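/- A polyhedron is a compact set $P\subset\mathbb R^3$, not necessarily convex, that is a finite union of finite intersections of closed half-spaces, is the closure of its interior, and has connected interior. Call a boundary point flat if $P$ coincides near it with a closed half-space. The faces of $P$ are the closures of the connected components of the set of flat boundary points, the edge length $e(P)$ is the total length (one-dimensional Hausdorff measure) of the set of non-flat boundary points, and the Melzak ratio is $m(P)=e(P)^3/v(P)$, where $v(P)$ is the volume. A face $F$ is exposed if it is contained in an open set $U_F$ such that $U_F\cap P$ is convex. The angle deficit of $P$ at a vertex $H$ is $2\pi-\sum_i\alpha_i$, where the $\alpha_i$ are the angles at $H$ of the faces of $P$ that contain $H$. **Theorem.** Let $P$ be a polyhedron with an exposed triangular face $F$ such that the sum of the angle deficits of $P$ at the three vertices of $F$ is at most $\pi/2$. Then $P$ can be perturbed, by rotating the plane of $F$ about one of the edges of $F$, to polyhedra with the same number of faces and strictly smaller Melzak ratio. More precisely, there are a convex open set $U\supseteq F$ such that $U\cap P$ is convex, an edge $L$ of $F$, one of the two senses of rotation about $L$, and $\varepsilon>0$ with the following property. For $\theta\ge 0$ let $P_\theta$ coincide with $P$ outside $U$, and let $P_\theta\cap U$ be the intersection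 with $U$ of the half-spaces that bound $P$ along its faces meeting $U$, except that the half-space belonging to $F$ is replaced by its image under the rotation by the angle $\theta$ about $L$ in the chosen sense. Then $P_0=P$, and for every $0<\theta\le\varepsilon$ the set $P_\theta$ is a polyhedron with the same number of faces as $P$ and $m(P_\theta)<m(P)$. -/

import Mathlib

open Set Filter Topology MeasureTheory

/-- Euclidean three-space. -/
abbrev E3 : Type := EuclideanSpace ℝ (Fin 3)

/-- `H` is a closed half-space of three-space. -/
def IsHalfspace (H : Set E3) : Prop :=
  ∃ n : E3, n ≠ 0 ∧ ∃ c : ℝ, H = {x | inner ℝ n x ≤ c}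

/-- The sets `P` and `H` coincide in a neighbourhood of the point `x`. -/
def AgreeNear (P H : Set E3) (x : E3) : Prop :=
  ∀ᶠ y in 𝓝 x, (y ∈ P ↔ y ∈ H)

/-- A (solid, not necessarily convex) polyhedron: a compact set that is the closure of its
interior, whose interior is connected (in particular non-empty), and that is a finite union
of finite intersections of closed half-spaces. -/
structure IsPolyhedron (P : Set E3) : Prop where
  isCompact : IsCompact P
  closure_interior : closure (interior P) = P
  isConnected_interior : IsConnected (interior P)
  polyhedral : ∃ S : Set (Set E3), S.Finite ∧
    (∀ K ∈ S, ∃ T : Set (Set E3), T.Finite ∧ (∀ H ∈ T, IsHalfspace H) ∧ K = ⋂₀ T) ∧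
    P = ⋃₀ S

/-- The points in the relative interior of faces: boundary points of `P` near which `P`
coincides with a closed half-space. -/
def flatPoints (P : Set E3) : Set E3 :=
  {x | x ∈ frontier P ∧ ∃ H, IsHalfspace H ∧ AgreeNear P H x}

/-- The faces of `P`: the closures of the connected components of the flat part of the
boundary (each of these components lies in a plane). -/
def faces (P : Set E3) : Set (Set E3) :=
  {F | ∃ x ∈ flatPoints P, F = closure (connectedComponentIn (flatPoints P) x)}

/-- The union of all edges (and vertices) of `P`: the boundary points that are not flat. -/
def edgeSkeleton (P : Set E3) : Set E3 :=
  frontier P \ flatPoints P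

/-- The total edge length of `P`. -/
noncomputable def edgeLength (P : Set E3) : ℝ :=
  (Measure.hausdorffMeasure 1 (edgeSkeleton P)).toReal

/-- The Melzak ratio of `P`: the cube of the edge length divided by the volume. -/
noncomputable def melzakRatio (P : Set E3) : ℝ :=
  edgeLength P ^ 3 / (volume P).toReal

/-- The face `F` of `P` is exposed: it has an open neighbourhood whose intersection with `P`
is convex. -/
def IsExposedFace (P F : Set E3) : Prop :=
  F ∈ faces P ∧ ∃ U : Set E3, IsOpen U ∧ F ⊆ U ∧ Convex ℝ (U ∩ P)

/-- The angle of the planar polygonal region `F` at its point `p`: twice the area of the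
circular sector of radius one that consists of the vectors `v`, parallel to the plane of `F`,
along which `F` can be entered from `p`. The measure is the Lebesgue (area) measure of the
direction plane of `F`, normalized by an orthonormal basis. -/
noncomputable def faceAngle (F : Set E3) (p : E3) : ℝ :=
  2 * ((stdOrthonormalBasis ℝ (vectorSpan ℝ F)).toBasis.addHaar
    {v : vectorSpan ℝ F | ‖v‖ ≤ 1 ∧ ∀ᶠ r : ℝ in 𝓝[>] 0, p + r • (v : E3) ∈ F}).toReal

/-- The angle deficit of `P` at the vertex `p`: `2π` minus the sum of the angles at `p` of the
faces of `P` that contain `p`. -/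
noncomputable def angleDeficit (P : Set E3) (p : E3) : ℝ :=
  2 * Real.pi - ∑ᶠ F ∈ {F | F ∈ faces P ∧ p ∈ F}, faceAngle F p

/-- The closed half-spaces that bound `P` along its faces inside `U`. -/
def faceHalfspaces (P U : Set E3) : Set (Set E3) :=
  {H | IsHalfspace H ∧ ∃ x ∈ U ∩ frontier P, AgreeNear P H x}

/-- For `n, m` orthonormal: the half-space through `a` with outward normal `n`, rotated by the
angle `θ` about the line through `a` orthogonal to both `n` and `m`. -/
noncomputable def rotatedHalfspace (a n m : E3) (θ : ℝ) : Set E3 :=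
  {x | inner ℝ (Real.cos θ • n + Real.sin θ • m) (x - a) ≤ 0}

/-- Vectors that describe a rotation, about the edge opposite to the vertex `A i`, of the plane
of the triangular face of `P` with vertices `A 0, A 1, A 2`: `n` is the unit normal of the face
that is outward for `P` (inside the neighbourhood `U` of the face), and `m` is one of the two
unit vectors orthogonal to `n` and to the edge. The choice of `m` is the choice of the sense
(outward or inward) of the rotation. -/
structure IsRotationFrame (P U : Set E3) (A : Fin 3 → E3) (i : Fin 3) (n m : E3) : Prop where
  norm_n : ‖n‖ = 1
  norm_m : ‖m‖ = 1
  orthogonal : inner ℝ n m = 0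
  normal : ∀ j, inner ℝ n (A j - A (i + 1)) = 0
  outward : ∀ x ∈ U ∩ P, inner ℝ n (x - A (i + 1)) ≤ 0
  axis : inner ℝ m (A (i + 2) - A (i + 1)) = 0

/-- The polyhedron `P` with the plane of one face rotated by the angle `θ`: inside `U`, where `P`
is the intersection of the half-spaces of its faces, the half-space
`rotatedHalfspace a n m 0` of the face is replaced by its rotated copy and the other
half-spaces are kept; outside `U` nothing changes. -/
noncomputable def rotateFace (P U : Set E3) (a n m : E3) (θ : ℝ) : Set E3 :=
  (P \ U) ∪
    (U ∩ (rotatedHalfspace a n m θ ∩ ⋂₀ (faceHalfspaces P U \ {rotatedHalfspace a n m 0})))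

/-!
The plane of the triangle is rotated outwards about the side `B C` opposite to a suitable vertex
`A`. Let `z` be the outward unit direction of the line in which the planes of the two faces
adjacent to `A B` and `A C` meet. Rotating the plane of the triangle about `B C` attaches to `P` a
flat tetrahedron with base `A B C` and apex `A + t • z`, where `t` tends to zero with the angle
(`IsTriangleCorner.exists_rotation`, `IsTriangleCorner.inter_union_eq`). The volume does not
decrease. The two lateral faces of the tetrahedron that contain the edge from `A` to `A + t • z`
prolong the adjacent faces of `P` and the third one replaces the triangle, so the number of faces
is unchanged (`IsTriangleCorner.encard_faces_union`). The sides `A B` and `A C` disappear as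
edges, and the three edges from `A + t • z` to `A`, `B` and `C` are new
(`IsTriangleCorner.edgeLength_union_le`). With `β = ∠(B - A, -z)` and `γ = ∠(C - A, -z)` the
derivative of the edge length with respect to `t` at `0` is at most `1 + cos β + cos γ`, which is
negative when `β + γ ≥ 3π/2` (`IsTriangleCorner.exists_edges_lt`).

It remains to find a vertex with `β + γ ≥ 3π/2`. At each vertex the angles of the faces of `P` add
up to at most `α + β + γ`, where `α` is the angle of the triangle: near the vertex `P` is a convex
cone contained in the trihedral cone with edge directions `B - A`, `C - A` and `-z`, and the total
angle at the apex is monotone in convex cones (`IsTriangleCorner.finsum_faceAngle_le`). Summing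
over the vertices, the deficit condition gives `6π - π - ∑ (β + γ) ≤ π/2`, so that some `β + γ` is
at least `3π/2`. Monotonicity is proved by integral geometry (`sum_area_le`): the total angle of
the facets of a cone is proportional to the average number of facets that a random plane through
the apex meets outside the apex. Almost every plane meets at most two facets of a convex cone, and
if it meets one then it meets two facets of the larger trihedral cone.

The local structure of `P` comes from two facts. Membership in a polyhedron depends only on the
position relative to finitely many planes (`IsPolyhedron.exists_isArrangement`), so boundary
points off the pairwise intersections of these planes are flat. Hence, in an open set where `P` is
convex, `P` is the intersection of the half-spaces of its faces (`IsPolyhedron.inter_eq`), and the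
sides of the triangle lie on the planes of further faces (`exists_isTriangleCorner`).
-/

/-! ### Half-spaces and flat points -/

/-- The closed half-space with outward conormal `φ` whose boundary passes through `a`. -/
def hsp (φ : StrongDual ℝ E3) (a : E3) : Set E3 := {x | φ (x - a) ≤ 0}

theorem mem_hsp {φ : StrongDual ℝ E3} {a x : E3} : x ∈ hsp φ a ↔ φ (x - a) ≤ 0 := Iff.rfl

theorem hsp_eq_of_apply_eq {φ : StrongDual ℝ E3} {a b : E3} (h : φ a = φ b) :
    hsp φ a = hsp φ b := by
  ext x; simp [hsp, h]

theorem hsp_smul {φ : StrongDual ℝ E3} {a : E3} {r : ℝ} (hr : 0 < r) :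
    hsp (r • φ) a = hsp φ a := by
  ext x
  simp only [hsp, mem_ofPred_eq, smul_apply, smul_eq_mul]
  constructor <;> intro h <;> nlinarith

theorem convex_hsp (φ : StrongDual ℝ E3) (a : E3) : Convex ℝ (hsp φ a) := by
  have : hsp φ a = {x | φ x ≤ φ a} := by ext x; simp [hsp]
  rw [this]
  exact convex_halfSpace_le φ.toLinearMap.isLinear _

theorem exists_dual_apply_eq_one {φ : StrongDual ℝ E3} (hφ : φ ≠ 0) : ∃ v, φ v = 1 := by
  obtain ⟨v, hv⟩ := ContinuousLinearMap.exists_ne_zero hφ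
  exact ⟨(φ v)⁻¹ • v, by simp [hv]⟩

theorem exists_dual_apply_eq {φ : StrongDual ℝ E3} (hφ : φ ≠ 0) (r : ℝ) : ∃ v, φ v = r := by
  obtain ⟨v, hv⟩ := exists_dual_apply_eq_one hφ
  exact ⟨r • v, by simp [hv]⟩

theorem isHalfspace_iff {H : Set E3} :
    IsHalfspace H ↔ ∃ φ : StrongDual ℝ E3, φ ≠ 0 ∧ ∃ a, H = hsp φ a := by
  constructor
  · rintro ⟨n, hn, c, rfl⟩
    have hφ : innerSL ℝ n ≠ 0 := by
      intro h
      apply hn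
      have := congrArg (fun f : StrongDual ℝ E3 => f n) h
      simpa using this
    obtain ⟨a, ha⟩ := exists_dual_apply_eq hφ c
    refine ⟨_, hφ, a, ?_⟩
    ext x
    rw [mem_hsp, map_sub, ha, sub_nonpos]
    rfl
  · rintro ⟨φ, hφ, a, rfl⟩
    refine ⟨(InnerProductSpace.toDual ℝ E3).symm φ, by simpa using hφ, φ a, ?_⟩
    ext x
    rw [mem_hsp, map_sub, sub_nonpos, mem_ofPred_eq, InnerProductSpace.toDual_symm_apply]

theorem isHalfspace_hsp {φ : StrongDual ℝ E3} (hφ : φ ≠ 0) (a : E3) : IsHalfspace (hsp φ a) :=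
  isHalfspace_iff.2 ⟨φ, hφ, a, rfl⟩

/-- A neighbourhood of `x` contains an initial piece of each ray from `x`. -/
theorem eventually_ray {p : E3 → Prop} {x : E3} (h : ∀ᶠ y in 𝓝 x, p y) (v : E3) :
    ∀ᶠ r : ℝ in 𝓝[>] 0, p (x + r • v) := by
  have : Tendsto (fun r : ℝ => x + r • v) (𝓝 0) (𝓝 x) := by
    have : Continuous fun r : ℝ => x + r • v := by fun_prop
    simpa using this.tendsto 0
  exact (this.eventually h).filter_mono nhdsWithin_le_nhds

theorem exists_pos_ray {p : E3 → Prop} {x : E3} (h : ∀ᶠ y in 𝓝 x, p y) (v : E3) :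
    ∃ r : ℝ, 0 < r ∧ p (x + r • v) := by
  obtain ⟨r, hr, hr'⟩ := ((eventually_ray h v).and self_mem_nhdsWithin).exists
  exact ⟨r, hr', hr⟩

/-- A half-space through the origin determines its conormal up to a nonnegative factor. -/
theorem exists_smul_of_imp {φ ψ : StrongDual ℝ E3}
    (h : ∀ v, φ v ≤ 0 → ψ v ≤ 0) : ∃ r : ℝ, 0 ≤ r ∧ ψ = r • φ := by
  by_cases hφ : φ = 0
  · refine ⟨0, le_rfl, ?_⟩
    ext v
    have h1 := h v (by simp [hφ])
    have h2 := h (-v) (by simp [hφ])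
    simp at h2 ⊢
    linarith
  obtain ⟨e, he⟩ := exists_dual_apply_eq_one hφ
  refine ⟨ψ e, ?_, ?_⟩
  · have := h (-e) (by simp [he])
    simpa using this
  ext v
  have h1 := h (v - φ v • e) (by simp [he])
  have h2 := h (-(v - φ v • e)) (by simp [he])
  simp only [map_neg, map_sub, map_smul, smul_eq_mul, smul_apply] at h1 h2 ⊢
  linarith

theorem AgreeNear.mem {P : Set E3} {φ : StrongDual ℝ E3} {x : E3}
    (h : AgreeNear P (hsp φ x) x) : x ∈ P :=
  h.self_of_nhds.2 (by simp [hsp])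

/-- A functional that is maximal on `P` at a flat point, at least locally, is a nonnegative
multiple of the outward conormal there. -/
theorem AgreeNear.exists_smul {P : Set E3} {φ ψ : StrongDual ℝ E3} {x : E3}
    (h : AgreeNear P (hsp φ x) x) (hψ : ∀ᶠ y in 𝓝 x, y ∈ P → ψ (y - x) ≤ 0) :
    ∃ r : ℝ, 0 ≤ r ∧ ψ = r • φ := by
  refine exists_smul_of_imp fun v hv => ?_
  obtain ⟨r, hr, h1, h2⟩ := exists_pos_ray (h.and hψ) v
  have := h2 (h1.2 (by simp [hsp]; nlinarith))
  simp at this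
  exact nonpos_of_mul_nonpos_right this hr

/-- A half-space that contains `P` near a flat point and has that point on its boundary is the
half-space of the flat point. -/
theorem AgreeNear.hsp_eq {P : Set E3} {φ ψ : StrongDual ℝ E3} {x : E3} (hψ0 : ψ ≠ 0)
    (h : AgreeNear P (hsp φ x) x) (hψ : ∀ᶠ y in 𝓝 x, y ∈ P → ψ (y - x) ≤ 0) :
    hsp ψ x = hsp φ x := by
  obtain ⟨r, hr, rfl⟩ := h.exists_smul hψ
  refine hsp_smul (lt_of_le_of_ne hr ?_)
  rintro rfl
  simp at hψ0

/-- Near a flat point the boundary points are flat, with the same half-space. -/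
theorem AgreeNear.eventually_agree {P : Set E3} {φ : StrongDual ℝ E3} {x : E3}
    (h : AgreeNear P (hsp φ x) x) :
    ∀ᶠ y in 𝓝 x, φ (y - x) = 0 → AgreeNear P (hsp φ y) y := by
  filter_upwards [h.eventually_nhds] with y hy h0
  have : hsp φ y = hsp φ x := hsp_eq_of_apply_eq (by simpa [sub_eq_zero] using h0)
  rwa [this]

theorem frontier_hsp_subset {φ : StrongDual ℝ E3} {a x : E3} (hx : x ∈ frontier (hsp φ a)) :
    φ (x - a) = 0 := by
  have h : frontier {x : E3 | φ (x - a) ≤ 0} ⊆ {x | φ (x - a) = 0} :=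
    frontier_le_subset_eq (by fun_prop) continuous_const
  exact h hx

theorem mem_frontier_iff_of_eventually {P Q : Set E3} {x : E3}
    (h : ∀ᶠ y in 𝓝 x, (y ∈ P ↔ y ∈ Q)) : x ∈ frontier P ↔ x ∈ frontier Q := by
  have key : ∀ {P Q : Set E3}, (∀ᶠ y in 𝓝 x, (y ∈ P ↔ y ∈ Q)) → x ∈ frontier P →
      x ∈ frontier Q := by
    intro P Q h hx
    rw [frontier_eq_closure_inter_closure] at hx ⊢
    rw [mem_inter_iff, mem_closure_iff_frequently, mem_closure_iff_frequently] at hx ⊢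
    exact ⟨(hx.1.and_eventually h).mono fun y hy => hy.2.1 hy.1,
      (hx.2.and_eventually h).mono fun y hy hq => hy.1 (hy.2.2 hq)⟩
  exact ⟨key h, key (h.mono fun _ => Iff.symm)⟩

theorem AgreeNear.mem_frontier {P : Set E3} {φ : StrongDual ℝ E3} (hφ : φ ≠ 0) {x : E3}
    (h : AgreeNear P (hsp φ x) x) : x ∈ frontier P := by
  rw [mem_frontier_iff_of_eventually h, frontier_eq_closure_inter_closure]
  refine ⟨subset_closure (by simp [hsp]), ?_⟩
  rw [mem_closure_iff_frequently]
  obtain ⟨v, hv⟩ := exists_dual_apply_eq_one hφ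
  intro hn
  obtain ⟨r, hr, h'⟩ := exists_pos_ray hn v
  apply h'
  simp [hsp, hv, hr]

/-- The half-space of a flat point may be taken with the point on its boundary. -/
theorem mem_flatPoints_iff {P : Set E3} {x : E3} :
    x ∈ flatPoints P ↔ ∃ φ : StrongDual ℝ E3, φ ≠ 0 ∧ AgreeNear P (hsp φ x) x := by
  constructor
  · rintro ⟨hx, H, hH, h⟩
    obtain ⟨φ, hφ, a, rfl⟩ := isHalfspace_iff.1 hH
    refine ⟨φ, hφ, ?_⟩
    have h0 := frontier_hsp_subset ((mem_frontier_iff_of_eventually h).1 hx)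
    rwa [hsp_eq_of_apply_eq (show φ x = φ a by simpa [sub_eq_zero] using h0)]
  · rintro ⟨φ, hφ, h⟩
    exact ⟨h.mem_frontier hφ, _, isHalfspace_hsp hφ x, h⟩

theorem AgreeNear.eventually_of_mem_frontier {P : Set E3} {φ : StrongDual ℝ E3} {x : E3}
    (h : AgreeNear P (hsp φ x) x) :
    ∀ᶠ y in 𝓝 x, y ∈ frontier P → φ (y - x) = 0 := by
  filter_upwards [h.eventually_nhds] with y hy h0
  exact frontier_hsp_subset ((mem_frontier_iff_of_eventually hy).1 h0)

/-- Flat points have connected neighbourhoods in the set of flat points. -/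
theorem eventually_mem_connectedComponentIn {P : Set E3} {x : E3} (hx : x ∈ flatPoints P) :
    ∀ᶠ y in 𝓝 x, y ∈ flatPoints P → y ∈ connectedComponentIn (flatPoints P) x := by
  obtain ⟨φ, hφ, h⟩ := mem_flatPoints_iff.1 hx
  obtain ⟨ε, hε, hball⟩ := Metric.eventually_nhds_iff_ball.1
    (h.eventually_agree.and h.eventually_of_mem_frontier)
  have hsub : Metric.ball x ε ∩ {y | φ (y - x) = 0} ⊆ flatPoints P := fun y hy =>
    mem_flatPoints_iff.2 ⟨φ, hφ, (hball y hy.1).1 hy.2⟩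
  have hconv : Convex ℝ (Metric.ball x ε ∩ {y | φ (y - x) = 0}) := by
    refine (convex_ball x ε).inter ?_
    have : {y : E3 | φ (y - x) = 0} = {y | φ y = φ x} := by ext y; simp [sub_eq_zero]
    rw [this]
    exact convex_hyperplane φ.toLinearMap.isLinear _
  filter_upwards [Metric.ball_mem_nhds x hε] with y hy hyf
  exact hconv.isPreconnected.subset_connectedComponentIn
    ⟨Metric.mem_ball_self hε, by simp⟩ hsub ⟨hy, (hball y hy).2 hyf.1⟩

/-- The connected components of the set of flat points are relatively closed in it. -/
theorem mem_connectedComponentIn_of_mem_closure {P : Set E3} {x y : E3}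
    (hy : y ∈ closure (connectedComponentIn (flatPoints P) x))
    (hyf : y ∈ flatPoints P) : y ∈ connectedComponentIn (flatPoints P) x := by
  rw [mem_closure_iff_frequently] at hy
  obtain ⟨z, hz, hz'⟩ := (hy.and_eventually (eventually_mem_connectedComponentIn hyf)).exists
  have h1 := connectedComponentIn_eq (hz' (connectedComponentIn_subset _ _ hz))
  rw [connectedComponentIn_eq hz, ← h1]
  exact mem_connectedComponentIn hyf

/-- A property that is locally constant on a preconnected set is constant on it. -/
theorem IsPreconnected.forall_of_eventually_iff {X : Type*} [TopologicalSpace X] {s : Set X}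
    (hs : IsPreconnected s) {p : X → Prop} (h : ∀ x ∈ s, ∀ᶠ y in 𝓝 x, y ∈ s → (p x ↔ p y))
    {x : X} (hx : x ∈ s) (hp : p x) : ∀ y ∈ s, p y := by
  intro y hy
  have := hs.induction₂ (fun a b => p a ↔ p b)
    (fun a ha => eventually_nhdsWithin_iff.2 (h a ha)) (fun a b c _ _ _ => Iff.trans)
    (fun a b _ _ => Iff.symm) hx hy
  exact this.1 hp

/-- All points of a component of the flat part of the boundary have the same half-space. -/
theorem AgreeNear.of_mem_connectedComponentIn {P : Set E3} {φ : StrongDual ℝ E3} {x y : E3}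
    (hφ : φ ≠ 0) (h : AgreeNear P (hsp φ x) x)
    (hy : y ∈ connectedComponentIn (flatPoints P) x) :
    φ (y - x) = 0 ∧ AgreeNear P (hsp φ y) y := by
  refine isPreconnected_connectedComponentIn.forall_of_eventually_iff
    (p := fun y => φ (y - x) = 0 ∧ AgreeNear P (hsp φ y) y) ?_
    (mem_connectedComponentIn (mem_flatPoints_iff.2 ⟨φ, hφ, h⟩)) ⟨by simp, h⟩ y hy
  intro a ha
  obtain ⟨ψ, hψ, haψ⟩ := mem_flatPoints_iff.1 (connectedComponentIn_subset _ _ ha)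
  filter_upwards [haψ.eventually_agree, haψ.eventually_of_mem_frontier] with b h1 h2 hb
  have hbf := connectedComponentIn_subset _ _ hb
  have hb0 := h2 hbf.1
  have hbψ := h1 hb0
  have key : ∀ {u v : E3}, AgreeNear P (hsp ψ u) u → AgreeNear P (hsp ψ v) v → ψ (u - v) = 0 →
      φ (u - x) = 0 → AgreeNear P (hsp φ u) u → φ (v - x) = 0 ∧ AgreeNear P (hsp φ v) v := by
    intro u v hu hv huv hux huφ
    have hle : ∀ᶠ y in 𝓝 u, y ∈ P → φ (y - u) ≤ 0 := huφ.mono fun y hy hyP => hy.1 hyP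
    -- the half-spaces at `u` with conormals `φ` and `ψ` both describe `P`, so `φ` is a positive
    -- multiple of `ψ`
    obtain ⟨r, hr, rfl⟩ := hu.exists_smul hle
    have hr' : 0 < r := lt_of_le_of_ne hr (by rintro rfl; simp at hφ)
    refine ⟨?_, by rwa [hsp_smul hr']⟩
    have : v - x = (u - x) - (u - v) := by abel
    rw [this, map_sub, hux]
    simp [huv]
  constructor
  · rintro ⟨h3, h4⟩
    exact key haψ hbψ (by rw [← neg_sub, map_neg, hb0, neg_zero]) h3 h4
  · rintro ⟨h3, h4⟩
    exact key hbψ haψ hb0 h3 h4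

/-! ### Local convexity -/

/-- Where `P` is convex it lies on one side of the plane of each of its flat points. -/
theorem AgreeNear.le_of_convex {P U : Set E3} (hUP : Convex ℝ (U ∩ P))
    {φ : StrongDual ℝ E3} {x y : E3} (hx : x ∈ U) (h : AgreeNear P (hsp φ x) x)
    (hy : y ∈ U ∩ P) : φ (y - x) ≤ 0 := by
  obtain ⟨r, ⟨hr, hr1⟩, hr0⟩ := (((eventually_ray h (y - x)).and
    (nhdsWithin_le_nhds (eventually_lt_nhds (show (0 : ℝ) < 1 by norm_num)))).and
      self_mem_nhdsWithin).exists
  have hmem := hUP.add_smul_sub_mem ⟨hx, h.mem⟩ hy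
    (show r ∈ Icc (0 : ℝ) 1 from ⟨le_of_lt hr0, le_of_lt hr1⟩)
  have := hr.1 hmem.2
  simp only [hsp, mem_ofPred_eq, add_sub_cancel_left, map_smul, smul_eq_mul] at this
  exact nonpos_of_mul_nonpos_right this hr0

/-- Where `P` is convex, the half-open segment from a flat point to a point of `P` in the same
supporting plane consists of flat points: homotheties centred at the end point carry a
neighbourhood of the flat point to neighbourhoods of the points of the segment. -/
theorem AgreeNear.add_smul_sub {P U : Set E3} (hU : IsOpen U) (hUP : Convex ℝ (U ∩ P))
    {φ : StrongDual ℝ E3} {x y : E3} (hx : x ∈ U) (h : AgreeNear P (hsp φ x) x)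
    (hy : y ∈ U ∩ P) (hxy : φ (y - x) = 0) {s : ℝ} (hs : s ∈ Ico (0 : ℝ) 1) :
    AgreeNear P (hsp φ (x + s • (y - x))) (x + s • (y - x)) := by
  set z := x + s • (y - x) with hz
  have h1s : 0 < 1 - s := by linarith [hs.2]
  have hzUP : z ∈ U ∩ P := hUP.add_smul_sub_mem ⟨hx, h.mem⟩ hy ⟨hs.1, hs.2.le⟩
  have hφz : hsp φ z = hsp φ x := hsp_eq_of_apply_eq (by simp [hz, hxy])
  rw [hφz]
  have htend : Tendsto (fun u : E3 => (1 - s)⁻¹ • (u - s • y)) (𝓝 z) (𝓝 x) := by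
    have hc : Continuous fun u : E3 => (1 - s)⁻¹ • (u - s • y) := by fun_prop
    have : (1 - s)⁻¹ • (z - s • y) = x := by
      rw [hz, inv_smul_eq_iff₀ h1s.ne']
      module
    simpa [this] using hc.tendsto z
  filter_upwards [hU.mem_nhds hzUP.1, htend.eventually (h.and (hU.mem_nhds hx))] with u hu hu'
  constructor
  · exact fun huP => h.le_of_convex hUP hx ⟨hu, huP⟩
  · intro huH
    have hu1 : (1 - s)⁻¹ • (u - s • y) ∈ P := by
      refine hu'.1.2 ?_
      have : (1 - s)⁻¹ • (u - s • y) - x = (1 - s)⁻¹ • ((u - x) - s • (y - x)) := by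
        have h2 : (u - x) - s • (y - x) = (u - s • y) - (1 - s) • x := by module
        rw [h2, smul_sub _ (u - s • y), inv_smul_smul₀ h1s.ne']
      rw [mem_hsp, this, map_smul, map_sub, map_smul, hxy, smul_zero, sub_zero, smul_eq_mul]
      exact mul_nonpos_of_nonneg_of_nonpos (inv_nonneg.2 h1s.le) huH
    have := hUP.add_smul_sub_mem ⟨hu'.2, hu1⟩ hy ⟨hs.1, hs.2.le⟩
    have he : (1 - s)⁻¹ • (u - s • y) + s • (y - (1 - s)⁻¹ • (u - s • y)) = u := by
      have : (1 - s)⁻¹ • (u - s • y) + s • (y - (1 - s)⁻¹ • (u - s • y)) =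
        ((1 - s) * (1 - s)⁻¹) • (u - s • y) + s • y := by module
      rw [this, mul_inv_cancel₀ h1s.ne']
      module
    rw [he] at this
    exact this.2

theorem AgreeNear.add_smul_sub_mem_connectedComponentIn {P U : Set E3} (hU : IsOpen U)
    (hUP : Convex ℝ (U ∩ P)) {φ : StrongDual ℝ E3} (hφ : φ ≠ 0) {x y : E3} (hx : x ∈ U)
    (h : AgreeNear P (hsp φ x) x) (hy : y ∈ U ∩ P) (hxy : φ (y - x) = 0) {s : ℝ}
    (hs : s ∈ Ico (0 : ℝ) 1) :
    x + s • (y - x) ∈ connectedComponentIn (flatPoints P) x := by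
  have hconv : IsPreconnected ((fun s : ℝ => x + s • (y - x)) '' Ico (0 : ℝ) 1) :=
    isPreconnected_Ico.image _ (by fun_prop)
  refine hconv.subset_connectedComponentIn ⟨0, by simp, by simp⟩ ?_ ⟨s, hs, rfl⟩
  rintro _ ⟨r, hr, rfl⟩
  exact mem_flatPoints_iff.2 ⟨φ, hφ, h.add_smul_sub hU hUP hx hy hxy hr⟩

theorem AgreeNear.mem_closure_connectedComponentIn {P U : Set E3} (hU : IsOpen U)
    (hUP : Convex ℝ (U ∩ P)) {φ : StrongDual ℝ E3} (hφ : φ ≠ 0) {x y : E3} (hx : x ∈ U)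
    (h : AgreeNear P (hsp φ x) x) (hy : y ∈ U ∩ P) (hxy : φ (y - x) = 0) :
    y ∈ closure (connectedComponentIn (flatPoints P) x) := by
  have hc : ContinuousOn (fun s : ℝ => x + s • (y - x)) (closure (Ico (0 : ℝ) 1)) := by fun_prop
  have h1 : (1 : ℝ) ∈ closure (Ico (0 : ℝ) 1) := by
    rw [closure_Ico (by norm_num)]; simp
  have := hc.image_closure ⟨1, h1, rfl⟩
  simp only [one_smul, add_sub_cancel] at this
  refine closure_mono ?_ this
  rintro _ ⟨r, hr, rfl⟩
  exact h.add_smul_sub_mem_connectedComponentIn hU hUP hφ hx hy hxy hr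

/-- Where `P` is convex, two flat points in the same supporting plane lie in the same face. -/
theorem AgreeNear.connectedComponentIn_eq {P U : Set E3} (hU : IsOpen U)
    (hUP : Convex ℝ (U ∩ P)) {φ : StrongDual ℝ E3} (hφ : φ ≠ 0) {x y : E3} (hx : x ∈ U)
    (h : AgreeNear P (hsp φ x) x) (hy : y ∈ U) (hyf : y ∈ flatPoints P) (hyP : y ∈ P)
    (hxy : φ (y - x) = 0) :
    connectedComponentIn (flatPoints P) x = connectedComponentIn (flatPoints P) y :=
  _root_.connectedComponentIn_eq (mem_connectedComponentIn_of_mem_closure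
    (h.mem_closure_connectedComponentIn hU hUP hφ hx ⟨hy, hyP⟩ hxy) hyf)

/-! ### Arrangements of planes -/

/-- `G` is a finite set of pairs `(φ, k)`, standing for the planes `φ = k`, such that
membership in `P` depends only on the half-spaces `φ ≤ k` to which a point belongs. -/
structure IsArrangement (G : Set (StrongDual ℝ E3 × ℝ)) (P : Set E3) : Prop where
  finite : G.Finite
  ne_zero : ∀ g ∈ G, g.1 ≠ 0
  mem_of_iff : ∀ y z, (∀ g ∈ G, (g.1 y ≤ g.2 ↔ g.1 z ≤ g.2)) → y ∈ P → z ∈ P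

theorem IsPolyhedron.exists_isArrangement {P : Set E3} (hP : IsPolyhedron P) :
    ∃ G, IsArrangement G P := by
  obtain ⟨S, hS, hT, rfl⟩ := hP.polyhedral
  choose! T hTfin hTH hTK using hT
  have hrep : ∀ H : Set E3, IsHalfspace H →
      ∃ g : StrongDual ℝ E3 × ℝ, g.1 ≠ 0 ∧ H = {x | g.1 x ≤ g.2} := by
    intro H hH
    obtain ⟨φ, hφ, a, rfl⟩ := isHalfspace_iff.1 hH
    exact ⟨(φ, φ a), hφ, by ext x; simp [hsp]⟩
  choose! f hf0 hf using hrep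
  refine ⟨f '' ⋃ K ∈ S, T K, (hS.biUnion hTfin).image f, ?_, ?_⟩
  · rintro _ ⟨H, hH, rfl⟩
    simp only [mem_iUnion] at hH
    obtain ⟨K, hK, hH⟩ := hH
    exact hf0 H (hTH K hK H hH)
  · intro y z h hy
    obtain ⟨K, hK, hyK⟩ := hy
    refine ⟨K, hK, ?_⟩
    rw [hTK K hK] at hyK ⊢
    intro H hH
    have h1 := h (f H) ⟨H, by simp only [mem_iUnion]; exact ⟨K, hK, hH⟩, rfl⟩
    have h2 := hf H (hTH K hK H hH)
    have h3 := hyK H hH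
    rw [h2] at h3 ⊢
    exact h1.1 h3

/-- Points off finitely many planes are dense. -/
theorem dense_forall_apply_ne {ι : Type*} {s : Set ι} (hs : s.Finite)
    {ψ : ι → StrongDual ℝ E3} {k : ι → ℝ} (h : ∀ i ∈ s, ψ i ≠ 0 ∨ k i ≠ 0) :
    Dense {x | ∀ i ∈ s, ψ i x ≠ k i} := by
  have : {x | ∀ i ∈ s, ψ i x ≠ k i} = ⋂ i ∈ s, {x | ψ i x ≠ k i} := by
    ext x; simp
  rw [this]
  refine dense_biInter_of_isOpen (fun i _ => ?_) hs.countable fun i hi => ?_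
  · exact isOpen_ne_fun (by fun_prop) (by fun_prop)
  · by_cases h0 : ψ i = 0
    · have : {x : E3 | ψ i x ≠ k i} = univ := by
        ext x
        simpa [h0] using ((h i hi).resolve_left (by simp [h0])).symm
      rw [this]; exact dense_univ
    · obtain ⟨v, hv⟩ := exists_dual_apply_eq_one h0
      intro x
      rw [mem_closure_iff_frequently]
      intro hn
      have hn' : ∀ᶠ y in 𝓝 x, ψ i y = k i := hn.mono fun y hy => by simpa using hy
      obtain ⟨r, hr, h1⟩ := exists_pos_ray hn' v
      have h2 := hn'.self_of_nhds
      simp [hv] at h1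
      linarith

theorem IsArrangement.eventually_iff {G : Set (StrongDual ℝ E3 × ℝ)} {P : Set E3}
    (hG : IsArrangement G P) (x : E3) :
    ∀ᶠ y in 𝓝 x, ∀ g ∈ G, g.1 x ≠ g.2 → (g.1 y ≤ g.2 ↔ g.1 x ≤ g.2) := by
  refine (eventually_all_finite hG.finite).2 fun g _ => ?_
  by_cases hg : g.1 x = g.2
  · simp [hg]
  rcases lt_or_gt_of_ne hg with h | h
  · filter_upwards [(g.1.continuous.tendsto x).eventually (eventually_lt_nhds h)] with y hy _
    exact ⟨fun _ => h.le, fun _ => hy.le⟩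
  · filter_upwards [(g.1.continuous.tendsto x).eventually (eventually_gt_nhds h)] with y hy _
    exact ⟨fun h' => absurd h' (not_le.2 hy), fun h' => absurd h' (not_le.2 h)⟩

theorem IsArrangement.exists_of_mem_frontier {G : Set (StrongDual ℝ E3 × ℝ)} {P : Set E3}
    (hG : IsArrangement G P) {x : E3} (hx : x ∈ frontier P) : ∃ g ∈ G, g.1 x = g.2 := by
  by_contra! hne
  have h := hG.eventually_iff x
  rw [frontier_eq_closure_inter_closure, mem_inter_iff, mem_closure_iff_frequently,
    mem_closure_iff_frequently] at hx
  obtain ⟨y, hy, hy'⟩ := (hx.1.and_eventually h).exists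
  obtain ⟨z, hz, hz'⟩ := (hx.2.and_eventually h).exists
  exact hz (hG.mem_of_iff y z (fun g hg => (hy' g hg (hne g hg)).trans
    (hz' g hg (hne g hg)).symm) hy)

/-- A boundary point of a polyhedron that lies on only one plane of the arrangement is flat;
so the points that are not flat lie on the lines in which two planes meet. -/
theorem IsArrangement.exists_of_mem_edgeSkeleton {G : Set (StrongDual ℝ E3 × ℝ)} {P : Set E3}
    (hG : IsArrangement G P) (hP : IsPolyhedron P) {x : E3} (hx : x ∈ edgeSkeleton P) :
    ∃ g ∈ G, ∃ g' ∈ G, g.1 x = g.2 ∧ g'.1 x = g'.2 ∧ ∀ r : ℝ, g'.1 ≠ r • g.1 := by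
  by_contra! hcon
  obtain ⟨g, hg, hgx⟩ := hG.exists_of_mem_frontier hx.1
  have hmul : ∀ g' ∈ G, g'.1 x = g'.2 → ∃ r : ℝ, g'.1 = r • g.1 :=
    fun g' hg' h => hcon g hg g' hg' hgx h
  obtain ⟨ε, hε, hball⟩ := Metric.eventually_nhds_iff_ball.1 (hG.eventually_iff x)
  have hxP : x ∈ P := hP.isCompact.isClosed.frontier_subset hx.1
  -- near `x` membership depends only on the sign of the one functional
  have hsign : ∀ y ∈ Metric.ball x ε, ∀ z ∈ Metric.ball x ε,
      (g.1 (y - x) ≤ 0 ↔ g.1 (z - x) ≤ 0) → (0 ≤ g.1 (y - x) ↔ 0 ≤ g.1 (z - x)) →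
      y ∈ P → z ∈ P := by
    intro y hy z hz h1 h2
    refine hG.mem_of_iff y z fun g' hg' => ?_
    by_cases hg'x : g'.1 x = g'.2
    · obtain ⟨r, hr⟩ := hmul g' hg' hg'x
      have e : ∀ u, g'.1 u ≤ g'.2 ↔ r * g.1 (u - x) ≤ 0 := by
        intro u
        rw [← hg'x, hr]
        simp [mul_sub]
      rw [e, e]
      rcases lt_trichotomy r 0 with hr0 | hr0 | hr0
      · constructor <;> intro h3
        · have := h2.1 (nonneg_of_mul_nonpos_right h3 hr0); nlinarith
        · have := h2.2 (nonneg_of_mul_nonpos_right h3 hr0); nlinarith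
      · simp [hr0]
      · constructor <;> intro h3
        · have := h1.1 (nonpos_of_mul_nonpos_right h3 hr0); nlinarith
        · have := h1.2 (nonpos_of_mul_nonpos_right h3 hr0); nlinarith
    · rw [hball y hy g' hg' hg'x, hball z hz g' hg' hg'x]
  -- a point of `P` near `x` off the plane
  obtain ⟨p, hp, hpP, hp0⟩ : ∃ p ∈ Metric.ball x ε, p ∈ P ∧ g.1 (p - x) ≠ 0 := by
    have hx' : x ∈ closure (interior P) := by rwa [hP.closure_interior]
    obtain ⟨q, hq, hq'⟩ := mem_closure_iff.1 hx' _ Metric.isOpen_ball (Metric.mem_ball_self hε)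
    have hd := dense_forall_apply_ne (s := {()}) (ψ := fun _ => g.1) (k := fun _ => g.1 x)
      (finite_singleton _) (fun _ _ => Or.inl (hG.ne_zero g hg))
    obtain ⟨p, hp, hp'⟩ := hd.inter_open_nonempty _
      (Metric.isOpen_ball.inter isOpen_interior) ⟨q, hq, hq'⟩
    exact ⟨p, hp.1, interior_subset hp.2, by simpa [sub_eq_zero] using hp'⟩
  have main : ∀ φ : StrongDual ℝ E3, φ ≠ 0 → φ (p - x) < 0 →
      (∀ y ∈ Metric.ball x ε, ∀ z ∈ Metric.ball x ε, (φ (y - x) ≤ 0 ↔ φ (z - x) ≤ 0) →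
        (0 ≤ φ (y - x) ↔ 0 ≤ φ (z - x)) → y ∈ P → z ∈ P) → False := by
    intro φ hφ hpφ hs
    have hle : ∀ y ∈ Metric.ball x ε, φ (y - x) ≤ 0 → y ∈ P := by
      intro y hy h
      rcases h.lt_or_eq with h | h
      · exact hs p hp y hy (iff_of_true hpφ.le h.le) (iff_of_false hpφ.not_ge h.not_ge) hpP
      · exact hs x (Metric.mem_ball_self hε) y hy (by simp [h]) (by simp [h]) hxP
    have hgt : ∀ q ∈ Metric.ball x ε, q ∈ P → φ (q - x) ≤ 0 := by
      intro q hq hqP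
      by_contra! h
      refine hx.1.2 (mem_interior.2 ⟨_, fun y hy => ?_, Metric.isOpen_ball,
        Metric.mem_ball_self hε⟩)
      by_cases hy0 : φ (y - x) ≤ 0
      · exact hle y hy hy0
      · push Not at hy0
        exact hs q hq y hy (iff_of_false h.not_ge hy0.not_ge) (iff_of_true h.le hy0.le) hqP
    refine hx.2 (mem_flatPoints_iff.2 ⟨φ, hφ, ?_⟩)
    filter_upwards [Metric.ball_mem_nhds x hε] with y hy
    exact ⟨hgt y hy, hle y hy⟩
  rcases lt_or_gt_of_ne hp0 with h | h
  · exact main g.1 (hG.ne_zero g hg) h hsign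
  · refine main (-g.1) (by simpa using hG.ne_zero g hg) (by simpa using h) ?_
    intro y hy z hz h1 h2
    refine hsign y hy z hz ?_ ?_
    · simpa only [neg_apply, Left.nonneg_neg_iff] using h2
    · simpa only [neg_apply, Left.neg_nonpos_iff] using h1

/-- The plane of a flat point belongs to the arrangement: otherwise a generic boundary point near
the flat point lies on no plane of the arrangement. -/
theorem IsArrangement.exists_eq_smul {G : Set (StrongDual ℝ E3 × ℝ)} {P : Set E3}
    (hG : IsArrangement G P) {φ : StrongDual ℝ E3} (hφ : φ ≠ 0) {x : E3}
    (h : AgreeNear P (hsp φ x) x) :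
    ∃ g ∈ G, ∃ r : ℝ, r ≠ 0 ∧ g.1 = r • φ ∧ g.2 = r * φ x := by
  by_contra! hcon
  obtain ⟨e, he⟩ := exists_dual_apply_eq_one hφ
  have hd := dense_forall_apply_ne (s := G) (ψ := fun g => g.1 - g.1 e • φ)
    (k := fun g => g.2 - g.1 e * φ x) hG.finite (by
      intro g hg
      by_cases h0 : g.1 - g.1 e • φ = 0
      · right
        rw [sub_eq_zero] at h0
        have hr : g.1 e ≠ 0 := by
          intro h1
          apply hG.ne_zero g hg
          rw [h0, h1, zero_smul]
        exact fun h2 => hcon g hg _ hr h0 (by linarith)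
      · exact Or.inl h0)
  have hc : Continuous fun y : E3 => y - φ (y - x) • e := by fun_prop
  have ht : Tendsto (fun y : E3 => y - φ (y - x) • e) (𝓝 x) (𝓝 x) := by
    simpa using hc.tendsto x
  have hev := ht.eventually h.eventually_agree
  obtain ⟨O, hO, hOo, hxO⟩ := eventually_nhds_iff.1 hev
  obtain ⟨y, hy, hy'⟩ := hd.inter_open_nonempty O hOo ⟨x, hxO⟩
  obtain ⟨g, hg, hg'⟩ := hG.exists_of_mem_frontier
    ((hO y hy (by simp [he])).mem_frontier hφ)
  apply hy' g hg
  simp only [map_sub, map_smul, smul_eq_mul, sub_apply, smul_apply] at hg' ⊢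
  linarith

theorem mem_faceHalfspaces_iff {P U H : Set E3} :
    H ∈ faceHalfspaces P U ↔ ∃ x ∈ U, ∃ φ : StrongDual ℝ E3, φ ≠ 0 ∧
      AgreeNear P (hsp φ x) x ∧ H = hsp φ x := by
  constructor
  · rintro ⟨hH, x, hx, h⟩
    obtain ⟨φ, hφ, a, rfl⟩ := isHalfspace_iff.1 hH
    have h0 := frontier_hsp_subset ((mem_frontier_iff_of_eventually h).1 hx.2)
    have e : hsp φ a = hsp φ x :=
      hsp_eq_of_apply_eq (by rw [map_sub, sub_eq_zero] at h0; exact h0.symm)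
    exact ⟨x, hx.1, φ, hφ, by rwa [← e], e⟩
  · rintro ⟨x, hx, φ, hφ, h, rfl⟩
    exact ⟨isHalfspace_hsp hφ x, x, ⟨hx, h.mem_frontier hφ⟩, h⟩

theorem IsPolyhedron.finite_faceHalfspaces {P : Set E3} (hP : IsPolyhedron P) (U : Set E3) :
    (faceHalfspaces P U).Finite := by
  obtain ⟨G, hG⟩ := hP.exists_isArrangement
  refine ((hG.finite.image fun g => {x : E3 | g.1 x ≤ g.2}).union
    (hG.finite.image fun g => {x : E3 | g.2 ≤ g.1 x})).subset ?_
  intro H hH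
  obtain ⟨x, -, φ, hφ, h, rfl⟩ := mem_faceHalfspaces_iff.1 hH
  obtain ⟨g, hg, r, hr, h1, h2⟩ := hG.exists_eq_smul hφ h
  rcases lt_or_gt_of_ne hr with hr | hr
  · refine Or.inr ⟨g, hg, ?_⟩
    ext y
    simp only [mem_ofPred_eq, mem_hsp, h1, h2, smul_apply, smul_eq_mul, map_sub]
    constructor <;> intro h3 <;> nlinarith
  · refine Or.inl ⟨g, hg, ?_⟩
    ext y
    simp only [mem_ofPred_eq, mem_hsp, h1, h2, smul_apply, smul_eq_mul, map_sub]
    constructor <;> intro h3 <;> nlinarith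

theorem IsPreconnected.exists_mem_frontier {X : Type*} [TopologicalSpace X] {s t : Set X}
    (hs : IsPreconnected s) (h1 : (s ∩ t).Nonempty) (h2 : (s ∩ tᶜ).Nonempty) :
    (s ∩ frontier t).Nonempty := by
  by_contra! hne
  obtain ⟨x, hx, hxt⟩ := h1
  obtain ⟨y, hy, hyt⟩ := h2
  have hcov : s ⊆ interior t ∪ (closure t)ᶜ := by
    intro z hz
    by_contra hz'
    rw [mem_union, not_or, notMem_compl_iff] at hz'
    exact (hne ▸ ⟨hz, hz'.2, hz'.1⟩ : z ∈ (∅ : Set X))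
  obtain ⟨z, -, hz, hz'⟩ := hs _ _ isOpen_interior isClosed_closure.isOpen_compl hcov
    ⟨x, hx, (hcov hx).resolve_right fun h => h (subset_closure hxt)⟩
    ⟨y, hy, (hcov hy).resolve_left fun h => hyt (interior_subset h)⟩
  exact hz' (subset_closure (interior_subset hz))

/-- Where a polyhedron is convex, it is the intersection of the half-spaces of its faces. The
segment from a generic interior point to a point outside leaves the polyhedron at a flat point,
because the points that are not flat lie on finitely many lines. -/
theorem IsPolyhedron.inter_eq {P U : Set E3} (hP : IsPolyhedron P) (hU : IsOpen U)
    (hUc : Convex ℝ U) (hUP : Convex ℝ (U ∩ P)) (hne : (U ∩ P).Nonempty) :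
    U ∩ P = U ∩ ⋂₀ faceHalfspaces P U := by
  obtain ⟨G, hG⟩ := hP.exists_isArrangement
  apply Subset.antisymm
  · rintro y ⟨hy, hyP⟩
    refine ⟨hy, fun H hH => ?_⟩
    obtain ⟨x, hx, φ, hφ, h, rfl⟩ := mem_faceHalfspaces_iff.1 hH
    exact h.le_of_convex hUP hx ⟨hy, hyP⟩
  rintro y ⟨hy, hyH⟩
  refine ⟨hy, ?_⟩
  by_contra hyP
  obtain ⟨q, hq⟩ : (U ∩ interior P).Nonempty := by
    obtain ⟨a, haU, haP⟩ := hne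
    rw [← hP.closure_interior] at haP
    exact mem_closure_iff.1 haP U hU haU
  -- the generic point avoids the planes of the arrangement, and the planes spanned by `y` and
  -- the intersection lines of the arrangement
  have hd1 := dense_forall_apply_ne (s := G) (ψ := fun g => g.1) (k := fun g => g.2) hG.finite
    (fun g hg => Or.inl (hG.ne_zero g hg))
  let s : Set ((StrongDual ℝ E3 × ℝ) × (StrongDual ℝ E3 × ℝ)) :=
    {p ∈ G ×ˢ G | (∀ r : ℝ, p.2.1 ≠ r • p.1.1) ∧ p.1.1 y ≠ p.1.2}
  have hd2 := dense_forall_apply_ne (s := s)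
    (ψ := fun p => (p.1.1 y - p.1.2) • p.2.1 - (p.2.1 y - p.2.2) • p.1.1)
    (k := fun p => (p.1.1 y - p.1.2) * p.2.2 - (p.2.1 y - p.2.2) * p.1.2)
    ((hG.finite.prod hG.finite).subset fun p hp => hp.1) (by
      rintro p ⟨-, hp, hp0⟩
      left
      intro h
      rw [sub_eq_zero] at h
      have hne : p.1.1 y - p.1.2 ≠ 0 := sub_ne_zero.2 hp0
      refine hp ((p.1.1 y - p.1.2)⁻¹ * (p.2.1 y - p.2.2)) ?_
      rw [mul_smul, ← h, inv_smul_smul₀ hne])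
  obtain ⟨x1, hx1, hx1'⟩ := hd1.inter_open_nonempty _ (hU.inter isOpen_interior) ⟨q, hq⟩
  have hopen : IsOpen {x : E3 | ∀ g ∈ G, g.1 x ≠ g.2} := by
    have : {x : E3 | ∀ g ∈ G, g.1 x ≠ g.2} = ⋂ g ∈ G, {x | g.1 x ≠ g.2} := by ext; simp
    rw [this]
    exact hG.finite.isOpen_biInter fun g _ => isOpen_ne_fun (by fun_prop) (by fun_prop)
  obtain ⟨x, ⟨⟨hxU, hxint⟩, hxG⟩, hxs⟩ := hd2.inter_open_nonempty _
    ((hU.inter isOpen_interior).inter hopen) ⟨x1, hx1, hx1'⟩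
  obtain ⟨z, hz, hzf⟩ := (convex_segment x y).isPreconnected.exists_mem_frontier
    (t := P) ⟨x, left_mem_segment ℝ x y, interior_subset hxint⟩
      ⟨y, right_mem_segment ℝ x y, hyP⟩
  have hzU : z ∈ U := hUc.segment_subset hxU hy hz
  have hzP : z ∈ P := hP.isCompact.isClosed.frontier_subset hzf
  rw [segment_eq_image'] at hz
  obtain ⟨t, ht, rfl⟩ := hz
  have ht1 : t ≠ 1 := by
    rintro rfl
    apply hyP
    simpa using hzP
  have ht0 : t ≠ 0 := by
    rintro rfl
    apply hzf.2
    simpa using hxint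
  have ht1' : t < 1 := lt_of_le_of_ne ht.2 ht1
  have ht0' : 0 < t := lt_of_le_of_ne ht.1 ht0.symm
  have hflat : x + t • (y - x) ∈ flatPoints P := by
    by_contra hnf
    obtain ⟨g, hg, g', hg', h1, h2, h3⟩ := hG.exists_of_mem_edgeSkeleton hP ⟨hzf, hnf⟩
    simp only [map_add, map_sub, map_smul, smul_eq_mul] at h1 h2
    by_cases hgy : g.1 y = g.2
    · apply hxG g hg
      have : (1 - t) * (g.1 x - g.2) = 0 := by rw [← hgy] at h1 ⊢; linarith
      rcases mul_eq_zero.1 this with h | h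
      · linarith
      · linarith
    · apply hxs (g, g') ⟨⟨hg, hg'⟩, h3, hgy⟩
      simp only [sub_apply, smul_apply, smul_eq_mul]
      have : (1 - t) * (((g.1 y - g.2) * g'.1 x - (g'.1 y - g'.2) * g.1 x) -
        ((g.1 y - g.2) * g'.2 - (g'.1 y - g'.2) * g.2)) = 0 := by
        rw [← h1, ← h2]; ring
      rcases mul_eq_zero.1 this with h | h
      · linarith
      · linarith
  obtain ⟨φ, hφ, h⟩ := mem_flatPoints_iff.1 hflat
  have h1 := hyH _ (mem_faceHalfspaces_iff.2 ⟨_, hzU, φ, hφ, h, rfl⟩)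
  have h2 : φ (x - (x + t • (y - x))) < 0 := by
    have hev : ∀ᶠ u in 𝓝 x, u ∈ U ∩ P :=
      mem_of_superset ((hU.inter isOpen_interior).mem_nhds ⟨hxU, hxint⟩) fun u hu =>
        ⟨hu.1, interior_subset hu.2⟩
    obtain ⟨e, he⟩ := exists_dual_apply_eq_one hφ
    obtain ⟨r, hr, hr'⟩ := exists_pos_ray hev e
    have := h.le_of_convex hUP hzU hr'
    have h3 : x + r • e - (x + t • (y - x)) = (x - (x + t • (y - x))) + r • e := by abel
    rw [h3, map_add, map_smul, he] at this
    simp only [smul_eq_mul, mul_one] at this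
    linarith
  rw [mem_hsp] at h1
  simp only [map_sub, map_add, map_smul, smul_eq_mul] at h1 h2
  nlinarith

/-! ### Finiteness of the edge length -/

/-- Two independent functionals vanish together on a line. -/
theorem exists_ne_zero_and_forall_eq_smul {φ ψ : StrongDual ℝ E3} (hφ : φ ≠ 0)
    (h : ∀ r : ℝ, ψ ≠ r • φ) :
    ∃ v : E3, v ≠ 0 ∧ φ v = 0 ∧ ψ v = 0 ∧ ∀ u, φ u = 0 → ψ u = 0 → ∃ t : ℝ, u = t • v := by
  obtain ⟨e, he⟩ := exists_dual_apply_eq_one hφ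
  obtain ⟨f, hf, hf'⟩ : ∃ f, φ f = 0 ∧ ψ f = 1 := by
    have : ψ - ψ e • φ ≠ 0 := sub_ne_zero.2 (h _)
    obtain ⟨f, hf⟩ := exists_dual_apply_eq_one this
    refine ⟨f - φ f • e, by simp [he], ?_⟩
    simp at hf ⊢
    linarith
  let L : E3 →ₗ[ℝ] ℝ × ℝ := φ.toLinearMap.prod ψ.toLinearMap
  have hL : LinearMap.range L = ⊤ := by
    rw [LinearMap.range_eq_top]
    rintro ⟨a, b⟩
    refine ⟨a • e + (b - a * ψ e) • f, ?_⟩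
    simp [L, he, hf, hf']
  have h1 := L.finrank_range_add_finrank_ker
  rw [hL] at h1
  simp at h1
  have h2 : Module.finrank ℝ (LinearMap.ker L) = 1 := by omega
  obtain ⟨v, hv, hv'⟩ := finrank_eq_one_iff'.1 h2
  have hvk : φ v = 0 ∧ ψ v = 0 := Prod.mk_eq_zero.1 (LinearMap.mem_ker.1 v.2)
  refine ⟨v, by simpa using hv, hvk.1, hvk.2, fun u hu hu' => ?_⟩
  obtain ⟨c, hc⟩ := hv' ⟨u, by simp [L, hu, hu']⟩
  exact ⟨c, by simpa using (congrArg Subtype.val hc).symm⟩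

/-- The points of a polyhedron that are not flat lie on finitely many segments. -/
theorem IsPolyhedron.hausdorffMeasure_edgeSkeleton_ne_top {P : Set E3} (hP : IsPolyhedron P) :
    Measure.hausdorffMeasure 1 (edgeSkeleton P) ≠ ⊤ := by
  obtain ⟨G, hG⟩ := hP.exists_isArrangement
  obtain ⟨R, hR⟩ := hP.isCompact.isBounded.subset_closedBall 0
  have hline : ∀ g ∈ G, ∀ g' ∈ G, (∀ r : ℝ, g'.1 ≠ r • g.1) →
      Measure.hausdorffMeasure 1
        {x : E3 | x ∈ Metric.closedBall 0 R ∧ g.1 x = g.2 ∧ g'.1 x = g'.2} ≠ ⊤ := by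
    intro g hg g' hg' h
    obtain ⟨v, hv0, hv1, hv2, hv⟩ := exists_ne_zero_and_forall_eq_smul (hG.ne_zero g hg) h
    rcases eq_empty_or_nonempty
      {x : E3 | x ∈ Metric.closedBall 0 R ∧ g.1 x = g.2 ∧ g'.1 x = g'.2} with h0 | ⟨p, hp⟩
    · rw [h0, measure_empty]; exact ENNReal.zero_ne_top
    have hvn : 0 < ‖v‖ := norm_pos_iff.2 hv0
    -- a bound for the parameters of two points of the ball on a line with direction `v`
    set T := 2 * R / ‖v‖
    have hsub : {x : E3 | x ∈ Metric.closedBall 0 R ∧ g.1 x = g.2 ∧ g'.1 x = g'.2} ⊆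
        segment ℝ (p + (-T) • v) (p + T • v) := by
      rintro x ⟨hxR, hx1, hx2⟩
      obtain ⟨t, ht⟩ := hv (x - p) (by simp [hx1, hp.2.1]) (by simp [hx2, hp.2.2])
      have hle : ‖x - p‖ ≤ 2 * R := by
        have h1 := mem_closedBall_zero_iff.1 hxR
        have h2 := mem_closedBall_zero_iff.1 hp.1
        linarith [norm_sub_le x p]
      rw [ht, norm_smul, Real.norm_eq_abs] at hle
      have hT : |t| ≤ T := by rwa [le_div_iff₀ hvn]
      have hx : x = AffineMap.lineMap p (p + v) t := by
        simp [AffineMap.lineMap_apply, ← ht]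
      have e : ∀ s : ℝ, p + s • v = AffineMap.lineMap p (p + v) s := by
        intro s; simp [AffineMap.lineMap_apply, add_comm]
      rw [e, e, ← image_segment, hx]
      refine ⟨t, ?_, rfl⟩
      rw [segment_eq_Icc (by linarith [abs_nonneg t])]
      exact abs_le.1 hT
    refine ne_top_of_le_ne_top ?_ (measure_mono hsub)
    rw [hausdorffMeasure_segment]
    exact edist_ne_top _ _
  let s : Set ((StrongDual ℝ E3 × ℝ) × (StrongDual ℝ E3 × ℝ)) :=
    {p ∈ G ×ˢ G | ∀ r : ℝ, p.2.1 ≠ r • p.1.1}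
  have hs : s.Finite := (hG.finite.prod hG.finite).subset fun p hp => hp.1
  have hsub : edgeSkeleton P ⊆ ⋃ p ∈ s,
      {x : E3 | x ∈ Metric.closedBall 0 R ∧ p.1.1 x = p.1.2 ∧ p.2.1 x = p.2.2} := by
    intro x hx
    obtain ⟨g, hg, g', hg', h1, h2, h3⟩ := hG.exists_of_mem_edgeSkeleton hP hx
    simp only [mem_iUnion]
    exact ⟨(g, g'), ⟨⟨hg, hg'⟩, h3⟩, hR (hP.isCompact.isClosed.frontier_subset hx.1), h1, h2⟩
  refine ne_top_of_le_ne_top ?_ (measure_mono hsub)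
  refine (measure_biUnion_lt_top hs fun p hp => ?_).ne
  exact lt_top_iff_ne_top.2 (hline p.1 hp.1.1 p.2 hp.1.2 hp.2)

/-! ### The corner of a triangular face -/

/-- Affine coordinates `b, c, d` at the vertex `A` of the triangular face `A B C` of `P`, in a
neighbourhood `U` of the face in which `P` is convex: they are the coordinates, in the basis
`B - A, C - A, z`, of the difference from `A`, where the line through `A` in the direction `z` is
the intersection of the planes of the two faces adjacent to the sides `A B` and `A C`. So `d = 0`
is the plane of the triangle, `c = 0` and `b = 0` are the planes of these two adjacent faces, and
`b + c + σ * d = 1` is the plane of the face adjacent to the side `B C`. The last three fields say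
that the closed triangle belongs to `U ∩ P`, that its relative interior is a component of the set
of flat points of `P`, and that the points of its sides are not flat. -/
structure IsTriangleCorner (P U : Set E3) (A B C z : E3) (b c d : StrongDual ℝ E3)
    (σ : ℝ) : Prop where
  isOpen : IsOpen U
  convex : Convex ℝ U
  convex_inter : Convex ℝ (U ∩ P)
  norm_z : ‖z‖ = 1
  decomp : ∀ v, v = b v • (B - A) + c v • (C - A) + d v • z
  b_B : b (B - A) = 1
  b_C : b (C - A) = 0
  b_z : b z = 0
  c_B : c (B - A) = 0
  c_C : c (C - A) = 1
  c_z : c z = 0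
  d_B : d (B - A) = 0
  d_C : d (C - A) = 0
  d_z : d z = 1
  mem_b : hsp (-b) A ∈ faceHalfspaces P U
  mem_c : hsp (-c) A ∈ faceHalfspaces P U
  mem_d : hsp d A ∈ faceHalfspaces P U
  mem_far : hsp (b + c + σ • d) B ∈ faceHalfspaces P U
  subset : ∀ x, d (x - A) = 0 → 0 ≤ b (x - A) → 0 ≤ c (x - A) → b (x - A) + c (x - A) ≤ 1 →
    x ∈ U ∩ P
  face : ∃ x₀ ∈ flatPoints P, connectedComponentIn (flatPoints P) x₀ =
    {x | d (x - A) = 0 ∧ 0 < b (x - A) ∧ 0 < c (x - A) ∧ b (x - A) + c (x - A) < 1}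
  notMem : ∀ x, d (x - A) = 0 → 0 ≤ b (x - A) → 0 ≤ c (x - A) → b (x - A) + c (x - A) ≤ 1 →
    x ∈ flatPoints P → 0 < b (x - A) ∧ 0 < c (x - A) ∧ b (x - A) + c (x - A) < 1

theorem mem_convexHull_triple_iff {A B C x : E3} :
    x ∈ convexHull ℝ ({A, B, C} : Set E3) ↔ ∃ β γ : ℝ, 0 ≤ β ∧ 0 ≤ γ ∧ β + γ ≤ 1 ∧
      x = A + β • (B - A) + γ • (C - A) := by
  rw [convexHull_insert (by simp), convexHull_pair, mem_convexJoin]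
  constructor
  · rintro ⟨a, ha, y, hy, hx⟩
    rw [mem_singleton_iff] at ha
    subst ha
    rw [segment_eq_image'] at hy hx
    obtain ⟨s, hs, rfl⟩ := hy
    obtain ⟨t, ht, rfl⟩ := hx
    refine ⟨t * (1 - s), t * s, mul_nonneg ht.1 (by linarith [hs.2]), mul_nonneg ht.1 hs.1,
      by nlinarith [ht.2], ?_⟩
    module
  · rintro ⟨β, γ, hβ, hγ, h, rfl⟩
    refine ⟨A, rfl, ?_⟩
    rcases (add_nonneg hβ hγ).eq_or_lt with h0 | h0
    · have h1 : β = 0 := by linarith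
      have h2 : γ = 0 := by linarith
      subst h1 h2
      exact ⟨B, left_mem_segment ℝ B C, by simpa using left_mem_segment ℝ A B⟩
    · refine ⟨B + (γ / (β + γ)) • (C - B), ?_, ?_⟩
      · rw [segment_eq_image']
        exact ⟨_, ⟨by positivity, by rw [div_le_one h0]; linarith⟩, rfl⟩
      · rw [segment_eq_image']
        refine ⟨β + γ, ⟨h0.le, h⟩, ?_⟩
        have : (β + γ) • (B + (γ / (β + γ)) • (C - B) - A) =
            (β + γ) • (B - A) + ((β + γ) * (γ / (β + γ))) • (C - B) := by module
        simp only [this, mul_div_cancel₀ _ h0.ne']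
        module

/-- The relative interior of a triangular face is a component of the flat part of the
boundary. -/
theorem mem_component_iff_of_triangle {P U : Set E3} (hU : IsOpen U) (hUP : Convex ℝ (U ∩ P))
    {A B C : E3} (hli : ∀ s t : ℝ, s • (B - A) + t • (C - A) = 0 → s = 0 ∧ t = 0)
    (hsub : convexHull ℝ {A, B, C} ⊆ U) (hsubP : convexHull ℝ {A, B, C} ⊆ P)
    {x₀ : E3} {φ : StrongDual ℝ E3} (hφ : φ ≠ 0) (h0 : AgreeNear P (hsp φ x₀) x₀)
    (hF : convexHull ℝ {A, B, C} = closure (connectedComponentIn (flatPoints P) x₀))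
    (hφB : φ (B - A) = 0) (hφC : φ (C - A) = 0) (hφ0 : φ (A - x₀) = 0) (β γ : ℝ) :
    A + β • (B - A) + γ • (C - A) ∈ connectedComponentIn (flatPoints P) x₀ ↔
      0 < β ∧ 0 < γ ∧ β + γ < 1 := by
  have hx₀f : x₀ ∈ flatPoints P := mem_flatPoints_iff.2 ⟨φ, hφ, h0⟩
  have hx₀ : x₀ ∈ convexHull ℝ {A, B, C} := by
    rw [hF]; exact subset_closure (mem_connectedComponentIn hx₀f)
  constructor
  · intro hx
    set x := A + β • (B - A) + γ • (C - A) with hxdef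
    obtain ⟨-, hxφ⟩ := h0.of_mem_connectedComponentIn hφ hx
    have hnear : ∀ᶠ y in 𝓝 x, φ (y - x) = 0 → y ∈ convexHull ℝ {A, B, C} := by
      filter_upwards [hxφ.eventually_agree,
        eventually_mem_connectedComponentIn (connectedComponentIn_subset _ _ hx)] with y h1 h2 h3
      rw [hF, connectedComponentIn_eq hx]
      exact subset_closure (h2 (mem_flatPoints_iff.2 ⟨φ, hφ, h1 h3⟩))
    have key : ∀ β' γ' : ℝ, ∃ r : ℝ, 0 < r ∧ 0 ≤ β + r * β' ∧ 0 ≤ γ + r * γ' ∧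
        β + r * β' + (γ + r * γ') ≤ 1 := by
      intro β' γ'
      obtain ⟨r, hr, hr'⟩ := exists_pos_ray hnear (β' • (B - A) + γ' • (C - A))
      obtain ⟨β₁, γ₁, h1, h2, h3, h4⟩ := mem_convexHull_triple_iff.1 (hr' (by simp [hφB, hφC]))
      have := hli (β + r * β' - β₁) (γ + r * γ' - γ₁) (by
        rw [hxdef, ← sub_eq_zero] at h4
        rw [← h4]; module)
      exact ⟨r, hr, by linarith, by linarith, by linarith⟩
    obtain ⟨r, hr, h1, -, -⟩ := key (-1) 0
    obtain ⟨s, hs, -, h2, -⟩ := key 0 (-1)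
    obtain ⟨t, ht, -, -, h3⟩ := key 1 1
    exact ⟨by linarith, by linarith, by linarith⟩
  · rintro ⟨hβ, hγ, hβγ⟩
    obtain ⟨β₀, γ₀, h1, h2, h3, rfl⟩ := mem_convexHull_triple_iff.1 hx₀
    obtain ⟨ε, ⟨⟨e1, e2⟩, e3⟩, hε⟩ : ∃ ε : ℝ, ((0 < β + ε * (β - β₀) ∧ 0 < γ + ε * (γ - γ₀)) ∧
        β + γ + ε * (β + γ - β₀ - γ₀) < 1) ∧ 0 < ε := by
      have ht : ∀ a b : ℝ, Tendsto (fun ε : ℝ => a + ε * b) (𝓝[>] 0) (𝓝 a) := fun a b => by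
        have hc : Continuous fun ε : ℝ => a + ε * b := by fun_prop
        simpa using (hc.tendsto 0).mono_left nhdsWithin_le_nhds
      exact ((((ht β _).eventually (eventually_gt_nhds hβ)).and
        ((ht γ _).eventually (eventually_gt_nhds hγ))).and
        ((ht (β + γ) _).eventually (eventually_lt_nhds hβγ))).and self_mem_nhdsWithin |>.exists
    set x₀ := A + β₀ • (B - A) + γ₀ • (C - A)
    have hy : A + (β + ε * (β - β₀)) • (B - A) + (γ + ε * (γ - γ₀)) • (C - A) ∈
        convexHull ℝ {A, B, C} :=
      mem_convexHull_triple_iff.2 ⟨_, _, e1.le, e2.le, by linarith, rfl⟩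
    have := h0.add_smul_sub_mem_connectedComponentIn hU hUP hφ (hsub hx₀) ⟨hsub hy, hsubP hy⟩
      (by
        have : A + (β + ε * (β - β₀)) • (B - A) + (γ + ε * (γ - γ₀)) • (C - A) - x₀ =
          (A - x₀) + (β + ε * (β - β₀)) • (B - A) + (γ + ε * (γ - γ₀)) • (C - A) := by abel
        simp [this, hφB, hφC, hφ0]) (s := (1 + ε)⁻¹)
      ⟨by positivity, inv_lt_one_of_one_lt₀ (by linarith)⟩
    convert this using 1
    have h1ε : (1 + ε) ≠ 0 := by positivity
    have e : A + (β + ε * (β - β₀)) • (B - A) + (γ + ε * (γ - γ₀)) • (C - A) - x₀ =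
      (1 + ε) • ((β - β₀) • (B - A) + (γ - γ₀) • (C - A)) := by
      simp only [x₀]; module
    rw [e, inv_smul_smul₀ h1ε]
    simp only [x₀]; module

/-- A point of the plane of a face that is not flat lies on the plane of another face. -/
theorem exists_hsp_ne_of_notMem_flatPoints {P U : Set E3} (hP : IsPolyhedron P) (hU : IsOpen U)
    (hUc : Convex ℝ U) (hUP : Convex ℝ (U ∩ P)) {M : E3} (hM : M ∈ U ∩ P)
    (hMf : M ∉ flatPoints P) {φ : StrongDual ℝ E3} (hφ : φ ≠ 0)
    (hmem : hsp φ M ∈ faceHalfspaces P U) :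
    ∃ ψ : StrongDual ℝ E3, ψ ≠ 0 ∧ hsp ψ M ∈ faceHalfspaces P U ∧ hsp ψ M ≠ hsp φ M := by
  by_contra! hcon
  refine hMf (mem_flatPoints_iff.2 ⟨φ, hφ, ?_⟩)
  have heq := hP.inter_eq hU hUc hUP ⟨M, hM⟩
  have hall : ∀ᶠ y in 𝓝 M, ∀ H ∈ faceHalfspaces P U, H ≠ hsp φ M → y ∈ H := by
    refine (eventually_all_finite (hP.finite_faceHalfspaces U)).2 fun H hH => ?_
    by_cases hne : H = hsp φ M
    · simp [hne]
    obtain ⟨x, hx, ψ, hψ, h, rfl⟩ := mem_faceHalfspaces_iff.1 hH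
    have hle := h.le_of_convex hUP hx hM
    rcases hle.lt_or_eq with hlt | h0
    · have hc : Continuous fun y : E3 => ψ (y - x) := by fun_prop
      filter_upwards [(hc.tendsto M).eventually (eventually_lt_nhds hlt)] with y hy _
      exact hy.le
    · exfalso
      have e : hsp ψ x = hsp ψ M :=
        hsp_eq_of_apply_eq (by rw [map_sub, sub_eq_zero] at h0; exact h0.symm)
      rw [e] at hne hH
      exact hne (hcon ψ hψ hH)
  filter_upwards [hall, hU.mem_nhds hM.1] with y hy hyU
  have h1 : y ∈ U ∩ P ↔ y ∈ U ∩ ⋂₀ faceHalfspaces P U := by rw [heq]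
  constructor
  · exact fun hyP => (h1.1 ⟨hyU, hyP⟩).2 _ hmem
  · intro hyH
    refine (h1.2 ⟨hyU, fun H hH => ?_⟩).2
    by_cases hne : H = hsp φ M
    · rwa [hne]
    · exact hy H hH hne

/-- A side of a triangular face, with midpoint `M`, lies on the plane of a second face, and the
opposite vertex `Z` is strictly inside the corresponding half-space. -/
theorem exists_adjacent_hsp {P U : Set E3} (hP : IsPolyhedron P) (hU : IsOpen U)
    (hUc : Convex ℝ U) (hUP : Convex ℝ (U ∩ P)) {X Y Z : E3} (hX : X ∈ U ∩ P) (hY : Y ∈ U ∩ P)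
    (hZ : Z ∈ U ∩ P) (hMf : X + (2⁻¹ : ℝ) • (Y - X) ∉ flatPoints P)
    {φ : StrongDual ℝ E3} (hφ : φ ≠ 0) {x₀ : E3} (hx₀U : x₀ ∈ U) (h0 : AgreeNear P (hsp φ x₀) x₀)
    (hφX : φ (X - x₀) = 0) (hφY : φ (Y - X) = 0)
    (hx₀ : ∃ s t : ℝ, x₀ = X + s • (Y - X) + t • (Z - X)) :
    ∃ ψ : StrongDual ℝ E3, ψ (Y - X) = 0 ∧ ψ (Z - X) = -1 ∧ hsp ψ X ∈ faceHalfspaces P U := by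
  set M := X + (2⁻¹ : ℝ) • (Y - X) with hMdef
  have hM : M ∈ U ∩ P := hUP.add_smul_sub_mem hX hY (by norm_num)
  have e1 : hsp φ M = hsp φ x₀ := by
    refine hsp_eq_of_apply_eq ?_
    have : φ (M - x₀) = 0 := by
      have : M - x₀ = (X - x₀) + (2⁻¹ : ℝ) • (Y - X) := by rw [hMdef]; abel
      rw [this]; simp [hφX, hφY]
    rwa [map_sub, sub_eq_zero] at this
  obtain ⟨ψ, hψ, hmem, hne⟩ := exists_hsp_ne_of_notMem_flatPoints hP hU hUc hUP hM hMf hφ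
    (by rw [e1]; exact mem_faceHalfspaces_iff.2 ⟨x₀, hx₀U, φ, hφ, h0, rfl⟩)
  have hle : ∀ y ∈ U ∩ P, ψ (y - M) ≤ 0 := by
    intro y hy
    rw [hP.inter_eq hU hUc hUP ⟨M, hM⟩] at hy
    exact hy.2 _ hmem
  have hYX : ψ (Y - X) = 0 := by
    have h1 := hle X hX
    have h2 := hle Y hY
    have e1 : X - M = -((2⁻¹ : ℝ) • (Y - X)) := by rw [hMdef]; module
    have e2 : Y - M = (2⁻¹ : ℝ) • (Y - X) := by rw [hMdef]; module
    rw [e1, map_neg, map_smul, smul_eq_mul] at h1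
    rw [e2, map_smul, smul_eq_mul] at h2
    linarith
  have hMX : ψ M = ψ X := by simp [hMdef, hYX]
  have hZX : ψ (Z - X) < 0 := by
    have h1 := hle Z hZ
    rw [map_sub, hMX, ← map_sub] at h1
    refine lt_of_le_of_ne h1 fun h2 => hne ?_
    obtain ⟨s, t, hst⟩ := hx₀
    have e2 : ψ x₀ = ψ M := by rw [hst, hMX]; simp [hYX, h2]
    have e3 := h0.hsp_eq hψ (by
      filter_upwards [hU.mem_nhds hx₀U] with y hyU hyP
      rw [map_sub, e2, ← map_sub]
      exact hle y ⟨hyU, hyP⟩)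
    rw [e1, ← e3]
    exact hsp_eq_of_apply_eq e2.symm
  refine ⟨(-(ψ (Z - X)))⁻¹ • ψ, by simp [hYX], ?_, ?_⟩
  · rw [smul_apply, smul_eq_mul, inv_neg, neg_mul, inv_mul_cancel₀ hZX.ne]
  · rw [hsp_smul (inv_pos.2 (neg_pos.2 hZX)), ← hsp_eq_of_apply_eq hMX]
    exact hmem

/-- A triangular face of a polyhedron that is convex near the face has a corner at each of its
vertices. The planes of the adjacent faces come from `exists_adjacent_hsp`, and `z` spans the line
in which the two planes through `A` meet. -/
theorem exists_isTriangleCorner {P U : Set E3} (hP : IsPolyhedron P) (hU : IsOpen U)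
    (hUc : Convex ℝ U) (hUP : Convex ℝ (U ∩ P)) {A B C : E3}
    (hli : ∀ s t : ℝ, s • (B - A) + t • (C - A) = 0 → s = 0 ∧ t = 0)
    (hsub : convexHull ℝ {A, B, C} ⊆ U) (hF : convexHull ℝ {A, B, C} ∈ faces P) :
    ∃ z b c d σ, IsTriangleCorner P U A B C z b c d σ := by
  obtain ⟨x₀, hx₀f, hF⟩ := hF
  obtain ⟨φ, hφ, h0⟩ := mem_flatPoints_iff.1 hx₀f
  have hPc := hP.isCompact.isClosed
  have hCP : connectedComponentIn (flatPoints P) x₀ ⊆ P := fun x hx =>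
    hPc.frontier_subset (connectedComponentIn_subset _ _ hx).1
  have hsubP : convexHull ℝ {A, B, C} ⊆ P := by
    rw [hF]; exact closure_minimal hCP hPc
  have hplane : ∀ x ∈ convexHull ℝ {A, B, C}, φ (x - x₀) = 0 := by
    rw [hF]
    refine fun x hx => closure_minimal (t := {x | φ (x - x₀) = 0})
      (fun y hy => (h0.of_mem_connectedComponentIn hφ hy).1)
      (isClosed_eq (by fun_prop) continuous_const) hx
  have hx₀ : x₀ ∈ convexHull ℝ {A, B, C} := by
    rw [hF]; exact subset_closure (mem_connectedComponentIn hx₀f)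
  have hx₀U := hsub hx₀
  have hAΔ : A ∈ convexHull ℝ {A, B, C} := subset_convexHull ℝ _ (by simp)
  have hBΔ : B ∈ convexHull ℝ {A, B, C} := subset_convexHull ℝ _ (by simp)
  have hCΔ : C ∈ convexHull ℝ {A, B, C} := subset_convexHull ℝ _ (by simp)
  have hφA := hplane A hAΔ
  have hφB : φ (B - A) = 0 := by
    rw [← sub_sub_sub_cancel_right B A x₀, map_sub, hplane B hBΔ, hφA, sub_zero]
  have hφC : φ (C - A) = 0 := by
    rw [← sub_sub_sub_cancel_right C A x₀, map_sub, hplane C hCΔ, hφA, sub_zero]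
  have hcomp := mem_component_iff_of_triangle hU hUP hli hsub hsubP hφ h0 hF hφB hφC hφA
  have hnf : ∀ β γ : ℝ, 0 ≤ β → 0 ≤ γ → β + γ ≤ 1 →
      A + β • (B - A) + γ • (C - A) ∈ flatPoints P → 0 < β ∧ 0 < γ ∧ β + γ < 1 := by
    intro β γ h1 h2 h3 h4
    rw [← hcomp]
    refine mem_connectedComponentIn_of_mem_closure ?_ h4
    rw [← hF]
    exact mem_convexHull_triple_iff.2 ⟨β, γ, h1, h2, h3, rfl⟩
  obtain ⟨β₀, γ₀, -, -, -, hx₀e⟩ := mem_convexHull_triple_iff.1 hx₀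
  have hin : ∀ x ∈ convexHull ℝ {A, B, C}, x ∈ U ∩ P := fun x hx => ⟨hsub hx, hsubP hx⟩
  obtain ⟨ψc, hc1, hc2, hc3⟩ := exists_adjacent_hsp hP hU hUc hUP (X := A) (Y := B) (Z := C)
    (hin A hAΔ) (hin B hBΔ) (hin C hCΔ) (fun h => by
      have := hnf 2⁻¹ 0 (by norm_num) le_rfl (by norm_num) (by simpa using h)
      exact lt_irrefl _ this.2.1) hφ hx₀U h0 hφA hφB ⟨β₀, γ₀, hx₀e⟩
  obtain ⟨ψb, hb1, hb2, hb3⟩ := exists_adjacent_hsp hP hU hUc hUP (X := A) (Y := C) (Z := B)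
    (hin A hAΔ) (hin C hCΔ) (hin B hBΔ) (fun h => by
      have := hnf 0 2⁻¹ le_rfl (by norm_num) (by norm_num) (by simpa using h)
      exact lt_irrefl _ this.1) hφ hx₀U h0 hφA hφC ⟨γ₀, β₀, by rw [hx₀e]; abel⟩
  obtain ⟨ψa, ha1, ha2, ha3⟩ := exists_adjacent_hsp hP hU hUc hUP (X := B) (Y := C) (Z := A)
    (hin B hBΔ) (hin C hCΔ) (hin A hAΔ) (fun h => by
      have := hnf 2⁻¹ 2⁻¹ (by norm_num) (by norm_num) (by norm_num) (by
        convert h using 1; module)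
      norm_num at this) hφ hx₀U h0 (hplane B hBΔ)
      (by rw [← sub_sub_sub_cancel_right C B A, map_sub, hφB, hφC, sub_zero])
      ⟨γ₀, 1 - β₀ - γ₀, by rw [hx₀e]; module⟩
  have hψb0 : ψb ≠ 0 := by rintro rfl; simp at hb2
  obtain ⟨v, hv0, hvb, hvc, hv⟩ := exists_ne_zero_and_forall_eq_smul hψb0 (ψ := ψc) (by
    rintro r rfl
    simp [hb1] at hc2)
  have hdec : ∀ u, ∃ t : ℝ, u = (-ψb u) • (B - A) + (-ψc u) • (C - A) + t • v := by
    intro u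
    obtain ⟨t, ht⟩ := hv (u + ψb u • (B - A) + ψc u • (C - A)) (by simp [hb1, hb2])
      (by simp [hc1, hc2])
    exact ⟨t, by rw [← ht]; module⟩
  have hφv : φ v ≠ 0 := by
    intro h
    apply hφ
    ext u
    obtain ⟨t, ht⟩ := hdec u
    rw [ht]
    simp [hφB, hφC, h]
  obtain ⟨z, hz1, hzv, hzφ⟩ : ∃ z : E3, ‖z‖ = 1 ∧ (∃ r : ℝ, z = r • v ∧ r ≠ 0) ∧ 0 < φ z := by
    have hn : 0 < ‖v‖ := norm_pos_iff.2 hv0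
    rcases lt_or_gt_of_ne hφv with h | h
    · refine ⟨(-‖v‖⁻¹) • v, by rw [norm_smul]; simp [hn.ne'],
        ⟨_, rfl, by simpa using hn.ne'⟩, ?_⟩
      rw [map_smul, smul_eq_mul]
      have := inv_pos.2 hn
      nlinarith
    · refine ⟨‖v‖⁻¹ • v, by rw [norm_smul]; simp [hn.ne'],
        ⟨_, rfl, by simpa using hn.ne'⟩, ?_⟩
      rw [map_smul, smul_eq_mul]
      positivity
  obtain ⟨r, hr, hr0⟩ := hzv
  have hzb : ψb z = 0 := by simp [hr, hvb]
  have hzc : ψc z = 0 := by simp [hr, hvc]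
  set d : StrongDual ℝ E3 := (φ z)⁻¹ • φ with hd
  have hdB : d (B - A) = 0 := by simp only [hd, smul_apply, hφB, smul_zero]
  have hdC : d (C - A) = 0 := by simp only [hd, smul_apply, hφC, smul_zero]
  have hdz : d z = 1 := by simp only [hd, smul_apply, smul_eq_mul, inv_mul_cancel₀ hzφ.ne']
  have hdecomp : ∀ u, u = (-ψb) u • (B - A) + (-ψc) u • (C - A) + d u • z := by
    intro u
    obtain ⟨t, ht⟩ := hdec u
    have h1 := congrArg d ht
    have hdv : d v = r⁻¹ := by
      have : r * d v = 1 := by rw [← hdz, hr, map_smul, smul_eq_mul]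
      exact eq_inv_of_mul_eq_one_right this
    have h2 : d u = t * r⁻¹ := by
      rw [h1]
      simp [hdB, hdC, hdv]
    have h3 : d u • z = t • v := by
      rw [h2, hr, smul_smul, mul_assoc, inv_mul_cancel₀ hr0, mul_one]
    rw [h3]
    exact ht
  have hpt : ∀ x, d (x - A) = 0 → x = A + (-ψb) (x - A) • (B - A) + (-ψc) (x - A) • (C - A) := by
    intro x hx
    have := hdecomp (x - A)
    rw [hx, zero_smul, add_zero] at this
    rw [add_assoc, ← this]
    abel
  refine ⟨z, -ψb, -ψc, d, ψa z, hU, hUc, hUP, hz1, hdecomp, by simp only [neg_apply, hb2, neg_neg],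
    by simp only [neg_apply, hb1, neg_zero], by simp only [neg_apply, hzb, neg_zero],
    by simp only [neg_apply, hc1, neg_zero], by simp only [neg_apply, hc2, neg_neg],
    by simp only [neg_apply, hzc, neg_zero], hdB, hdC, hdz,
    by rwa [neg_neg], by rwa [neg_neg], ?_, ?_, ?_, ⟨x₀, hx₀f, ?_⟩, ?_⟩
  · rw [hd, hsp_smul (inv_pos.2 hzφ)]
    exact mem_faceHalfspaces_iff.2 ⟨x₀, hx₀U, φ, hφ, h0,
      hsp_eq_of_apply_eq (by rwa [map_sub, sub_eq_zero] at hφA)⟩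
  · have : -ψb + -ψc + ψa z • d = ψa := by
      ext u
      have h1 : ψa (B - A) = 1 := by rw [← neg_sub, map_neg, ha2, neg_neg]
      have h2 : ψa (C - A) = 1 := by
        rw [← sub_add_sub_cancel C B A, map_add, ha1, h1, zero_add]
      conv_rhs => rw [hdecomp u]
      simp only [map_add, map_smul, h1, h2, add_apply, smul_apply, smul_eq_mul]
      ring
    rwa [this]
  · intro x h1 h2 h3 h4
    exact hin x (mem_convexHull_triple_iff.2 ⟨_, _, h2, h3, h4, hpt x h1⟩)
  · ext x
    constructor
    · intro hx
      have hx1 : d (x - A) = 0 := by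
        have h1 := (h0.of_mem_connectedComponentIn hφ hx).1
        have h2 : φ (x - A) = 0 := by
          rw [← sub_sub_sub_cancel_right x A x₀, map_sub, h1, hφA, sub_zero]
        rw [hd, smul_apply, h2, smul_zero]
      rw [hpt x hx1, hcomp] at hx
      exact ⟨hx1, hx⟩
    · rintro ⟨hx1, hx⟩
      rw [hpt x hx1, hcomp]
      exact hx
  · intro x h1 h2 h3 h4 h5
    rw [hpt x h1] at h5
    exact hnf _ _ h2 h3 h4 h5

/-! ### Areas of planar cones and a Crofton formula -/

open scoped Pointwise in
/-- The part of the unit ball that projects into a cone of a plane: its volume is proportional to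
the area of the cone in the unit disc, with a factor that does not depend on the plane. -/
theorem volume_adjoint_mem_cone (f : ℂ →ₗᵢ[ℝ] E3) {T : Set ℂ} (hT : MeasurableSet T)
    (hcone : ∀ r : ℝ, 0 < r → ∀ x ∈ T, r • x ∈ T) :
    volume {u : E3 | ‖u‖ ≤ 1 ∧ ContinuousLinearMap.adjoint f.toContinuousLinearMap u ∈ T} *
      volume (Metric.closedBall (0 : ℂ) 1) =
    volume (Metric.closedBall (0 : E3) 1) * volume (T ∩ Metric.closedBall 0 1) := by
  set a := ContinuousLinearMap.adjoint f.toContinuousLinearMap with ha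
  have hadj : ∀ u x, inner ℝ (a u) x = inner ℝ u (f x) := fun u x =>
    ContinuousLinearMap.adjoint_inner_left f.toContinuousLinearMap x u
  obtain ⟨n, hn1, hn⟩ : ∃ n : E3, ‖n‖ = 1 ∧ ∀ x, inner ℝ (f x) n = 0 := by
    have h1 := (LinearMap.range f.toLinearMap).finrank_add_finrank_orthogonal
    have h2 : Module.finrank ℝ (LinearMap.range f.toLinearMap) = 2 := by
      rw [LinearMap.finrank_range_of_inj f.injective, Complex.finrank_real_complex]
    have h3 : Module.finrank ℝ E3 = 3 := by simp
    have h4 : 0 < Module.finrank ℝ (LinearMap.range f.toLinearMap)ᗮ := by omega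
    obtain ⟨n, hn⟩ := (Module.finrank_pos_iff_exists_ne_zero).1 h4
    have hn0 : (n : E3) ≠ 0 := by simpa using hn
    refine ⟨‖(n : E3)‖⁻¹ • (n : E3), by rw [norm_smul]; simp [hn0], fun x => ?_⟩
    rw [inner_smul_right, n.2 (f x) ⟨x, rfl⟩, mul_zero]
  let L₀ : ℂ × ℝ →ₗ[ℝ] E3 := f.toLinearMap.coprod (LinearMap.toSpanSingleton ℝ E3 n)
  have hL₀ : ∀ p, L₀ p = f p.1 + p.2 • n := fun p => rfl
  have hnorm : ∀ p, ‖L₀ p‖ ^ 2 = ‖p.1‖ ^ 2 + p.2 ^ 2 := by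
    intro p
    rw [hL₀, norm_add_sq_real, inner_smul_right, hn, norm_smul, hn1, f.norm_map]
    simp
  have hinj : Function.Injective L₀ := by
    rw [← LinearMap.ker_eq_bot, LinearMap.ker_eq_bot']
    intro p hp
    have := hnorm p
    rw [hp] at this
    simp only [norm_zero, ne_eq, OfNat.ofNat_ne_zero, not_false_eq_true, zero_pow] at this
    have h1 : ‖p.1‖ ^ 2 = 0 := by nlinarith [sq_nonneg ‖p.1‖, sq_nonneg p.2]
    have h2 : p.2 ^ 2 = 0 := by nlinarith [sq_nonneg ‖p.1‖, sq_nonneg p.2]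
    ext1
    · simpa using h1
    · simpa using h2
  have hfr : Module.finrank ℝ (ℂ × ℝ) = Module.finrank ℝ E3 := by simp
  let L : (ℂ × ℝ) ≃L[ℝ] E3 :=
    (LinearEquiv.ofInjectiveOfFinrankEq L₀ hinj hfr).toContinuousLinearEquiv
  have hL : ∀ p, L p = f p.1 + p.2 • n := fun p => rfl
  have hn' : ∀ x, inner ℝ n (f x) = 0 := fun x => by rw [real_inner_comm]; exact hn x
  have haL : ∀ p, a (L p) = p.1 := by
    intro p
    refine ext_inner_right ℝ fun x => ?_
    rw [hadj, hL, inner_add_left, f.inner_map_map, inner_smul_left, hn' x]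
    simp
  have : (volume : Measure (ℂ × ℝ)).IsAddHaarMeasure :=
    Measure.prod.instIsAddHaarMeasure volume volume
  have := L.isAddHaarMeasure_map (volume : Measure (ℂ × ℝ))
  have hkv := Measure.isAddLeftInvariant_eq_smul (volume : Measure E3)
    ((volume : Measure (ℂ × ℝ)).map L)
  set k := Measure.addHaarScalarFactor (volume : Measure E3) ((volume : Measure (ℂ × ℝ)).map L)
  -- Fubini: the slice at height `t` is the part of the cone in a disc of squared radius `1 - t ^ 2`
  have hslice : ∀ S : Set ℂ, MeasurableSet S → (∀ r : ℝ, 0 < r → ∀ x ∈ S, r • x ∈ S) →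
      volume {u : E3 | ‖u‖ ≤ 1 ∧ a u ∈ S} =
        k * ((∫⁻ t : ℝ, ENNReal.ofReal (1 - t ^ 2)) * volume (S ∩ Metric.closedBall 0 1)) := by
    intro S hS hSc
    have hmeas : MeasurableSet {u : E3 | ‖u‖ ≤ 1 ∧ a u ∈ S} :=
      (isClosed_le continuous_norm continuous_const).measurableSet.inter
        (a.continuous.measurable hS)
    have hpre : L ⁻¹' {u : E3 | ‖u‖ ≤ 1 ∧ a u ∈ S} = {p | ‖p.1‖ ^ 2 + p.2 ^ 2 ≤ 1 ∧ p.1 ∈ S} := by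
      ext p
      simp only [mem_preimage, mem_ofPred_eq, haL]
      rw [← hnorm p]
      have : ‖L p‖ = ‖L₀ p‖ := rfl
      rw [this, sq_le_one_iff₀ (norm_nonneg _)]
    rw [hkv, Measure.smul_apply, ENNReal.smul_def, smul_eq_mul,
      Measure.map_apply L.continuous.measurable hmeas, hpre, Measure.volume_eq_prod,
      Measure.prod_apply_symm (by rw [← hpre]; exact L.continuous.measurable hmeas),
      ← lintegral_mul_const _ (by fun_prop)]
    congr 1
    refine lintegral_congr fun t => ?_
    have hset : (fun x : ℂ => (x, t)) ⁻¹' {p | ‖p.1‖ ^ 2 + p.2 ^ 2 ≤ 1 ∧ p.1 ∈ S} =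
        {x | ‖x‖ ^ 2 ≤ 1 - t ^ 2 ∧ x ∈ S} := by
      ext x; simp [le_sub_iff_add_le]
    rw [hset]
    rcases lt_trichotomy (1 - t ^ 2) 0 with h | h | h
    · have : {x : ℂ | ‖x‖ ^ 2 ≤ 1 - t ^ 2 ∧ x ∈ S} = ∅ := by
        ext x
        simp only [mem_ofPred_eq, mem_empty_iff_false, iff_false, not_and]
        intro hx
        nlinarith [sq_nonneg ‖x‖]
      rw [this, measure_empty, ENNReal.ofReal_of_nonpos h.le, zero_mul]
    · have : {x : ℂ | ‖x‖ ^ 2 ≤ 1 - t ^ 2 ∧ x ∈ S} ⊆ {0} := by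
        rintro x ⟨hx, -⟩
        rw [h] at hx
        have : ‖x‖ ^ 2 = 0 := le_antisymm hx (sq_nonneg _)
        simpa using this
      have h0 := measure_mono_null this (measure_singleton (μ := volume) (0 : ℂ))
      rw [h0, h, ENNReal.ofReal_zero, zero_mul]
    · set s := √(1 - t ^ 2)
      have hs : 0 < s := Real.sqrt_pos.2 h
      have hs2 : s ^ 2 = 1 - t ^ 2 := Real.sq_sqrt h.le
      have : {x : ℂ | ‖x‖ ^ 2 ≤ 1 - t ^ 2 ∧ x ∈ S} = s • (S ∩ Metric.closedBall 0 1) := by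
        ext x
        rw [mem_smul_set_iff_inv_smul_mem₀ hs.ne']
        simp only [mem_ofPred_eq, mem_inter_iff, mem_closedBall_zero_iff, norm_smul, norm_inv,
          Real.norm_eq_abs, abs_of_pos hs]
        rw [inv_mul_le_one₀ hs, ← hs2, sq_le_sq₀ (norm_nonneg _) hs.le, and_comm]
        refine and_congr_left fun _ => ⟨hSc _ (inv_pos.2 hs) x, fun h => ?_⟩
        simpa [smul_smul, hs.ne'] using hSc s hs _ h
      rw [this, Measure.addHaar_smul, Complex.finrank_real_complex, hs2, abs_of_pos h]
  have h1 := hslice T hT hcone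
  have h2 := hslice univ MeasurableSet.univ (by simp)
  have h3 : {u : E3 | ‖u‖ ≤ 1 ∧ a u ∈ univ} = Metric.closedBall 0 1 := by ext; simp
  rw [h3, univ_inter] at h2
  rw [h1, h2]
  ring

/-- The area of a sector of the unit disc, by integration in polar coordinates. -/
theorem volume_sector {θ : ℝ} (hθ : θ ≤ Real.pi) :
    volume ({x : ℂ | x.arg ∈ Ioo 0 θ} ∩ Metric.closedBall 0 1) = ENNReal.ofReal (θ / 2) := by
  have hmeas : MeasurableSet ({x : ℂ | x.arg ∈ Ioo 0 θ} ∩ Metric.closedBall 0 1) :=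
    (Complex.measurable_arg measurableSet_Ioo).inter measurableSet_closedBall
  rw [← lintegral_indicator_one hmeas, ← Complex.lintegral_comp_polarCoord_symm]
  have h : ∀ p ∈ polarCoord.target, ENNReal.ofReal p.1 •
      ({x : ℂ | x.arg ∈ Ioo 0 θ} ∩ Metric.closedBall 0 1).indicator (1 : ℂ → ENNReal)
        (Complex.polarCoord.symm p) =
      (Ioc 0 1 ×ˢ Ioo 0 θ).indicator (fun p : ℝ × ℝ => ENNReal.ofReal p.1) p := by
    rintro ⟨r, φ⟩ hp
    simp only [polarCoord_target, mem_prod, mem_Ioi, mem_Ioo] at hp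
    have harg : (Complex.polarCoord.symm (r, φ)).arg = φ := by
      rw [Complex.polarCoord_symm_apply, Complex.ofReal_cos, Complex.ofReal_sin]
      exact Complex.arg_mul_cos_add_sin_mul_I hp.1 ⟨hp.2.1, hp.2.2.le⟩
    have hnorm : ‖Complex.polarCoord.symm (r, φ)‖ = r := by
      rw [Complex.norm_polarCoord_symm, abs_of_pos hp.1]
    by_cases hmem : (r, φ) ∈ Ioc (0 : ℝ) 1 ×ˢ Ioo 0 θ
    · rw [indicator_of_mem hmem, indicator_of_mem]
      · simp
      · exact ⟨by rw [mem_ofPred_eq, harg]; exact hmem.2,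
          by rw [mem_closedBall_zero_iff, hnorm]; exact hmem.1.2⟩
    · rw [indicator_of_notMem hmem, indicator_of_notMem]
      · simp
      · rintro ⟨h1, h2⟩
        rw [mem_ofPred_eq, harg] at h1
        rw [mem_closedBall_zero_iff, hnorm] at h2
        exact hmem ⟨⟨hp.1, h2⟩, h1⟩
  rw [setLIntegral_congr_fun polarCoord.open_target.measurableSet h,
    setLIntegral_indicator (measurableSet_Ioc.prod measurableSet_Ioo)]
  have hsub : Ioc (0 : ℝ) 1 ×ˢ Ioo 0 θ ∩ polarCoord.target = Ioc (0 : ℝ) 1 ×ˢ Ioo 0 θ := by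
    refine inter_eq_left.2 ?_
    rintro ⟨r, φ⟩ ⟨h1, h2⟩
    simp only [polarCoord_target, mem_prod, mem_Ioi, mem_Ioo] at *
    exact ⟨h1.1, by linarith [Real.pi_pos], by linarith⟩
  have hr : ∫⁻ r in Ioc (0 : ℝ) 1, ENNReal.ofReal r = ENNReal.ofReal (1 / 2) := by
    rw [← ofReal_integral_eq_lintegral_ofReal, ← intervalIntegral.integral_of_le zero_le_one,
      integral_id]
    · norm_num
    · exact (continuous_id.integrableOn_Icc).mono_set Ioc_subset_Icc_self
    · exact (ae_restrict_iff' measurableSet_Ioc).2 (ae_of_all _ fun x hx => hx.1.le)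
  rw [hsub, Measure.volume_eq_prod, ← Measure.prod_restrict,
    lintegral_prod _ (by fun_prop)]
  simp only [lintegral_const, Measure.restrict_apply, MeasurableSet.univ, univ_inter,
    Real.volume_Ioo, sub_zero]
  rw [lintegral_mul_const _ (by fun_prop), hr, ← ENNReal.ofReal_mul (by norm_num)]
  congr 1
  ring

/-- Multiplication by `I`, the rotation of the plane by a right angle. -/
noncomputable def rotI : ℂ ≃ₗᵢ[ℝ] ℂ :=
  rotation ⟨Complex.I, mem_sphere_zero_iff_norm.2 Complex.norm_I⟩

theorem rotI_apply (x : ℂ) : rotI x = Complex.I * x := rfl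

theorem volume_preimage_inter_closedBall (J : ℂ ≃ₗᵢ[ℝ] ℂ) {S : Set ℂ} (hS : MeasurableSet S) :
    volume (J ⁻¹' S ∩ Metric.closedBall 0 1) = volume (S ∩ Metric.closedBall 0 1) := by
  have : J ⁻¹' S ∩ Metric.closedBall 0 1 = J ⁻¹' (S ∩ Metric.closedBall 0 1) := by
    ext x; simp
  rw [this, J.measurePreserving.measure_preimage
    (hS.inter measurableSet_closedBall).nullMeasurableSet]

/-- The set of vectors of the unit ball whose orthogonal plane meets a pointed cone of a plane
outside the origin has at least the volume that the Crofton formula predicts. -/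
theorem exists_measurableSet_of_cone (V : Submodule ℝ E3) (hV : Module.finrank ℝ V = 2)
    {D : Set E3} (hD : IsClosed D) (hcone : ∀ r : ℝ, 0 < r → ∀ x ∈ D, r • x ∈ D)
    (hsal : ∀ x ∈ D, -x ∈ D → x = 0) :
    ∃ H : Set E3, MeasurableSet H ∧
      (∀ u ∈ H, ‖u‖ ≤ 1 ∧ ∃ v ∈ D, v ∈ V ∧ v ≠ 0 ∧ inner ℝ u v = 0) ∧
      volume H * volume (Metric.closedBall (0 : ℂ) 1) =
        volume (Metric.closedBall (0 : E3) 1) *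
          (2 * volume {v : V | ‖v‖ ≤ 1 ∧ (v : E3) ∈ D}) := by
  let e : ℂ ≃ₗᵢ[ℝ] V := Complex.orthonormalBasisOneI.equiv (stdOrthonormalBasis ℝ V)
    (finCongr hV.symm)
  let f : ℂ →ₗᵢ[ℝ] E3 := V.subtypeₗᵢ.comp e.toLinearIsometry
  have hf : ∀ x, f x = (e x : E3) := fun x => rfl
  let S : Set ℂ := {y | y ≠ 0 ∧ f y ∈ D}
  have hfm : Measurable f := f.continuous.measurable
  have hS : MeasurableSet S := (measurableSet_singleton (0 : ℂ)).compl.inter (hfm hD.measurableSet)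
  -- `u` is orthogonal to a nonzero vector of the planar cone if and only if a rotation by a right
  -- angle, in one of the two senses, carries the projection of `u` into the cone
  let J' : ℂ ≃ₗᵢ[ℝ] ℂ := rotI.trans (LinearIsometryEquiv.neg ℝ)
  let T : Set ℂ := rotI ⁻¹' S ∪ J' ⁻¹' S
  have hT : MeasurableSet T := (rotI.continuous.measurable hS).union (J'.continuous.measurable hS)
  have hSc : ∀ r : ℝ, 0 < r → ∀ y ∈ S, r • y ∈ S := by
    rintro r hr y ⟨h1, h2⟩
    exact ⟨smul_ne_zero hr.ne' h1, by rw [map_smul]; exact hcone r hr _ h2⟩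
  have hTc : ∀ r : ℝ, 0 < r → ∀ y ∈ T, r • y ∈ T := by
    rintro r hr y (h | h)
    · left
      rw [mem_preimage, map_smul]
      exact hSc r hr _ h
    · right
      rw [mem_preimage, map_smul]
      exact hSc r hr _ h
  have hadj : ∀ u x, inner ℝ (ContinuousLinearMap.adjoint f.toContinuousLinearMap u) x =
      inner ℝ u (f x) := fun u x =>
    ContinuousLinearMap.adjoint_inner_left f.toContinuousLinearMap x u
  have hJ0 : ∀ x : ℂ, inner ℝ x (rotI x) = 0 := by
    intro x
    rw [rotI_apply, Complex.inner]
    simp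
    ring
  have hvolT : volume (T ∩ Metric.closedBall 0 1) =
      2 * volume {v : V | ‖v‖ ≤ 1 ∧ (v : E3) ∈ D} := by
    have hdisj : Disjoint (rotI ⁻¹' S ∩ Metric.closedBall 0 1)
        (J' ⁻¹' S ∩ Metric.closedBall 0 1) := by
      rw [Set.disjoint_left]
      rintro x ⟨⟨h1, h2⟩, -⟩ ⟨⟨-, h3⟩, -⟩
      have : f (J' x) = -f (rotI x) := by simp [J']
      rw [this] at h3
      have h4 := hsal _ h2 h3
      rw [← f.map_zero] at h4
      exact h1 (f.injective h4)
    rw [union_inter_distrib_right, measure_union hdisj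
      ((J'.continuous.measurable hS).inter measurableSet_closedBall),
      volume_preimage_inter_closedBall _ hS, volume_preimage_inter_closedBall _ hS, ← two_mul]
    congr 1
    have h1 : MeasurableSet {v : V | ‖v‖ ≤ 1 ∧ (v : E3) ∈ D} :=
      (isClosed_le continuous_norm continuous_const).measurableSet.inter
        (measurable_subtype_coe hD.measurableSet)
    rw [← e.measurePreserving.measure_preimage h1.nullMeasurableSet]
    refine measure_congr ?_
    have h0 : ∀ᵐ x : ℂ, x ≠ 0 := by
      rw [ae_iff]; simp
    filter_upwards [h0] with x hx
    refine propext ?_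
    change (x ≠ 0 ∧ f x ∈ D) ∧ x ∈ Metric.closedBall 0 1 ↔ ‖e x‖ ≤ 1 ∧ (e x : E3) ∈ D
    rw [mem_closedBall_zero_iff, e.norm_map, hf]
    tauto
  refine ⟨{u | ‖u‖ ≤ 1 ∧ ContinuousLinearMap.adjoint f.toContinuousLinearMap u ∈ T}, ?_, ?_, ?_⟩
  · exact (isClosed_le continuous_norm continuous_const).measurableSet.inter
      ((ContinuousLinearMap.continuous _).measurable hT)
  · rintro u ⟨hu, h⟩
    refine ⟨hu, ?_⟩
    rcases h with ⟨h1, h2⟩ | ⟨h1, h2⟩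
    · refine ⟨_, h2, (e _).2, fun h0 => h1 (f.injective (h0.trans f.map_zero.symm)), ?_⟩
      rw [← hadj, hJ0]
    · refine ⟨_, h2, (e _).2, fun h0 => h1 (f.injective (h0.trans f.map_zero.symm)), ?_⟩
      rw [← hadj]
      simp [J', hJ0]
  · rw [volume_adjoint_mem_cone f hT hTc, hvolT]

/-- The volume of the set of vectors of the unit ball whose orthogonal plane separates `p` from
`q` is at most proportional to the angle between `p` and `q`. -/
theorem volume_inner_mul_inner_neg_le {p q : E3} (hp : p ≠ 0) (hpq : ∀ r : ℝ, q ≠ r • p) :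
    volume {u : E3 | ‖u‖ ≤ 1 ∧ inner ℝ u p * inner ℝ u q < 0} *
      volume (Metric.closedBall (0 : ℂ) 1) ≤
    volume (Metric.closedBall (0 : E3) 1) *
      ENNReal.ofReal (InnerProductGeometry.angle p q) := by
  have hq : q ≠ 0 := by simpa using hpq 0
  have hpn : 0 < ‖p‖ := norm_pos_iff.2 hp
  have hqn : 0 < ‖q‖ := norm_pos_iff.2 hq
  set θ := InnerProductGeometry.angle p q with hθ
  -- an orthonormal basis `e₀, e₁` of the plane of `p` and `q` in which `q` has the argument `θ`
  set e₀ : E3 := ‖p‖⁻¹ • p with he₀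
  have he₀n : ‖e₀‖ = 1 := by rw [he₀, norm_smul]; simp [hpn.ne']
  have hpe : p = ‖p‖ • e₀ := by rw [he₀, smul_inv_smul₀ hpn.ne']
  have hcos : inner ℝ e₀ q = ‖q‖ * Real.cos θ := by
    rw [hθ, InnerProductGeometry.cos_angle, he₀, real_inner_smul_left]
    field_simp
  set q' : E3 := q - (‖q‖ * Real.cos θ) • e₀ with hq'
  have hq'0 : q' ≠ 0 := by
    intro h
    rw [hq', sub_eq_zero, he₀, smul_smul] at h
    exact hpq _ h
  have hq'n : 0 < ‖q'‖ := norm_pos_iff.2 hq'0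
  have he₀q' : inner ℝ e₀ q' = 0 := by
    rw [hq', inner_sub_right, hcos, inner_smul_right, real_inner_self_eq_norm_sq, he₀n]
    ring
  have hsin : ‖q'‖ = ‖q‖ * Real.sin θ := by
    have h1 : ‖q‖ ^ 2 = ‖q'‖ ^ 2 + (‖q‖ * Real.cos θ) ^ 2 := by
      have : q = q' + (‖q‖ * Real.cos θ) • e₀ := by rw [hq']; abel
      conv_lhs => rw [this]
      rw [norm_add_sq_real, inner_smul_right, real_inner_comm, he₀q', norm_smul, he₀n,
        Real.norm_eq_abs, mul_one, sq_abs]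
      ring
    have h2 : ‖q'‖ ^ 2 = (‖q‖ * Real.sin θ) ^ 2 := by
      have := Real.sin_sq_add_cos_sq θ
      nlinarith
    have h3 : 0 ≤ ‖q‖ * Real.sin θ :=
      mul_nonneg hqn.le (InnerProductGeometry.sin_angle_nonneg p q)
    exact (sq_eq_sq₀ hq'n.le h3).1 h2
  set e₁ : E3 := ‖q'‖⁻¹ • q' with he₁
  have he₁n : ‖e₁‖ = 1 := by rw [he₁, norm_smul]; simp [hq'n.ne']
  have he₀₁ : inner ℝ e₀ e₁ = 0 := by rw [he₁, inner_smul_right, he₀q', mul_zero]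
  have hqe : q = ‖q‖ • (Real.cos θ • e₀ + Real.sin θ • e₁) := by
    have : q' = ‖q'‖ • e₁ := by rw [he₁, smul_inv_smul₀ hq'n.ne']
    rw [hsin] at this
    rw [smul_add, smul_smul ‖q‖ (Real.cos θ) e₀, smul_smul ‖q‖ (Real.sin θ) e₁, ← this, hq']
    abel
  let f₀ : ℂ →ₗ[ℝ] E3 := Complex.reLm.smulRight e₀ + Complex.imLm.smulRight e₁
  have hf₀ : ∀ x, f₀ x = x.re • e₀ + x.im • e₁ := fun x => rfl
  let f : ℂ →ₗᵢ[ℝ] E3 := f₀.isometryOfInner (by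
    intro x y
    have he₁₀ : inner ℝ e₁ e₀ = 0 := by rw [real_inner_comm]; exact he₀₁
    simp only [hf₀, inner_add_left, inner_add_right, real_inner_smul_left, real_inner_smul_right,
      real_inner_self_eq_norm_sq, he₀n, he₁n, he₀₁, he₁₀, Complex.inner, Complex.mul_re,
      Complex.conj_re, Complex.conj_im]
    ring)
  have hf : ∀ x, f x = x.re • e₀ + x.im • e₁ := fun x => rfl
  set a := ContinuousLinearMap.adjoint f.toContinuousLinearMap
  have hadj : ∀ u x, inner ℝ (a u) x = inner ℝ u (f x) := fun u x =>
    ContinuousLinearMap.adjoint_inner_left f.toContinuousLinearMap x u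
  let T : Set ℂ := {x | x.re * (x.re * Real.cos θ + x.im * Real.sin θ) < 0}
  have hT : MeasurableSet T :=
    (isOpen_lt (by fun_prop) continuous_const).measurableSet
  have hTc : ∀ r : ℝ, 0 < r → ∀ x ∈ T, r • x ∈ T := by
    intro r hr x hx
    simp only [T, mem_ofPred_eq, Complex.smul_re, Complex.smul_im, smul_eq_mul] at hx ⊢
    have : r * x.re * (r * x.re * Real.cos θ + r * x.im * Real.sin θ) =
      r ^ 2 * (x.re * (x.re * Real.cos θ + x.im * Real.sin θ)) := by ring
    rw [this]
    exact mul_neg_of_pos_of_neg (by positivity) hx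
  have hset : {u : E3 | ‖u‖ ≤ 1 ∧ inner ℝ u p * inner ℝ u q < 0} = {u | ‖u‖ ≤ 1 ∧ a u ∈ T} := by
    ext u
    refine and_congr_right fun _ => ?_
    have h1 : inner ℝ u p = ‖p‖ * (a u).re := by
      have := hadj u 1
      rw [hf] at this
      simp only [Complex.one_re, Complex.one_im, one_smul, zero_smul, add_zero] at this
      conv_lhs => rw [hpe]
      rw [inner_smul_right, ← this, Complex.inner]
      simp
    have h2 : inner ℝ u q = ‖q‖ * ((a u).re * Real.cos θ + (a u).im * Real.sin θ) := by
      have := hadj u ⟨Real.cos θ, Real.sin θ⟩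
      rw [hf] at this
      conv_lhs => rw [hqe]
      rw [inner_smul_right, ← this, Complex.inner]
      simp only [Complex.mul_re, Complex.conj_re, Complex.conj_im]
      ring
    rw [h1, h2]
    change _ ↔ (a u).re * ((a u).re * Real.cos θ + (a u).im * Real.sin θ) < 0
    have : ‖p‖ * (a u).re * (‖q‖ * ((a u).re * Real.cos θ + (a u).im * Real.sin θ)) =
      (‖p‖ * ‖q‖) * ((a u).re * ((a u).re * Real.cos θ + (a u).im * Real.sin θ)) := by ring
    rw [this]
    have hpq := mul_pos hpn hqn
    constructor
    · intro h
      by_contra! h'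
      exact absurd h (not_lt.2 (mul_nonneg hpq.le h'))
    · exact fun h => mul_neg_of_pos_of_neg hpq h
  rw [hset, volume_adjoint_mem_cone f hT hTc]
  gcongr
  -- after a rotation by a right angle the two sectors are `0 < arg < θ` and its opposite
  let S : Set ℂ := {y | y.arg ∈ Ioo 0 θ}
  have hS : MeasurableSet S := Complex.measurable_arg measurableSet_Ioo
  have hθπ : θ ≤ Real.pi := InnerProductGeometry.angle_le_pi _ _
  have harg : ∀ y : ℂ, 0 < y.im → 0 < y.re * Real.sin θ - y.im * Real.cos θ → y ∈ S := by
    intro y hy h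
    have h0 : 0 < y.arg := by
      refine lt_of_le_of_ne (Complex.arg_nonneg_iff.2 hy.le) fun h => ?_
      rw [eq_comm, Complex.arg_eq_zero_iff] at h
      exact hy.ne' h.2
    refine ⟨h0, ?_⟩
    by_contra! hle
    have hyn : 0 < ‖y‖ := norm_pos_iff.2 (by rintro rfl; simp at hy)
    have h1 : y.re = ‖y‖ * Real.cos y.arg := by
      rw [Complex.norm_mul_cos_arg]
    have h2 : y.im = ‖y‖ * Real.sin y.arg := by
      rw [Complex.norm_mul_sin_arg]
    have h3 : y.re * Real.sin θ - y.im * Real.cos θ = -(‖y‖ * Real.sin (y.arg - θ)) := by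
      rw [h1, h2, Real.sin_sub]; ring
    have h4 : 0 ≤ Real.sin (y.arg - θ) :=
      Real.sin_nonneg_of_nonneg_of_le_pi (by linarith)
        (by linarith [Complex.arg_le_pi y, InnerProductGeometry.angle_nonneg p q])
    rw [h3] at h
    nlinarith
  let J' : ℂ ≃ₗᵢ[ℝ] ℂ := rotI.trans (LinearIsometryEquiv.neg ℝ)
  have hsub : T ∩ Metric.closedBall 0 1 ⊆
      (rotI ⁻¹' S ∩ Metric.closedBall 0 1) ∪ (J' ⁻¹' S ∩ Metric.closedBall 0 1) := by
    rintro x ⟨hx, hxb⟩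
    change x.re * (x.re * Real.cos θ + x.im * Real.sin θ) < 0 at hx
    rcases mul_neg_iff.1 hx with ⟨h1, h2⟩ | ⟨h1, h2⟩
    · refine Or.inl ⟨harg _ ?_ ?_, hxb⟩ <;> simp [rotI_apply] <;> linarith
    · refine Or.inr ⟨harg _ ?_ ?_, hxb⟩ <;> simp [J', rotI_apply] <;> linarith
  refine (measure_mono hsub).trans ((measure_union_le _ _).trans ?_)
  rw [volume_preimage_inter_closedBall _ hS, volume_preimage_inter_closedBall _ hS,
    volume_sector hθπ, ← ENNReal.ofReal_add
      (by linarith [InnerProductGeometry.angle_nonneg p q])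
      (by linarith [InnerProductGeometry.angle_nonneg p q])]
  rw [add_halves]

/-! ### The total angle at the apex of a polyhedral cone -/

theorem ae_inner_ne_zero {v : E3} (hv : v ≠ 0) : ∀ᵐ u : E3, inner ℝ u v ≠ 0 := by
  have h : LinearMap.ker (innerSL ℝ v).toLinearMap ≠ ⊤ := by
    intro h
    have h1 : v ∈ LinearMap.ker (innerSL ℝ v).toLinearMap := by rw [h]; trivial
    apply hv
    simpa using h1
  have h0 := Measure.addHaar_submodule volume _ h
  rw [ae_iff]
  refine measure_mono_null (fun u hu => ?_) h0
  have hu' : inner ℝ u v = 0 := by simpa using hu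
  change inner ℝ v u = 0
  rw [real_inner_comm]
  exact hu'

/-- At most two facets of a pointed polyhedral cone meet a generic plane through the apex: of
three coplanar boundary rays one is a nonnegative combination of the other two, and then it shares
a supporting plane with one of them. -/
theorem not_three_facets {ι : Type*} {s : Finset ι} {φ : ι → StrongDual ℝ E3} {ℓ : StrongDual ℝ E3}
    (hℓ : ∀ v, (∀ i ∈ s, φ i v ≤ 0) → v ≠ 0 → 0 < ℓ v) {u : E3} (hu : u ≠ 0)
    (hgen : ∀ i ∈ s, ∀ j ∈ s, i ≠ j → ∀ v, v ≠ 0 → φ i v = 0 → φ j v = 0 → inner ℝ u v ≠ 0)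
    {i : Fin 3 → ι} (hi : ∀ k, i k ∈ s) (hinj : Function.Injective i) {v : Fin 3 → E3}
    (hv0 : ∀ k, v k ≠ 0) (hvD : ∀ k, ∀ j ∈ s, φ j (v k) ≤ 0) (hvφ : ∀ k, φ (i k) (v k) = 0)
    (hvu : ∀ k, inner ℝ u (v k) = 0) : False := by
  have hdep : ¬ LinearIndependent ℝ v := by
    intro hli
    have htop := hli.span_eq_top_of_card_eq_finrank (by simp)
    have hmem : u ∈ Submodule.span ℝ (range v) := by rw [htop]; trivial
    have hle : Submodule.span ℝ (range v) ≤ LinearMap.ker (innerSL ℝ u).toLinearMap := by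
      rw [Submodule.span_le]
      rintro _ ⟨k, rfl⟩
      exact hvu k
    have : inner ℝ u u = 0 := hle hmem
    exact hu (inner_self_eq_zero.1 this)
  obtain ⟨g, hg, k₀, hk₀⟩ := Fintype.not_linearIndependent_iff.1 hdep
  have hℓv : ∀ k, 0 < ℓ (v k) := fun k => hℓ _ (hvD k) (hv0 k)
  -- one of the rays is not a nonnegative combination of the other two
  have key : ∀ a b c : Fin 3, a ≠ c → b ≠ c → ∀ α β γ : ℝ, 0 ≤ α → 0 ≤ β → γ < 0 →
      α • v a + β • v b + γ • v c = 0 → False := by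
    intro a b c hac hbc α β γ hα hβ hγ h
    have h1 := congrArg (φ (i c)) h
    simp only [map_add, map_smul, smul_eq_mul, hvφ c, mul_zero, add_zero, map_zero] at h1
    have h2 := mul_nonpos_of_nonneg_of_nonpos hα (hvD a (i c) (hi c))
    have h3 := mul_nonpos_of_nonneg_of_nonpos hβ (hvD b (i c) (hi c))
    have hα0 : α = 0 := by
      by_contra hα0
      have h4 : φ (i c) (v a) = 0 := by
        rcases mul_eq_zero.1 (show α * φ (i c) (v a) = 0 by linarith) with h | h
        · exact absurd h hα0
        · exact h
      exact hgen _ (hi a) _ (hi c) (fun h => hac (hinj h)) _ (hv0 a) (hvφ a) h4 (hvu a)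
    have hβ0 : β = 0 := by
      by_contra hβ0
      have h4 : φ (i c) (v b) = 0 := by
        rcases mul_eq_zero.1 (show β * φ (i c) (v b) = 0 by linarith) with h | h
        · exact absurd h hβ0
        · exact h
      exact hgen _ (hi b) _ (hi c) (fun h => hbc (hinj h)) _ (hv0 b) (hvφ b) h4 (hvu b)
    rw [hα0, hβ0, zero_smul, zero_smul, zero_add, zero_add, smul_eq_zero] at h
    exact h.elim hγ.ne (hv0 c)
  have pos : ∀ α β γ : ℝ, 0 ≤ α → 0 ≤ β → 0 ≤ γ → α • v 0 + β • v 1 + γ • v 2 = 0 →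
      α = 0 ∧ β = 0 ∧ γ = 0 := by
    intro α β γ hα hβ hγ h
    have h1 := congrArg ℓ h
    simp only [map_add, map_smul, smul_eq_mul, map_zero] at h1
    have a0 := mul_nonneg hα (hℓv 0).le
    have a1 := mul_nonneg hβ (hℓv 1).le
    have a2 := mul_nonneg hγ (hℓv 2).le
    refine ⟨?_, ?_, ?_⟩
    · exact (mul_eq_zero.1 (show α * ℓ (v 0) = 0 by linarith)).resolve_right (hℓv 0).ne'
    · exact (mul_eq_zero.1 (show β * ℓ (v 1) = 0 by linarith)).resolve_right (hℓv 1).ne'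
    · exact (mul_eq_zero.1 (show γ * ℓ (v 2) = 0 by linarith)).resolve_right (hℓv 2).ne'
  rw [Fin.sum_univ_three] at hg
  have main : ∀ α β γ : ℝ, ¬ (α = 0 ∧ β = 0 ∧ γ = 0) → α • v 0 + β • v 1 + γ • v 2 = 0 →
      0 ≤ α → False := by
    intro α β γ hne h hα
    rcases le_or_gt 0 β with hβ | hβ <;> rcases le_or_gt 0 γ with hγ | hγ
    · exact hne (pos α β γ hα hβ hγ h)
    · exact key 0 1 2 (by decide) (by decide) α β γ hα hβ hγ h
    · exact key 0 2 1 (by decide) (by decide) α γ β hα hγ hβ (by rw [← h]; abel)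
    · rcases hα.eq_or_lt with h0 | h0
      · have := pos (-α) (-β) (-γ) (by linarith) (by linarith) (by linarith) (by
          rw [← neg_eq_zero, ← h]; module)
        exact hne ⟨by linarith [this.1], by linarith [this.2.1], by linarith [this.2.2]⟩
      · exact key 1 2 0 (by decide) (by decide) (-β) (-γ) (-α) (by linarith) (by linarith)
          (by linarith) (by rw [← neg_eq_zero, ← h]; module)
  have hne : ¬ (g 0 = 0 ∧ g 1 = 0 ∧ g 2 = 0) := by
    rintro ⟨h0, h1, h2⟩
    fin_cases k₀
    exacts [hk₀ h0, hk₀ h1, hk₀ h2]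
  rcases le_total 0 (g 0) with h | h
  · exact main _ _ _ hne hg h
  · refine main (-g 0) (-g 1) (-g 2) (by simpa using hne) ?_ (by linarith)
    rw [← neg_eq_zero, ← hg]; module

theorem weighted_sum_pos {b c e x y t : ℝ} (hb : 0 ≤ b) (hc : 0 ≤ c) (he : 0 ≤ e)
    (h : 0 < b + c + e) (hx : 0 < x) (hy : 0 < y) (ht : 0 < t) : 0 < b * x + c * y + e * t := by
  have h1 := mul_nonneg hb hx.le
  have h2 := mul_nonneg hc hy.le
  have h3 := mul_nonneg he ht.le
  rcases hb.eq_or_lt with rfl | hb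
  · rcases hc.eq_or_lt with rfl | hc
    · have := mul_pos (show 0 < e by linarith) ht
      linarith
    · have := mul_pos hc hy
      linarith
  · have := mul_pos hb hx
    linarith

/-- The total angle at the apex of the facets of a polyhedral cone is at most that of a
trihedral cone containing it. The facets lie in the planes `V i`, and twice the area of a planar
cone in the unit disc is its angle. By the Crofton formula the total angle measures how often the
facets meet a random plane through the apex; this happens at most twice, and only for planes that
meet the trihedral cone, two of whose facets they then meet. -/
theorem sum_area_le {ι : Type*} (s : Finset ι) {φ : ι → StrongDual ℝ E3}
    (hφ0 : ∀ i ∈ s, φ i ≠ 0) (hpair : ∀ i ∈ s, ∀ j ∈ s, i ≠ j → ∀ r : ℝ, φ j ≠ r • φ i)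
    {V : ι → Submodule ℝ E3} (hV : ∀ i ∈ s, Module.finrank ℝ (V i) = 2)
    (hVφ : ∀ i ∈ s, ∀ v ∈ V i, φ i v = 0) {p q w : E3} {b c e : StrongDual ℝ E3}
    (hdec : ∀ v, v = b v • p + c v • q + e v • w)
    (hD : ∀ v, (∀ i ∈ s, φ i v ≤ 0) → 0 ≤ b v ∧ 0 ≤ c v ∧ 0 ≤ e v)
    (hp : p ≠ 0) (hq : q ≠ 0) (hw : w ≠ 0) (hpq : ∀ r : ℝ, q ≠ r • p) (hpw : ∀ r : ℝ, w ≠ r • p)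
    (hqw : ∀ r : ℝ, w ≠ r • q) :
    ∑ i ∈ s, 2 * (volume {v : V i | ‖v‖ ≤ 1 ∧ ∀ j ∈ s, φ j (v : E3) ≤ 0}).toReal ≤
      InnerProductGeometry.angle p q + InnerProductGeometry.angle p w +
        InnerProductGeometry.angle q w := by
  classical
  set D : Set E3 := {v | ∀ i ∈ s, φ i v ≤ 0} with hDdef
  have hDclosed : IsClosed D := by
    have : D = ⋂ i ∈ s, {v | φ i v ≤ 0} := by ext; simp [hDdef]
    rw [this]
    exact isClosed_biInter fun i _ => isClosed_le (by fun_prop) continuous_const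
  have hDcone : ∀ r : ℝ, 0 < r → ∀ x ∈ D, r • x ∈ D := by
    intro r hr x hx i hi
    rw [map_smul, smul_eq_mul]
    exact mul_nonpos_of_nonneg_of_nonpos hr.le (hx i hi)
  have hℓ : ∀ v ∈ D, v ≠ 0 → 0 < (b + c + e) v := by
    intro v hv hv0
    obtain ⟨h1, h2, h3⟩ := hD v hv
    refine lt_of_le_of_ne (by simp only [add_apply]; linarith) fun h => hv0 ?_
    simp only [add_apply] at h
    have e1 : b v = 0 := by linarith
    have e2 : c v = 0 := by linarith
    have e3 : e v = 0 := by linarith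
    rw [hdec v, e1, e2, e3]
    simp
  have hsal : ∀ x ∈ D, -x ∈ D → x = 0 := by
    intro x hx hx'
    by_contra h0
    have h1 := hℓ x hx h0
    have h2 := hℓ (-x) hx' (by simpa using h0)
    rw [map_neg] at h2
    linarith
  have hex := fun i (hi : i ∈ s) =>
    exists_measurableSet_of_cone (V i) (hV i hi) hDclosed hDcone hsal
  choose! H hHm hHhit hHvol using hex
  let N : E3 → E3 → Set E3 := fun x y => {u | ‖u‖ ≤ 1 ∧ inner ℝ u x * inner ℝ u y < 0}
  have hNm : ∀ x y, MeasurableSet (N x y) := fun x y =>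
    (isClosed_le continuous_norm continuous_const).measurableSet.inter
      (isOpen_lt (f := fun u : E3 => inner ℝ u x * inner ℝ u y) (by fun_prop)
        continuous_const).measurableSet
  -- generic planes
  have hgen : ∀ᵐ u : E3, ∀ i ∈ s, ∀ j ∈ s, i ≠ j → ∀ v, v ≠ 0 → φ i v = 0 → φ j v = 0 →
      inner ℝ u v ≠ 0 := by
    refine (eventually_all_finset s).2 fun i hi => (eventually_all_finset s).2 fun j hj => ?_
    by_cases hij : i = j
    · exact Eventually.of_forall fun u h => absurd hij h
    obtain ⟨v, hv0, -, -, hv⟩ := exists_ne_zero_and_forall_eq_smul (hφ0 i hi) (hpair i hi j hj hij)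
    filter_upwards [ae_inner_ne_zero hv0] with u hu _ x hx h1 h2
    obtain ⟨t, rfl⟩ := hv x h1 h2
    rw [inner_smul_right]
    exact mul_ne_zero (by rintro rfl; simp at hx) hu
  -- a generic plane meets at most two facets, and if it meets a facet then it separates two of the
  -- three pairs of edges of the trihedral cone
  have hcount : ∀ᵐ u : E3, ∑ i ∈ s, (H i).indicator (1 : E3 → ENNReal) u ≤
      (N p q).indicator 1 u + (N p w).indicator 1 u + (N q w).indicator 1 u := by
    filter_upwards [hgen, ae_inner_ne_zero hp, ae_inner_ne_zero hq, ae_inner_ne_zero hw]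
      with u hu hup huq huw
    have hu0 : u ≠ 0 := by rintro rfl; simp at hup
    have hsum : ∑ i ∈ s, (H i).indicator (1 : E3 → ENNReal) u =
        (s.filter fun i => u ∈ H i).card := by
      simp [indicator_apply]
    rw [hsum]
    have hcard : (s.filter fun i => u ∈ H i).card ≤ 2 := by
      by_contra! hlt
      obtain ⟨i₀, h0, i₁, h1, i₂, h2, h01, h02, h12⟩ := Finset.two_lt_card.1 hlt
      rw [Finset.mem_filter] at h0 h1 h2
      obtain ⟨-, v₀, hv₀D, hv₀V, hv₀, hv₀u⟩ := hHhit _ h0.1 u h0.2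
      obtain ⟨-, v₁, hv₁D, hv₁V, hv₁, hv₁u⟩ := hHhit _ h1.1 u h1.2
      obtain ⟨-, v₂, hv₂D, hv₂V, hv₂, hv₂u⟩ := hHhit _ h2.1 u h2.2
      refine not_three_facets (s := s) (φ := φ) (i := ![i₀, i₁, i₂]) (v := ![v₀, v₁, v₂]) hℓ hu0 hu
        ?_ ?_ ?_ ?_ ?_ ?_
      · intro k; fin_cases k
        exacts [h0.1, h1.1, h2.1]
      · intro k l hkl
        fin_cases k <;> fin_cases l <;> first
          | rfl
          | exact absurd hkl h01
          | exact absurd hkl h02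
          | exact absurd hkl h12
          | exact absurd hkl.symm h01
          | exact absurd hkl.symm h02
          | exact absurd hkl.symm h12
      · intro k; fin_cases k
        exacts [hv₀, hv₁, hv₂]
      · intro k; fin_cases k
        exacts [hv₀D, hv₁D, hv₂D]
      · intro k; fin_cases k
        exacts [hVφ _ h0.1 _ hv₀V, hVφ _ h1.1 _ hv₁V, hVφ _ h2.1 _ hv₂V]
      · intro k; fin_cases k
        exacts [hv₀u, hv₁u, hv₂u]
    rcases (s.filter fun i => u ∈ H i).eq_empty_or_nonempty with h | ⟨i, hi⟩
    · simp [h]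
    rw [Finset.mem_filter] at hi
    obtain ⟨hun, v, hvD, -, hv0, hvu⟩ := hHhit _ hi.1 u hi.2
    obtain ⟨h1, h2, h3⟩ := hD v hvD
    have hpos := hℓ v hvD hv0
    simp only [add_apply] at hpos
    have hrel : b v * inner ℝ u p + c v * inner ℝ u q + e v * inner ℝ u w = 0 := by
      rw [← hvu]
      conv_rhs => rw [hdec v]
      simp only [inner_add_right, inner_smul_right]
    have h2le : (2 : ENNReal) ≤
        (N p q).indicator 1 u + (N p w).indicator 1 u + (N q w).indicator 1 u := by
      have hN : ∀ x y, u ∈ N x y ↔ inner ℝ u x * inner ℝ u y < 0 := fun x y => and_iff_right hun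
      simp only [indicator_apply, hN, Pi.one_apply]
      rcases lt_or_gt_of_ne hup with hup | hup <;> rcases lt_or_gt_of_ne huq with huq | huq <;>
        rcases lt_or_gt_of_ne huw with huw | huw
      · exfalso
        have := weighted_sum_pos h1 h2 h3 hpos (neg_pos.2 hup) (neg_pos.2 huq) (neg_pos.2 huw)
        linarith
      · rw [if_neg (by nlinarith), if_pos (by nlinarith), if_pos (by nlinarith)]; norm_num
      · rw [if_pos (by nlinarith), if_neg (by nlinarith), if_pos (by nlinarith)]; norm_num
      · rw [if_pos (by nlinarith), if_pos (by nlinarith), if_neg (by nlinarith)]; norm_num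
      · rw [if_pos (by nlinarith), if_pos (by nlinarith), if_neg (by nlinarith)]; norm_num
      · rw [if_pos (by nlinarith), if_neg (by nlinarith), if_pos (by nlinarith)]; norm_num
      · rw [if_neg (by nlinarith), if_pos (by nlinarith), if_pos (by nlinarith)]; norm_num
      · exfalso
        have := weighted_sum_pos h1 h2 h3 hpos hup huq huw
        linarith
    refine le_trans ?_ h2le
    exact_mod_cast hcard
  have hint : ∑ i ∈ s, volume (H i) ≤ volume (N p q) + volume (N p w) + volume (N q w) := by
    have h1 := lintegral_mono_ae hcount
    rw [lintegral_finsetSum' s fun i hi =>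
      (aemeasurable_const.indicator (hHm i hi)).congr (by rfl), lintegral_add_right _
      (measurable_one.indicator (hNm q w)), lintegral_add_right _
      (measurable_one.indicator (hNm p w)), lintegral_indicator_one (hNm p q),
      lintegral_indicator_one (hNm p w), lintegral_indicator_one (hNm q w)] at h1
    refine le_of_eq_of_le (Finset.sum_congr rfl fun i hi => ?_) h1
    rw [lintegral_indicator_one (hHm i hi)]
  set κ := volume (Metric.closedBall (0 : ℂ) 1)
  set β := volume (Metric.closedBall (0 : E3) 1)
  have hβ0 : β ≠ 0 := (Metric.measure_closedBall_pos volume _ one_pos).ne'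
  have hβt : β ≠ ⊤ := measure_closedBall_lt_top.ne
  set μ : ι → ENNReal := fun i => volume {v : V i | ‖v‖ ≤ 1 ∧ ∀ j ∈ s, φ j (v : E3) ≤ 0}
  have hμt : ∀ i, μ i ≠ ⊤ := fun i => by
    refine ne_top_of_le_ne_top (measure_closedBall_lt_top (x := (0 : V i)) (r := 1)).ne
      (measure_mono fun v hv => ?_)
    rw [mem_closedBall_zero_iff]
    exact hv.1
  have hmain : β * ∑ i ∈ s, 2 * μ i ≤ β * ENNReal.ofReal (InnerProductGeometry.angle p q +
      InnerProductGeometry.angle p w + InnerProductGeometry.angle q w) := by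
    calc β * ∑ i ∈ s, 2 * μ i = ∑ i ∈ s, volume (H i) * κ := by
          rw [Finset.mul_sum]
          exact Finset.sum_congr rfl fun i hi => (hHvol i hi).symm
      _ = (∑ i ∈ s, volume (H i)) * κ := by rw [Finset.sum_mul]
      _ ≤ (volume (N p q) + volume (N p w) + volume (N q w)) * κ := by gcongr
      _ = volume (N p q) * κ + volume (N p w) * κ + volume (N q w) * κ := by ring
      _ ≤ β * ENNReal.ofReal (InnerProductGeometry.angle p q) +
            β * ENNReal.ofReal (InnerProductGeometry.angle p w) +
            β * ENNReal.ofReal (InnerProductGeometry.angle q w) := by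
          exact add_le_add (add_le_add (volume_inner_mul_inner_neg_le hp hpq)
            (volume_inner_mul_inner_neg_le hp hpw)) (volume_inner_mul_inner_neg_le hq hqw)
      _ = _ := by
          rw [← mul_add, ← mul_add, ← ENNReal.ofReal_add (InnerProductGeometry.angle_nonneg _ _)
            (InnerProductGeometry.angle_nonneg _ _), ← ENNReal.ofReal_add (add_nonneg
            (InnerProductGeometry.angle_nonneg _ _) (InnerProductGeometry.angle_nonneg _ _))
            (InnerProductGeometry.angle_nonneg _ _)]
  have hmain' := (ENNReal.mul_le_mul_iff_right hβ0 hβt).1 hmain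
  have := ENNReal.toReal_mono ENNReal.ofReal_ne_top hmain'
  rw [ENNReal.toReal_ofReal (add_nonneg (add_nonneg (InnerProductGeometry.angle_nonneg _ _)
    (InnerProductGeometry.angle_nonneg _ _)) (InnerProductGeometry.angle_nonneg _ _)),
    ENNReal.toReal_sum fun i _ => ENNReal.mul_ne_top (by norm_num) (hμt i)] at this
  refine le_trans (Finset.sum_le_sum fun i _ => ?_) this
  rw [ENNReal.toReal_mul]
  norm_num
  exact le_rfl

/-! ### The angles at a corner -/

/-- A face through the point `A` of a region in which `P` is convex has a supporting plane at `A`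
that contains the directions of the face. -/
theorem exists_flat_of_mem_face {P U : Set E3} (hU : IsOpen U) {A : E3} (hA : A ∈ U)
    {F : Set E3} (hF : F ∈ faces P) (hAF : A ∈ F) :
    ∃ x ∈ U, ∃ φ : StrongDual ℝ E3, φ ≠ 0 ∧ AgreeNear P (hsp φ x) x ∧
      F = closure (connectedComponentIn (flatPoints P) x) ∧ (∀ y ∈ F, φ (y - x) = 0) ∧
      φ (x - A) = 0 := by
  obtain ⟨x₀, hx₀, rfl⟩ := hF
  obtain ⟨x, hxU, hx⟩ := mem_closure_iff.1 hAF U hU hA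
  obtain ⟨φ, hφ, h⟩ := mem_flatPoints_iff.1 (connectedComponentIn_subset _ _ hx)
  have hplane : ∀ y ∈ closure (connectedComponentIn (flatPoints P) x₀), φ (y - x) = 0 := by
    rw [connectedComponentIn_eq hx]
    exact fun y hy => closure_minimal (t := {y | φ (y - x) = 0})
      (fun y hy => (h.of_mem_connectedComponentIn hφ hy).1)
      (isClosed_eq (by fun_prop) continuous_const) hy
  refine ⟨x, hxU, φ, hφ, h, by rw [connectedComponentIn_eq hx], hplane, ?_⟩
  rw [← neg_sub, map_neg, hplane A hAF, neg_zero]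

theorem face_subset {P F : Set E3} (hP : IsPolyhedron P) (hF : F ∈ faces P) : F ⊆ P := by
  obtain ⟨x₀, hx₀, rfl⟩ := hF
  exact closure_minimal (fun x hx =>
    hP.isCompact.isClosed.frontier_subset (connectedComponentIn_subset _ _ hx).1)
      hP.isCompact.isClosed

theorem finrank_ker_dual {φ : StrongDual ℝ E3} (hφ : φ ≠ 0) :
    Module.finrank ℝ (LinearMap.ker φ.toLinearMap) = 2 := by
  have h1 := φ.toLinearMap.finrank_range_add_finrank_ker
  have h2 : LinearMap.range φ.toLinearMap = ⊤ := by
    rw [LinearMap.range_eq_top]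
    exact fun r => exists_dual_apply_eq hφ r
  rw [h2, finrank_top] at h1
  simp at h1
  omega

/-- The direction plane of a face is the kernel of the conormal at any of its flat points. -/
theorem vectorSpan_eq_ker {P F : Set E3} {x : E3} {φ : StrongDual ℝ E3} (hφ : φ ≠ 0)
    (h : AgreeNear P (hsp φ x) x) (hF : F = closure (connectedComponentIn (flatPoints P) x))
    (hplane : ∀ y ∈ F, φ (y - x) = 0) :
    vectorSpan ℝ F = LinearMap.ker φ.toLinearMap := by
  have hxf : x ∈ flatPoints P := mem_flatPoints_iff.2 ⟨φ, hφ, h⟩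
  have hxF : x ∈ F := by rw [hF]; exact subset_closure (mem_connectedComponentIn hxf)
  apply le_antisymm
  · rw [vectorSpan_def, Submodule.span_le]
    rintro _ ⟨y, hy, z, hz, rfl⟩
    change φ (y - z) = 0
    rw [← sub_sub_sub_cancel_right y z x, map_sub, hplane y hy, hplane z hz, sub_zero]
  · intro v hv
    have hv0 : φ v = 0 := hv
    obtain ⟨r, hr, h1, h2⟩ := exists_pos_ray
      (h.eventually_agree.and (eventually_mem_connectedComponentIn hxf)) v
    have h3 : x + r • v ∈ F := by
      rw [hF]
      exact subset_closure (h2 (mem_flatPoints_iff.2 ⟨φ, hφ, h1 (by simp [hv0])⟩))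
    have h4 := vsub_mem_vectorSpan ℝ h3 hxF
    rw [vsub_eq_sub, add_sub_cancel_left] at h4
    exact (Submodule.smul_mem_iff _ hr.ne').1 h4

/-- The sum of the angles at a vertex of a triangular face is at most the sum of the angles of
the trihedral angle formed by the planes of the triangle and of the two adjacent faces. -/
theorem IsTriangleCorner.finsum_faceAngle_le {P U : Set E3} {A B C z : E3}
    {b c d : StrongDual ℝ E3} {σ : ℝ} (hP : IsPolyhedron P)
    (h : IsTriangleCorner P U A B C z b c d σ) :
    ∑ᶠ F ∈ {F | F ∈ faces P ∧ A ∈ F}, faceAngle F A ≤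
      InnerProductGeometry.angle (B - A) (C - A) + InnerProductGeometry.angle (B - A) (-z) +
        InnerProductGeometry.angle (C - A) (-z) := by
  have hA : A ∈ U ∩ P := h.subset A (by simp) (by simp) (by simp) (by simp)
  set S : Set (Set E3) := {F | F ∈ faces P ∧ A ∈ F} with hS
  have hex : ∀ F ∈ S, _ := fun F (hF : F ∈ S) => exists_flat_of_mem_face h.isOpen hA.1 hF.1 hF.2
  choose! x hxU φ hφ hagree hFx hplane hxA using hex
  have hflat : ∀ F ∈ S, x F ∈ flatPoints P := fun F hF =>
    mem_flatPoints_iff.2 ⟨φ F, hφ F hF, hagree F hF⟩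
  have hhsp : ∀ F ∈ S, hsp (φ F) A = hsp (φ F) (x F) := fun F hF =>
    hsp_eq_of_apply_eq (by have := hxA F hF; rw [map_sub, sub_eq_zero] at this; exact this.symm)
  have hle : ∀ F ∈ S, ∀ y ∈ U ∩ P, φ F (y - A) ≤ 0 := by
    intro F hF y hy
    have h1 := (hagree F hF).le_of_convex h.convex_inter (hxU F hF) hy
    rw [← sub_add_sub_cancel y (x F) A, map_add, hxA F hF, add_zero]
    exact h1
  -- distinct faces through `A` have distinct planes, since `P` is convex near `A`
  have hxy : ∀ F ∈ S, ∀ G ∈ S, ∀ r : ℝ, φ G = r • φ F → F = G := by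
    intro F hF G hG r hr
    have hxG : φ F (x G - x F) = 0 := by
      have h1 := hxA G hG
      have hr0 : r ≠ 0 := by
        rintro rfl
        exact hφ G hG (by rw [hr, zero_smul])
      rw [hr, smul_apply, smul_eq_mul, mul_eq_zero] at h1
      rw [← sub_sub_sub_cancel_right (x G) (x F) A, map_sub, hxA F hF, h1.resolve_left hr0,
        sub_zero]
    rw [hFx F hF, hFx G hG, (hagree F hF).connectedComponentIn_eq h.isOpen h.convex_inter
      (hφ F hF) (hxU F hF) (hxU G hG) (hflat G hG) (hagree G hG).mem hxG]
  have hfin : S.Finite := by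
    refine Set.Finite.of_finite_image (f := fun F => hsp (φ F) A)
      ((hP.finite_faceHalfspaces U).subset ?_) ?_
    · rintro _ ⟨F, hF, rfl⟩
      exact mem_faceHalfspaces_iff.2 ⟨x F, hxU F hF, φ F, hφ F hF, hagree F hF, hhsp F hF⟩
    · intro F hF G hG hFG
      change hsp (φ F) A = hsp (φ G) A at hFG
      obtain ⟨r, -, hr⟩ := exists_smul_of_imp (φ := φ F) (ψ := φ G) (by
        intro v hv
        have : v + A ∈ hsp (φ G) A := by rw [← hFG]; simpa [hsp] using hv
        simpa [hsp] using this)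
      exact hxy F hF G hG r hr
  rw [finsum_mem_eq_finite_toFinset_sum _ hfin]
  have hmem : ∀ {F}, F ∈ hfin.toFinset ↔ F ∈ S := hfin.mem_toFinset
  -- the three planes of the trihedral angle are planes of faces through `A`
  have hthree : ∀ ψ : StrongDual ℝ E3, ψ ≠ 0 → hsp ψ A ∈ faceHalfspaces P U →
      ∃ F ∈ S, ∀ v, φ F v ≤ 0 → ψ v ≤ 0 := by
    intro ψ hψ hmem
    obtain ⟨y, hy, χ, hχ, hagr, he⟩ := mem_faceHalfspaces_iff.1 hmem
    rw [← he] at hagr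
    have h0 : ψ (y - A) = 0 := frontier_hsp_subset
      ((mem_frontier_iff_of_eventually hagr).1 (by
        rw [he] at hagr; exact hagr.mem_frontier hχ))
    have h1 : hsp ψ A = hsp ψ y := hsp_eq_of_apply_eq (by
      rw [map_sub, sub_eq_zero] at h0; exact h0.symm)
    rw [h1] at hagr
    have hyf : y ∈ flatPoints P := mem_flatPoints_iff.2 ⟨ψ, hψ, hagr⟩
    set F := closure (connectedComponentIn (flatPoints P) y) with hF
    have hFS : F ∈ S := ⟨⟨y, hyf, rfl⟩, hagr.mem_closure_connectedComponentIn h.isOpen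
      h.convex_inter hψ hy hA (by rw [← neg_sub, map_neg, h0, neg_zero])⟩
    refine ⟨F, hFS, ?_⟩
    have hy' : y ∈ connectedComponentIn (flatPoints P) (x F) := by
      refine mem_connectedComponentIn_of_mem_closure ?_ hyf
      rw [← hFx F hFS]
      exact subset_closure (mem_connectedComponentIn hyf)
    obtain ⟨-, h2⟩ := (hagree F hFS).of_mem_connectedComponentIn (hφ F hFS) hy'
    obtain ⟨r, hr, rfl⟩ := h2.exists_smul (ψ := ψ) (hagr.mono fun u hu huP => hu.1 huP)
    intro v hv
    rw [smul_apply, smul_eq_mul]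
    exact mul_nonpos_of_nonneg_of_nonpos hr hv
  have hb0 : -b ≠ 0 := by
    intro h0; have := h.b_B; rw [neg_eq_zero] at h0; simp [h0] at this
  have hc0 : -c ≠ 0 := by
    intro h0; have := h.c_C; rw [neg_eq_zero] at h0; simp [h0] at this
  have hd0 : d ≠ 0 := by
    intro h0; have := h.d_z; simp [h0] at this
  obtain ⟨Fb, hFb, hFb'⟩ := hthree _ hb0 h.mem_b
  obtain ⟨Fc, hFc, hFc'⟩ := hthree _ hc0 h.mem_c
  obtain ⟨Fd, hFd, hFd'⟩ := hthree _ hd0 h.mem_d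
  have hsum := sum_area_le hfin.toFinset (φ := φ) (V := fun F => vectorSpan ℝ F)
    (p := B - A) (q := C - A) (w := -z) (b := b) (c := c) (e := -d)
    (fun F hF => hφ F (hmem.1 hF))
    (fun F hF G hG hne r hr => hne (hxy F (hmem.1 hF) G (hmem.1 hG) r hr))
    (fun F hF => by
      have hF := hmem.1 hF
      rw [vectorSpan_eq_ker (hφ F hF) (hagree F hF) (hFx F hF) (hplane F hF),
        finrank_ker_dual (hφ F hF)])
    (fun F hF v hv => by
      have hF := hmem.1 hF
      rw [vectorSpan_eq_ker (hφ F hF) (hagree F hF) (hFx F hF) (hplane F hF)] at hv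
      exact hv)
    (fun v => by
      rw [neg_apply, neg_smul_neg]
      exact h.decomp v)
    (fun v hv => by
      have h1 := hFb' v (hv Fb (hmem.2 hFb))
      have h2 := hFc' v (hv Fc (hmem.2 hFc))
      have h3 := hFd' v (hv Fd (hmem.2 hFd))
      simp only [neg_apply] at h1 h2 ⊢
      exact ⟨by linarith, by linarith, by linarith⟩)
    (fun h0 => by have := h.b_B; simp [h0] at this)
    (fun h0 => by have := h.c_C; simp [h0] at this)
    (fun h0 => by have := h.d_z; rw [neg_eq_zero] at h0; simp [h0] at this)
    (fun r hr => by have := h.c_C; rw [hr, map_smul, h.c_B] at this; simp at this)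
    (fun r hr => by
      have := congrArg d hr
      rw [map_smul, map_neg, h.d_z, h.d_B] at this; simp at this)
    (fun r hr => by
      have := congrArg d hr
      rw [map_smul, map_neg, h.d_z, h.d_C] at this; simp at this)
  refine le_trans (Finset.sum_le_sum fun F hF => ?_) hsum
  rw [faceAngle, OrthonormalBasis.addHaar_eq_volume]
  refine mul_le_mul_of_nonneg_left (ENNReal.toReal_mono ?_ (measure_mono ?_)) (by norm_num)
  · refine ne_top_of_le_ne_top (measure_closedBall_lt_top (x := (0 : vectorSpan ℝ F)) (r := 1)).ne
      (measure_mono fun v hv => ?_)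
    rw [mem_closedBall_zero_iff]
    exact hv.1
  · rintro v ⟨hv, hv'⟩
    refine ⟨hv, fun G hG => ?_⟩
    obtain ⟨r, ⟨hr1, hr2⟩, hr⟩ := ((hv'.and (eventually_ray (h.isOpen.mem_nhds hA.1) (v : E3))).and
      self_mem_nhdsWithin).exists
    have := hle G (hmem.1 hG) _ ⟨hr2, face_subset hP (hmem.1 hF).1 hr1⟩
    rw [add_sub_cancel_left, map_smul, smul_eq_mul] at this
    exact nonpos_of_mul_nonpos_right this hr

/-! ### Attaching a tetrahedron to the face -/

/-- The tetrahedron with base `A B C` and apex `A + t • z`, in the coordinates of a corner. -/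
def tetra (A : E3) (b c d : StrongDual ℝ E3) (t : ℝ) : Set E3 :=
  {x | 0 ≤ b (x - A) ∧ 0 ≤ c (x - A) ∧ 0 ≤ d (x - A) ∧
    b (x - A) + c (x - A) + t⁻¹ * d (x - A) ≤ 1}

/-- The height `t` is so small that the tetrahedron `tetra A b c d t` lies in `U` and satisfies
the inequalities of all faces of `P` that meet `U`, except that of the face `d = 0`. The condition
`σ < t⁻¹` says that the plane `b + c + t⁻¹ * d = 1` of the upper face of the tetrahedron is strictly
between the planes of the triangle and of the face adjacent to the side `B C`. -/
structure IsSmallHeight (P U : Set E3) (A z : E3) (b c d : StrongDual ℝ E3) (σ t : ℝ) : Prop where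
  pos : 0 < t
  tetra_subset : tetra A b c d t ⊆ U
  lt_inv : σ < t⁻¹
  tip_mem : ∀ H ∈ faceHalfspaces P U, H ≠ hsp d A → A + t • z ∈ H

theorem tetra_swap (A : E3) (b c d : StrongDual ℝ E3) (t : ℝ) :
    tetra A c b d t = tetra A b c d t := by
  ext x
  simp only [tetra, mem_ofPred_eq]
  rw [add_comm (c (x - A))]
  tauto

theorem isClosed_tetra (A : E3) (b c d : StrongDual ℝ E3) (t : ℝ) : IsClosed (tetra A b c d t) := by
  have h1 : IsClosed {x : E3 | 0 ≤ b (x - A)} := isClosed_le continuous_const (by fun_prop)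
  have h2 : IsClosed {x : E3 | 0 ≤ c (x - A)} := isClosed_le continuous_const (by fun_prop)
  have h3 : IsClosed {x : E3 | 0 ≤ d (x - A)} := isClosed_le continuous_const (by fun_prop)
  have h4 : IsClosed {x : E3 | b (x - A) + c (x - A) + t⁻¹ * d (x - A) ≤ 1} :=
    isClosed_le (by fun_prop) continuous_const
  exact h1.inter (h2.inter (h3.inter h4))

namespace IsTriangleCorner

variable {P U : Set E3} {A B C z : E3} {b c d : StrongDual ℝ E3} {σ t : ℝ}

/-- The roles of `B` and `C` may be interchanged. -/
theorem swap (h : IsTriangleCorner P U A B C z b c d σ) :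
    IsTriangleCorner P U A C B z c b d σ where
  isOpen := h.isOpen
  convex := h.convex
  convex_inter := h.convex_inter
  norm_z := h.norm_z
  decomp v := by rw [add_comm (c v • (C - A))]; exact h.decomp v
  b_B := h.c_C
  b_C := h.c_B
  b_z := h.c_z
  c_B := h.b_C
  c_C := h.b_B
  c_z := h.b_z
  d_B := h.d_C
  d_C := h.d_B
  d_z := h.d_z
  mem_b := h.mem_c
  mem_c := h.mem_b
  mem_d := h.mem_d
  mem_far := by
    have : hsp (c + b + σ • d) C = hsp (b + c + σ • d) B := by
      rw [add_comm c b]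
      refine hsp_eq_of_apply_eq ?_
      have h1 : (b + c + σ • d) (C - B) = 0 := by
        have key : ∀ v, (b + c + σ • d) v = b v + c v + σ * d v := fun v => rfl
        rw [← sub_sub_sub_cancel_right C B A, map_sub, key, key, h.b_C, h.c_C, h.d_C, h.b_B, h.c_B,
          h.d_B]
        simp
      rwa [map_sub, sub_eq_zero] at h1
    rw [this]
    exact h.mem_far
  subset x h1 h2 h3 h4 := h.subset x h1 h3 h2 (by linarith)
  face := by
    obtain ⟨x₀, hx₀, hx⟩ := h.face
    refine ⟨x₀, hx₀, ?_⟩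
    rw [hx]
    ext x
    simp only [mem_ofPred_eq]
    rw [add_comm (c (x - A))]
    tauto
  notMem x h1 h2 h3 h4 h5 := by
    obtain ⟨h6, h7, h8⟩ := h.notMem x h1 h3 h2 (by linarith) h5
    exact ⟨h7, h6, by linarith⟩

theorem b_ne_zero (h : IsTriangleCorner P U A B C z b c d σ) : -b ≠ 0 := by
  intro h0; have := h.b_B; rw [neg_eq_zero] at h0; simp [h0] at this

theorem c_ne_zero (h : IsTriangleCorner P U A B C z b c d σ) : -c ≠ 0 := h.swap.b_ne_zero

theorem d_ne_zero (h : IsTriangleCorner P U A B C z b c d σ) : d ≠ 0 := by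
  intro h0; have := h.d_z; simp [h0] at this

theorem mem_A (h : IsTriangleCorner P U A B C z b c d σ) : A ∈ U ∩ P :=
  h.subset A (by simp) (by simp) (by simp) (by simp)

theorem mem_B (h : IsTriangleCorner P U A B C z b c d σ) : B ∈ U ∩ P :=
  h.subset B h.d_B (by simp [h.b_B]) h.c_B.ge (by simp [h.b_B, h.c_B])

theorem mem_C (h : IsTriangleCorner P U A B C z b c d σ) : C ∈ U ∩ P := h.swap.mem_B

theorem inter_eq (h : IsTriangleCorner P U A B C z b c d σ) (hP : IsPolyhedron P) :
    U ∩ P = U ∩ ⋂₀ faceHalfspaces P U :=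
  hP.inter_eq h.isOpen h.convex h.convex_inter ⟨A, h.mem_A⟩

theorem d_nonpos (h : IsTriangleCorner P U A B C z b c d σ) (hP : IsPolyhedron P) {x : E3}
    (hx : x ∈ U ∩ P) : d (x - A) ≤ 0 := by
  rw [h.inter_eq hP] at hx
  exact hx.2 _ h.mem_d

theorem b_nonneg (h : IsTriangleCorner P U A B C z b c d σ) (hP : IsPolyhedron P) {x : E3}
    (hx : x ∈ U ∩ P) : 0 ≤ b (x - A) := by
  rw [h.inter_eq hP] at hx
  have := hx.2 _ h.mem_b
  rw [mem_hsp, neg_apply] at this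
  linarith

theorem c_nonneg (h : IsTriangleCorner P U A B C z b c d σ) (hP : IsPolyhedron P) {x : E3}
    (hx : x ∈ U ∩ P) : 0 ≤ c (x - A) := h.swap.b_nonneg hP hx

theorem far_apply (h : IsTriangleCorner P U A B C z b c d σ) (s : ℝ) (x : E3) :
    (b + c + s • d) (x - B) = b (x - A) + c (x - A) + s * d (x - A) - 1 := by
  have key : ∀ v, (b + c + s • d) v = b v + c v + s * d v := fun v => rfl
  rw [← sub_sub_sub_cancel_right x B A, map_sub, key, key, h.b_B, h.c_B, h.d_B]
  ring

theorem far_le (h : IsTriangleCorner P U A B C z b c d σ) (hP : IsPolyhedron P) {x : E3}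
    (hx : x ∈ U ∩ P) : b (x - A) + c (x - A) + σ * d (x - A) ≤ 1 := by
  rw [h.inter_eq hP] at hx
  have := hx.2 _ h.mem_far
  rw [mem_hsp, h.far_apply] at this
  linarith

theorem hsp_b_ne (h : IsTriangleCorner P U A B C z b c d σ) : hsp (-b) A ≠ hsp d A := by
  intro he
  have h1 : A + z ∈ hsp (-b) A := by simp [hsp, h.b_z]
  rw [he] at h1
  simp [hsp, h.d_z] at h1
  linarith

theorem hsp_far_ne (h : IsTriangleCorner P U A B C z b c d σ) (ht : 0 < t) (hσ : σ < t⁻¹) :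
    hsp (b + c + σ • d) B ≠ hsp d A := by
  intro he
  have h1 : A + t • z ∈ hsp (b + c + σ • d) B := by
    rw [mem_hsp, h.far_apply]
    have : σ * t < 1 := by rwa [← lt_inv_mul_iff₀' ht, mul_one]
    simp only [add_sub_cancel_left, map_smul, h.b_z, h.c_z, h.d_z, smul_eq_mul]
    linarith
  rw [he] at h1
  simp [hsp, h.d_z] at h1
  linarith

/-- The ray from `A` in the direction `z`, along which the planes of the two faces adjacent to
the triangle meet, stays inside the half-spaces of the other faces through `A`. -/
theorem apply_z_nonpos (h : IsTriangleCorner P U A B C z b c d σ) (hP : IsPolyhedron P)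
    {φ : StrongDual ℝ E3} {x : E3} (hx : x ∈ U) (hxφ : AgreeNear P (hsp φ x) x)
    (hxA : φ (x - A) = 0) (hne : hsp φ x ≠ hsp d A) : φ z ≤ 0 := by
  by_contra! hz
  apply hne
  have hsupp : ∀ y ∈ U ∩ P, φ (y - A) ≤ 0 := fun y hy => by
    have := hxφ.le_of_convex h.convex_inter hx hy
    rwa [← sub_add_sub_cancel y x A, map_add, hxA, add_zero]
  have hB := hsupp B h.mem_B
  have hC := hsupp C h.mem_C
  have hzero : ∀ y ∈ U ∩ P, φ (y - A) = 0 → d (y - A) = 0 := by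
    intro y hy h0
    rw [h.decomp (y - A)] at h0
    simp only [map_add, map_smul, smul_eq_mul] at h0
    have h1 := mul_nonpos_of_nonneg_of_nonpos (h.b_nonneg hP hy) hB
    have h2 := mul_nonpos_of_nonneg_of_nonpos (h.c_nonneg hP hy) hC
    have h3 := mul_nonpos_of_nonpos_of_nonneg (h.d_nonpos hP hy) hz.le
    have h4 : d (y - A) * φ z = 0 := by linarith
    exact (mul_eq_zero.1 h4).resolve_right hz.ne'
  have hker : ∀ v, φ v = 0 → d v = 0 := by
    intro v hv
    obtain ⟨r, hr, h1, h2⟩ := exists_pos_ray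
      (hxφ.eventually_agree.and (h.isOpen.mem_nhds hx)) v
    have h3 := (h1 (by simp [hv])).mem
    have h4 := hzero _ ⟨h2, h3⟩ (by
      rw [add_sub_right_comm, map_add, hxA, map_smul, hv, smul_zero, add_zero])
    have h5 := hzero x ⟨hx, hxφ.mem⟩ hxA
    rw [add_sub_right_comm, map_add, h5, map_smul, zero_add, smul_eq_mul] at h4
    exact (mul_eq_zero.1 h4).resolve_left hr.ne'
  have hd : d = (φ z)⁻¹ • φ := by
    ext v
    have := hker (v - (φ v / φ z) • z) (by simp [hz.ne'])
    rw [map_sub, map_smul, h.d_z, smul_eq_mul, mul_one, sub_eq_zero] at this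
    rw [this, smul_apply, smul_eq_mul, div_eq_inv_mul]
  rw [hd, hsp_smul (inv_pos.2 hz)]
  exact hsp_eq_of_apply_eq (by rwa [map_sub, sub_eq_zero] at hxA)

/-- All small heights are admissible. The half-spaces with `A` in their interior contain
`A + t • z` for small `t`, those with `A` on their boundary by `apply_z_nonpos`. -/
theorem exists_isSmallHeight (h : IsTriangleCorner P U A B C z b c d σ) (hP : IsPolyhedron P) :
    ∃ ε : ℝ, 0 < ε ∧ ∀ t ∈ Ioc 0 ε, IsSmallHeight P U A z b c d σ t := by
  have hΔ : convexHull ℝ {A, B, C} ⊆ U := fun x hx => by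
    obtain ⟨β, γ, hβ, hγ, hβγ, rfl⟩ := mem_convexHull_triple_iff.1 hx
    have e : A + β • (B - A) + γ • (C - A) - A = β • (B - A) + γ • (C - A) := by abel
    refine (h.subset _ ?_ ?_ ?_ ?_).1 <;> rw [e] <;>
      simp only [map_add, map_smul, h.b_B, h.b_C, h.c_B, h.c_C, h.d_B, h.d_C, smul_eq_mul] <;>
      linarith
  have hcomp : IsCompact (convexHull ℝ ({A, B, C} : Set E3)) :=
    (Set.toFinite _).isCompact_convexHull ℝ
  obtain ⟨δ, hδ, hδU⟩ := hcomp.exists_cthickening_subset_open h.isOpen hΔ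
  have h1 : ∀ᶠ t : ℝ in 𝓝[>] 0, t ≤ δ :=
    nhdsWithin_le_nhds (eventually_le_nhds hδ)
  have h2 : ∀ᶠ t : ℝ in 𝓝[>] 0, t * σ < 1 := by
    have hc : Continuous fun t : ℝ => t * σ := by fun_prop
    exact nhdsWithin_le_nhds ((hc.tendsto 0).eventually (eventually_lt_nhds (by simp)))
  have h3 : ∀ᶠ t : ℝ in 𝓝[>] 0, ∀ H ∈ faceHalfspaces P U, H ≠ hsp d A → A + t • z ∈ H := by
    refine (eventually_all_finite (hP.finite_faceHalfspaces U)).2 fun H hH => ?_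
    by_cases hne : H = hsp d A
    · exact Eventually.of_forall fun t h => absurd hne h
    obtain ⟨x, hx, φ, hφ, hxφ, rfl⟩ := mem_faceHalfspaces_iff.1 hH
    rcases (hxφ.le_of_convex h.convex_inter hx h.mem_A).lt_or_eq with hlt | h0
    · have hc : Continuous fun y : E3 => φ (y - x) := by fun_prop
      filter_upwards [eventually_ray ((hc.tendsto A).eventually (eventually_lt_nhds hlt)) z]
        with t ht _
      exact le_of_lt ht
    · have hz := h.apply_z_nonpos hP hx hxφ (by rw [← neg_sub, map_neg, h0, neg_zero]) hne
      filter_upwards [self_mem_nhdsWithin] with t ht _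
      have ht : 0 < t := ht
      rw [mem_hsp, add_sub_right_comm, map_add, h0, zero_add, map_smul, smul_eq_mul]
      exact mul_nonpos_of_nonneg_of_nonpos ht.le hz
  obtain ⟨ε, hε, hall⟩ := mem_nhdsGT_iff_exists_Ioc_subset.1 ((h1.and h2).and h3)
  refine ⟨ε, hε, fun t ht => ?_⟩
  obtain ⟨⟨h4, h5⟩, h6⟩ := hall ht
  have ht0 : 0 < t := ht.1
  refine ⟨ht0, fun x hx => hδU ?_, ?_, h6⟩
  · obtain ⟨hb, hc, hd, hg⟩ := hx
    have hdt : d (x - A) ≤ t := by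
      have : t⁻¹ * d (x - A) ≤ 1 := by linarith
      rwa [inv_mul_le_iff₀ ht0, mul_one] at this
    have hmem : A + b (x - A) • (B - A) + c (x - A) • (C - A) ∈ convexHull ℝ {A, B, C} :=
      mem_convexHull_triple_iff.2 ⟨_, _, hb, hc, by
        have := mul_nonneg (inv_nonneg.2 ht0.le) hd
        linarith, rfl⟩
    refine Metric.mem_cthickening_of_dist_le x _ _ _ hmem ?_
    have : x - (A + b (x - A) • (B - A) + c (x - A) • (C - A)) = d (x - A) • z := by
      have h7 := h.decomp (x - A)
      rw [← sub_sub, ← sub_sub, sub_sub, sub_eq_iff_eq_add, add_comm (d (x - A) • z)]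
      exact h7
    rw [dist_eq_norm, this, norm_smul, h.norm_z, mul_one, Real.norm_eq_abs, abs_of_nonneg hd]
    linarith
  · rw [← one_div, lt_div_iff₀ ht0]
    linarith

end IsTriangleCorner

/-! ### The enlarged polyhedron near the tetrahedron -/

/-- A point on the boundary planes of two different supporting half-spaces is not flat. -/
theorem notMem_flatPoints_of_two_hsp {Q U : Set E3} (hU : IsOpen U) {x : E3} (hx : x ∈ U)
    {φ ψ : StrongDual ℝ E3} (hφ0 : φ ≠ 0) (hψ0 : ψ ≠ 0) (hφ : ∀ y ∈ U ∩ Q, φ (y - x) ≤ 0)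
    (hψ : ∀ y ∈ U ∩ Q, ψ (y - x) ≤ 0) (hne : hsp φ x ≠ hsp ψ x) : x ∉ flatPoints Q := by
  intro hf
  obtain ⟨χ, hχ, h⟩ := mem_flatPoints_iff.1 hf
  apply hne
  rw [h.hsp_eq hφ0 (by filter_upwards [hU.mem_nhds hx] with y hy hyQ using hφ y ⟨hy, hyQ⟩),
    h.hsp_eq hψ0 (by filter_upwards [hU.mem_nhds hx] with y hy hyQ using hψ y ⟨hy, hyQ⟩)]

theorem eventually_apply_lt {φ : StrongDual ℝ E3} {a x : E3} {r : ℝ} (h : φ (x - a) < r) :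
    ∀ᶠ y in 𝓝 x, φ (y - a) < r := by
  have hc : Continuous fun y : E3 => φ (y - a) := by fun_prop
  exact (hc.tendsto x).eventually (eventually_lt_nhds h)

theorem eventually_lt_apply {φ : StrongDual ℝ E3} {a x : E3} {r : ℝ} (h : r < φ (x - a)) :
    ∀ᶠ y in 𝓝 x, r < φ (y - a) := by
  have hc : Continuous fun y : E3 => φ (y - a) := by fun_prop
  exact (hc.tendsto x).eventually (eventually_gt_nhds h)

namespace IsTriangleCorner

variable {P U : Set E3} {A B C z : E3} {b c d : StrongDual ℝ E3} {σ t : ℝ}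

theorem mem_hsp_top (h : IsTriangleCorner P U A B C z b c d σ) {x : E3} :
    x ∈ hsp (b + c + t⁻¹ • d) B ↔ b (x - A) + c (x - A) + t⁻¹ * d (x - A) ≤ 1 := by
  rw [mem_hsp, h.far_apply]
  constructor <;> intro h' <;> linarith

theorem eq_add (h : IsTriangleCorner P U A B C z b c d σ) (x : E3) :
    x = A + b (x - A) • (B - A) + c (x - A) • (C - A) + d (x - A) • z := by
  rw [add_assoc, add_assoc, ← add_assoc (b (x - A) • (B - A)), ← h.decomp (x - A)]
  abel

theorem tetra_subset_of_mem (h : IsTriangleCorner P U A B C z b c d σ) (ht : 0 < t) {H : Set E3}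
    (hH : Convex ℝ H) (hA : A ∈ H) (hB : B ∈ H) (hC : C ∈ H) (htip : A + t • z ∈ H) :
    tetra A b c d t ⊆ H := by
  rintro x ⟨h1, h2, h3, h4⟩
  have hx : x = (1 - b (x - A) - c (x - A) - t⁻¹ * d (x - A)) • A + b (x - A) • B +
      c (x - A) • C + (t⁻¹ * d (x - A)) • (A + t • z) := by
    have e : (t⁻¹ * d (x - A)) • (t • z) = d (x - A) • z := by
      rw [smul_smul]; congr 1; field_simp
    rw [smul_add, e]
    nth_rewrite 1 [h.eq_add x]
    module
  have h3' : 0 ≤ t⁻¹ * d (x - A) := mul_nonneg (inv_nonneg.2 ht.le) h3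
  rw [hx]
  have := hH.sum_mem (t := Finset.univ)
    (w := ![1 - b (x - A) - c (x - A) - t⁻¹ * d (x - A), b (x - A), c (x - A), t⁻¹ * d (x - A)])
    (z := ![A, B, C, A + t • z]) (by
      intro i _
      fin_cases i
      exacts [by change 0 ≤ 1 - b (x - A) - c (x - A) - t⁻¹ * d (x - A); linarith, h1, h2, h3'])
    (by simp [Fin.sum_univ_four]; ring) (by
      intro i _
      fin_cases i
      exacts [hA, hB, hC, htip])
  simpa [Fin.sum_univ_four] using this

/-- Inside `U`, attaching the tetrahedron replaces the half-space of the triangle by the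
half-space of the upper face `B C (A + t • z)` of the tetrahedron. -/
theorem inter_union_eq (h : IsTriangleCorner P U A B C z b c d σ) (hP : IsPolyhedron P)
    (hs : IsSmallHeight P U A z b c d σ t) :
    U ∩ (P ∪ tetra A b c d t) =
      U ∩ (hsp (b + c + t⁻¹ • d) B ∩ ⋂₀ (faceHalfspaces P U \ {hsp d A})) := by
  have hin : ∀ H ∈ faceHalfspaces P U, U ∩ P ⊆ H := fun H hH x hx => by
    rw [h.inter_eq hP] at hx
    exact hx.2 H hH
  ext x
  constructor
  · rintro ⟨hxU, hxP | hxT⟩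
    · refine ⟨hxU, h.mem_hsp_top.2 ?_, fun H hH => hin H hH.1 ⟨hxU, hxP⟩⟩
      have h1 := h.far_le hP ⟨hxU, hxP⟩
      have h2 := h.d_nonpos hP ⟨hxU, hxP⟩
      nlinarith [hs.lt_inv]
    · refine ⟨hxU, h.mem_hsp_top.2 hxT.2.2.2, fun H hH => ?_⟩
      have hHc : Convex ℝ H := by
        obtain ⟨y, -, φ, -, -, rfl⟩ := mem_faceHalfspaces_iff.1 hH.1
        exact convex_hsp φ y
      exact h.tetra_subset_of_mem hs.pos hHc (hin H hH.1 h.mem_A) (hin H hH.1 h.mem_B)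
        (hin H hH.1 h.mem_C) (hs.tip_mem H hH.1 hH.2) hxT
  · rintro ⟨hxU, hg, hH⟩
    refine ⟨hxU, ?_⟩
    rcases le_or_gt (d (x - A)) 0 with hd | hd
    · left
      have : x ∈ U ∩ ⋂₀ faceHalfspaces P U := by
        refine ⟨hxU, fun H hH' => ?_⟩
        by_cases he : H = hsp d A
        · rw [he]; exact hd
        · exact hH H ⟨hH', he⟩
      rw [← h.inter_eq hP] at this
      exact this.2
    · right
      have h1 := hH _ ⟨h.mem_b, h.hsp_b_ne⟩
      have h2 := hH _ ⟨h.mem_c, h.swap.hsp_b_ne⟩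
      rw [mem_hsp, neg_apply] at h1 h2
      exact ⟨by linarith, by linarith, hd.le, h.mem_hsp_top.1 hg⟩

theorem mem_of_mem_faceHalfspaces (h : IsTriangleCorner P U A B C z b c d σ) (hP : IsPolyhedron P)
    (hs : IsSmallHeight P U A z b c d σ t) {H : Set E3} (hH : H ∈ faceHalfspaces P U)
    (hne : H ≠ hsp d A) {x : E3} (hx : x ∈ U ∩ (P ∪ tetra A b c d t)) : x ∈ H := by
  rw [h.inter_union_eq hP hs] at hx
  exact hx.2.2 H ⟨hH, hne⟩

theorem top_le (h : IsTriangleCorner P U A B C z b c d σ) (hP : IsPolyhedron P)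
    (hs : IsSmallHeight P U A z b c d σ t) {x : E3} (hx : x ∈ U ∩ (P ∪ tetra A b c d t)) :
    b (x - A) + c (x - A) + t⁻¹ * d (x - A) ≤ 1 := by
  rw [h.inter_union_eq hP hs] at hx
  exact h.mem_hsp_top.1 hx.2.1

theorem b_nonneg_union (h : IsTriangleCorner P U A B C z b c d σ) (hP : IsPolyhedron P)
    {x : E3} (hx : x ∈ U ∩ (P ∪ tetra A b c d t)) :
    0 ≤ b (x - A) := by
  rcases hx.2 with hx' | hx'
  exacts [h.b_nonneg hP ⟨hx.1, hx'⟩, hx'.1]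

theorem mem_of_d_zero (h : IsTriangleCorner P U A B C z b c d σ) {x : E3}
    (hx : x ∈ tetra A b c d t) (hd : d (x - A) = 0) : x ∈ U ∩ P :=
  h.subset x hd hx.1 hx.2.1 (by have := hx.2.2.2; rw [hd] at this; linarith)

theorem d_eq_zero_of_mem (h : IsTriangleCorner P U A B C z b c d σ) (hP : IsPolyhedron P)
    (hs : IsSmallHeight P U A z b c d σ t) {x : E3}
    (hx : x ∈ tetra A b c d t) (hxP : x ∈ P) : d (x - A) = 0 :=
  le_antisymm (h.d_nonpos hP ⟨hs.tetra_subset hx, hxP⟩) hx.2.2.1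

theorem eventually_union_iff_left {x : E3} (hx : x ∉ tetra A b c d t) :
    ∀ᶠ y in 𝓝 x, (y ∈ P ∪ tetra A b c d t ↔ y ∈ P) := by
  filter_upwards [(isClosed_tetra A b c d t).isOpen_compl.mem_nhds hx] with y hy
  exact ⟨fun h => h.resolve_right hy, Or.inl⟩

theorem eventually_union_iff_right (h : IsTriangleCorner P U A B C z b c d σ)
    (hP : IsPolyhedron P) {x : E3} (hxU : x ∈ U) (hd : 0 < d (x - A)) :
    ∀ᶠ y in 𝓝 x, (y ∈ P ∪ tetra A b c d t ↔ y ∈ tetra A b c d t) := by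
  filter_upwards [h.isOpen.mem_nhds hxU, eventually_lt_apply hd] with y hyU hyd
  exact ⟨fun h' => h'.resolve_left fun hyP => not_lt.2 (h.d_nonpos hP ⟨hyU, hyP⟩) hyd, Or.inr⟩

/-- A flat point of the face adjacent to the side `A B`, strictly below the plane of the
triangle. -/
theorem exists_agree_c (h : IsTriangleCorner P U A B C z b c d σ) (hP : IsPolyhedron P) :
    ∃ y ∈ U, c (y - A) = 0 ∧ d (y - A) < 0 ∧ AgreeNear P (hsp (-c) y) y := by
  obtain ⟨x, hx, φ, hφ, hagr, he⟩ := mem_faceHalfspaces_iff.1 h.mem_c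
  rw [← he] at hagr
  have h0 : (-c) (x - A) = 0 := frontier_hsp_subset
    ((mem_frontier_iff_of_eventually hagr).1 (by rw [he] at hagr; exact hagr.mem_frontier hφ))
  have h1 : hsp (-c) A = hsp (-c) x := hsp_eq_of_apply_eq (by
    rw [map_sub, sub_eq_zero] at h0; exact h0.symm)
  rw [h1] at hagr
  obtain ⟨r, hr, h2, h3⟩ := exists_pos_ray (hagr.eventually_agree.and (h.isOpen.mem_nhds hx)) (-z)
  have e : x + r • -z - A = (x - A) + r • (-z) := by abel
  refine ⟨x + r • -z, h3, ?_, ?_, h2 (by simp [h.c_z])⟩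
  · have : c (x - A) = 0 := by rwa [neg_apply, neg_eq_zero] at h0
    rw [e, map_add, this]
    simp [h.c_z]
  · have := h.d_nonpos hP ⟨hx, hagr.mem⟩
    rw [e, map_add, map_smul, map_neg, h.d_z, smul_eq_mul]
    linarith

/-- Only the two faces adjacent to the side `A B` have planes that contain a relatively interior
point of this side. -/
theorem hsp_eq_of_mem_side (h : IsTriangleCorner P U A B C z b c d σ) (hP : IsPolyhedron P)
    {x y : E3} (hd : d (x - A) = 0) (hc : c (x - A) = 0) (hb : 0 < b (x - A))
    (hb1 : b (x - A) < 1) {φ : StrongDual ℝ E3} (hφ : φ ≠ 0) (hyU : y ∈ U)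
    (hagr : AgreeNear P (hsp φ y) y) (hne : hsp φ y ≠ hsp d A) (hxy : φ (x - y) = 0) :
    hsp φ y = hsp (-c) A := by
  have hle : ∀ u ∈ U ∩ P, φ (u - y) ≤ 0 := fun u hu => hagr.le_of_convex h.convex_inter hyU hu
  have hx : x - A = b (x - A) • (B - A) := by
    have := h.decomp (x - A)
    rwa [hd, hc, zero_smul, zero_smul, add_zero, add_zero] at this
  have hA := hle A h.mem_A
  have hB := hle B h.mem_B
  have hAB : φ (x - y) = (1 - b (x - A)) * φ (A - y) + b (x - A) * φ (B - y) := by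
    have : x - y = (A - y) + b (x - A) • (B - A) := by rw [← hx]; abel
    rw [this, map_add, map_smul, ← sub_sub_sub_cancel_right B A y,
      map_sub φ (B - y) (A - y), smul_eq_mul]
    ring
  have hA0 : φ (A - y) = 0 := by nlinarith
  have hB0 : φ (B - y) = 0 := by nlinarith
  have hBA : φ (B - A) = 0 := by
    rw [← sub_sub_sub_cancel_right B A y, map_sub, hA0, hB0, sub_zero]
  have hz : φ z = 0 := by
    apply le_antisymm
    · exact h.apply_z_nonpos hP hyU hagr (by rw [← neg_sub, map_neg, hA0, neg_zero]) hne
    · obtain ⟨y₁, hy₁U, hy₁c, hy₁d, hy₁⟩ := h.exists_agree_c hP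
      have h1 := hle y₁ ⟨hy₁U, hy₁.mem⟩
      rw [← sub_add_sub_cancel y₁ A y, map_add, hA0, add_zero, h.decomp (y₁ - A)] at h1
      simp only [map_add, map_smul, hBA, hy₁c, smul_eq_mul, mul_zero, zero_mul, zero_add] at h1
      exact nonneg_of_mul_nonpos_right h1 hy₁d
  have hφc : φ = φ (C - A) • c := by
    ext v
    conv_lhs => rw [h.decomp v]
    simp [hBA, hz, mul_comm]
  have hCA : φ (C - A) < 0 := by
    have h1 := hle C h.mem_C
    rw [← sub_add_sub_cancel C A y, map_add, hA0, add_zero] at h1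
    refine lt_of_le_of_ne h1 fun h2 => hφ ?_
    rw [hφc, h2, zero_smul]
  have e1 : hsp φ y = hsp φ A :=
    hsp_eq_of_apply_eq (by rw [map_sub, sub_eq_zero] at hA0; exact hA0.symm)
  have e2 : φ = (-φ (C - A)) • (-c) := by rw [neg_smul_neg]; exact hφc
  rw [e1, e2, hsp_smul (by linarith)]

/-- The lateral face `A B (A + t • z)` of the tetrahedron prolongs the face of `P` adjacent to
the side `A B`. -/
theorem agree_side (h : IsTriangleCorner P U A B C z b c d σ) (hP : IsPolyhedron P)
    (hs : IsSmallHeight P U A z b c d σ t) {x : E3} (hb : 0 < b (x - A)) (hc : c (x - A) = 0)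
    (hd : 0 ≤ d (x - A)) (hg : b (x - A) + c (x - A) + t⁻¹ * d (x - A) < 1) :
    AgreeNear (P ∪ tetra A b c d t) (hsp (-c) x) x := by
  have hxT : x ∈ tetra A b c d t := ⟨hb.le, hc.ge, hd, hg.le⟩
  have hxU := hs.tetra_subset hxT
  have hg' : ∀ᶠ y in 𝓝 x, b (y - A) + c (y - A) + t⁻¹ * d (y - A) < 1 := by
    have hcont : Continuous fun y : E3 => b (y - A) + c (y - A) + t⁻¹ * d (y - A) := by fun_prop
    exact (hcont.tendsto x).eventually (eventually_lt_nhds hg)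
  have hcx : hsp (-c) x = hsp (-c) A := hsp_eq_of_apply_eq (by
    have : c x = c A := by rwa [map_sub, sub_eq_zero] at hc
    simp [this])
  rw [hcx]
  rcases hd.eq_or_lt with hd0 | hd0
  · have hb1 : b (x - A) < 1 := by rw [hc, ← hd0] at hg; linarith
    have hall : ∀ᶠ y in 𝓝 x, ∀ H ∈ faceHalfspaces P U, H ≠ hsp d A → H ≠ hsp (-c) A → y ∈ H := by
      refine (eventually_all_finite (hP.finite_faceHalfspaces U)).2 fun H hH => ?_
      by_cases h1 : H = hsp d A
      · exact Eventually.of_forall fun _ h' => absurd h1 h'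
      by_cases h2 : H = hsp (-c) A
      · exact Eventually.of_forall fun _ _ h' => absurd h2 h'
      obtain ⟨y, hyU, φ, hφ, hagr, rfl⟩ := mem_faceHalfspaces_iff.1 hH
      have hxP := h.mem_of_d_zero hxT hd0.symm
      rcases (hagr.le_of_convex h.convex_inter hyU hxP).lt_or_eq with hlt | h0
      · filter_upwards [eventually_apply_lt hlt] with u hu _ _
        exact hu.le
      · exact absurd (h.hsp_eq_of_mem_side hP hd0.symm hc hb hb1 hφ hyU hagr h1 h0) h2
    filter_upwards [hall, h.isOpen.mem_nhds hxU, hg'] with y hy hyU hyg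
    constructor
    · intro hyQ
      exact h.mem_of_mem_faceHalfspaces hP hs h.mem_c h.swap.hsp_b_ne ⟨hyU, hyQ⟩
    · intro hyc
      have : y ∈ U ∩ (P ∪ tetra A b c d t) := by
        rw [h.inter_union_eq hP hs]
        refine ⟨hyU, h.mem_hsp_top.2 hyg.le, fun H hH => ?_⟩
        by_cases h2 : H = hsp (-c) A
        · rwa [h2]
        · exact hy H hH.1 hH.2 h2
      exact this.2
  · filter_upwards [h.eventually_union_iff_right hP (t := t) hxU hd0, hg', eventually_lt_apply hb,
      eventually_lt_apply hd0] with y hy hyg hyb hyd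
    rw [hy, mem_hsp, neg_apply]
    exact ⟨fun h' => by linarith [h'.2.1], fun h' => ⟨hyb.le, by linarith, hyd.le, hyg.le⟩⟩

theorem top_ne_zero (h : IsTriangleCorner P U A B C z b c d σ) (s : ℝ) : b + c + s • d ≠ 0 := by
  intro h0
  have h1 := h.far_apply s A
  rw [h0] at h1
  simp at h1

theorem agree_top (h : IsTriangleCorner P U A B C z b c d σ) (hP : IsPolyhedron P)
    (hs : IsSmallHeight P U A z b c d σ t) {x : E3} (hb : 0 < b (x - A)) (hc : 0 < c (x - A))
    (hd : 0 < d (x - A)) (hg : b (x - A) + c (x - A) + t⁻¹ * d (x - A) = 1) :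
    AgreeNear (P ∪ tetra A b c d t) (hsp (b + c + t⁻¹ • d) x) x := by
  have hxT : x ∈ tetra A b c d t := ⟨hb.le, hc.le, hd.le, hg.le⟩
  have hx : hsp (b + c + t⁻¹ • d) x = hsp (b + c + t⁻¹ • d) B := hsp_eq_of_apply_eq (by
    rw [← sub_eq_zero, ← map_sub, h.far_apply, hg, sub_self])
  rw [hx]
  filter_upwards [h.eventually_union_iff_right hP (t := t) (hs.tetra_subset hxT) hd,
    eventually_lt_apply hb, eventually_lt_apply hc, eventually_lt_apply hd] with y hy h1 h2 h3
  rw [hy, h.mem_hsp_top]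
  exact ⟨fun h' => h'.2.2.2, fun h' => ⟨h1.le, h2.le, h3.le, h'⟩⟩

/-- The interior of the tetrahedron, together with the relative interior of its base, is interior to
the enlarged polyhedron. -/
theorem mem_interior_union (h : IsTriangleCorner P U A B C z b c d σ) (hP : IsPolyhedron P)
    {x : E3} (hb : 0 < b (x - A)) (hc : 0 < c (x - A)) (hd : 0 ≤ d (x - A))
    (hg : b (x - A) + c (x - A) + t⁻¹ * d (x - A) < 1) :
    x ∈ interior (P ∪ tetra A b c d t) := by
  rw [mem_interior_iff_mem_nhds]
  have hg' : ∀ᶠ y in 𝓝 x, b (y - A) + c (y - A) + t⁻¹ * d (y - A) < 1 := by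
    have hcont : Continuous fun y : E3 => b (y - A) + c (y - A) + t⁻¹ * d (y - A) := by fun_prop
    exact (hcont.tendsto x).eventually (eventually_lt_nhds hg)
  have hT : ∀ᶠ y in 𝓝 x, 0 ≤ d (y - A) → y ∈ tetra A b c d t := by
    filter_upwards [hg', eventually_lt_apply hb, eventually_lt_apply hc] with y h1 h2 h3 h4
    exact ⟨h2.le, h3.le, h4, h1.le⟩
  rcases hd.eq_or_lt with hd0 | hd0
  · obtain ⟨x₀, hx₀, hface⟩ := h.face
    have hx : x ∈ connectedComponentIn (flatPoints P) x₀ := by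
      rw [hface]
      refine ⟨hd0.symm, hb, hc, ?_⟩
      rw [← hd0] at hg
      linarith
    obtain ⟨φ, hφ, hagr⟩ := mem_flatPoints_iff.1 (connectedComponentIn_subset _ _ hx)
    have hxU := (h.mem_of_d_zero (t := t) ⟨hb.le, hc.le, hd, hg.le⟩ hd0.symm)
    have he : hsp d x = hsp φ x := hagr.hsp_eq h.d_ne_zero (by
      filter_upwards [h.isOpen.mem_nhds hxU.1] with y hyU hyP
      have := h.d_nonpos hP ⟨hyU, hyP⟩
      rwa [← sub_sub_sub_cancel_right y x A, map_sub, ← hd0, sub_zero])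
    rw [← he] at hagr
    filter_upwards [hT, hagr] with y h1 h2
    rcases le_total 0 (d (y - A)) with h3 | h3
    · exact Or.inr (h1 h3)
    · refine Or.inl (h2.2 ?_)
      rwa [mem_hsp, ← sub_sub_sub_cancel_right y x A, map_sub, ← hd0, sub_zero]
  · filter_upwards [hT, eventually_lt_apply hd0] with y h1 h2
    exact Or.inr (h1 h2.le)

end IsTriangleCorner

/-! ### Edges and volume of the enlarged polyhedron -/

/-- The lateral face of the tetrahedron `tetra A b c d t` in the plane `c = 0`. Of its sides only
the relative interior of the one in the base `d = 0` is included. -/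
def lateral (A : E3) (b c d : StrongDual ℝ E3) (t : ℝ) : Set E3 :=
  {x | c (x - A) = 0 ∧ 0 < b (x - A) ∧ 0 ≤ d (x - A) ∧
    b (x - A) + c (x - A) + t⁻¹ * d (x - A) < 1}

/-- The relative interior of the upper face of the tetrahedron `tetra A b c d t`. -/
def upperFace (A : E3) (b c d : StrongDual ℝ E3) (t : ℝ) : Set E3 :=
  {x | 0 < b (x - A) ∧ 0 < c (x - A) ∧ 0 < d (x - A) ∧
    b (x - A) + c (x - A) + t⁻¹ * d (x - A) = 1}

theorem lateral_subset_tetra {A : E3} {b c d : StrongDual ℝ E3} {t : ℝ} :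
    lateral A b c d t ⊆ tetra A b c d t := fun _ hx => ⟨hx.2.1.le, hx.1.ge, hx.2.2.1, hx.2.2.2.le⟩

theorem upper_subset_tetra {A : E3} {b c d : StrongDual ℝ E3} {t : ℝ} :
    upperFace A b c d t ⊆ tetra A b c d t := fun _ hx =>
  ⟨hx.1.le, hx.2.1.le, hx.2.2.1.le, hx.2.2.2.le⟩

theorem mem_flatPoints_congr {P Q : Set E3} {x : E3} (h : ∀ᶠ y in 𝓝 x, (y ∈ P ↔ y ∈ Q)) :
    x ∈ flatPoints P ↔ x ∈ flatPoints Q := by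
  simp only [mem_flatPoints_iff]
  refine exists_congr fun φ => and_congr_right fun _ => ⟨fun h' => ?_, fun h' => ?_⟩
  · filter_upwards [h, h'] with y h1 h2 using h1.symm.trans h2
  · filter_upwards [h, h'] with y h1 h2 using h1.trans h2

theorem apply_smul_add_smul_sub (φ : StrongDual ℝ E3) (A x y : E3) {r s : ℝ} (h : r + s = 1) :
    φ (r • x + s • y - A) = r * φ (x - A) + s * φ (y - A) := by
  have : r • x + s • y - A = r • (x - A) + s • (y - A) := by
    have hA : A = (r + s) • A := by rw [h, one_smul]
    nth_rewrite 1 [hA]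
    module
  rw [this, map_add, map_smul, map_smul, smul_eq_mul, smul_eq_mul]

/-- A finite union of finite intersections of half-spaces remains one when another finite
intersection of half-spaces is added. -/
theorem exists_polyhedral_insert {S : Set (Set E3)} {T : Set E3} {W : Set (Set E3)}
    (hS : S.Finite) (hST : ∀ K ∈ S, ∃ T : Set (Set E3), T.Finite ∧ (∀ H ∈ T, IsHalfspace H) ∧
      K = ⋂₀ T) (hW : W.Finite) (hWH : ∀ H ∈ W, IsHalfspace H) (hT : T = ⋂₀ W) :
    ∃ S' : Set (Set E3), S'.Finite ∧ (∀ K ∈ S', ∃ T : Set (Set E3), T.Finite ∧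
      (∀ H ∈ T, IsHalfspace H) ∧ K = ⋂₀ T) ∧ ⋃₀ S ∪ T = ⋃₀ S' := by
  refine ⟨insert T S, hS.insert T, ?_, by rw [sUnion_insert, union_comm]⟩
  rintro K (rfl | hK)
  · exact ⟨W, hW, hWH, hT⟩
  · exact hST K hK

theorem hausdorffMeasure_segment_union {A B C : E3} (h : segment ℝ A B ∩ segment ℝ A C ⊆ {A}) :
    Measure.hausdorffMeasure 1 (segment ℝ A B ∪ segment ℝ A C) = edist A B + edist A C := by
  have hm : MeasurableSet (segment ℝ A C) := by
    rw [segment_eq_image_lineMap]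
    exact (isCompact_Icc.image (by fun_prop)).isClosed.measurableSet
  have := Measure.nullSingletonClass_hausdorff (X := E3) (d := 1) one_pos
  have h0 : Measure.hausdorffMeasure 1 (segment ℝ A B ∩ segment ℝ A C) = 0 :=
    measure_mono_null h (measure_singleton _)
  have h1 := measure_union_add_inter (μ := Measure.hausdorffMeasure 1) (segment ℝ A B) hm
  rw [h0, add_zero, hausdorffMeasure_segment, hausdorffMeasure_segment] at h1
  exact h1

namespace IsTriangleCorner

variable {P U : Set E3} {A B C z : E3} {b c d : StrongDual ℝ E3} {σ t : ℝ}

/-- The points of the tetrahedron are interior points of the enlarged polyhedron, or belong to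
one of the three new pieces of faces, or lie on one of the edges. -/
theorem tetra_cases (h : IsTriangleCorner P U A B C z b c d σ) (hP : IsPolyhedron P)
    {x : E3} (hx : x ∈ tetra A b c d t) :
    x ∈ interior (P ∪ tetra A b c d t) ∨ x ∈ lateral A b c d t ∨ x ∈ lateral A c b d t ∨
      x ∈ upperFace A b c d t ∨ (b (x - A) = 0 ∧ c (x - A) = 0) ∨
      (c (x - A) = 0 ∧ b (x - A) + c (x - A) + t⁻¹ * d (x - A) = 1) ∨
      (b (x - A) = 0 ∧ b (x - A) + c (x - A) + t⁻¹ * d (x - A) = 1) ∨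
      (d (x - A) = 0 ∧ b (x - A) + c (x - A) + t⁻¹ * d (x - A) = 1) := by
  obtain ⟨hb, hc, hd, hg⟩ := hx
  rcases hb.eq_or_lt with hb | hb <;> rcases hc.eq_or_lt with hc | hc <;>
    rcases hg.eq_or_lt with hg | hg
  · simp [← hb, ← hc]
  · simp [← hb, ← hc]
  · exact .inr <| .inr <| .inr <| .inr <| .inr <| .inr <| .inl ⟨hb.symm, hg⟩
  · exact .inr <| .inr <| .inl ⟨hb.symm, hc, hd, by linarith⟩
  · exact .inr <| .inr <| .inr <| .inr <| .inr <| .inl ⟨hc.symm, hg⟩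
  · exact .inr <| .inl ⟨hc.symm, hb, hd, hg⟩
  · rcases hd.eq_or_lt with hd | hd
    · exact .inr <| .inr <| .inr <| .inr <| .inr <| .inr <| .inr ⟨hd.symm, hg⟩
    · exact .inr <| .inr <| .inr <| .inl ⟨hb, hc, hd, hg⟩
  · exact .inl (h.mem_interior_union hP hb hc hd hg)

theorem lateral_subset_flatPoints (h : IsTriangleCorner P U A B C z b c d σ) (hP : IsPolyhedron P)
    (hs : IsSmallHeight P U A z b c d σ t) :
    lateral A b c d t ⊆ flatPoints (P ∪ tetra A b c d t) := fun _ hx =>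
  mem_flatPoints_iff.2 ⟨_, h.c_ne_zero, h.agree_side hP hs hx.2.1 hx.1 hx.2.2.1 hx.2.2.2⟩

theorem _root_.IsSmallHeight.swap (hs : IsSmallHeight P U A z b c d σ t) :
    IsSmallHeight P U A z c b d σ t :=
  ⟨hs.pos, by rw [tetra_swap]; exact hs.tetra_subset, hs.lt_inv, hs.tip_mem⟩

theorem lateral_subset_flatPoints' (h : IsTriangleCorner P U A B C z b c d σ)
    (hP : IsPolyhedron P) (hs : IsSmallHeight P U A z b c d σ t) :
    lateral A c b d t ⊆ flatPoints (P ∪ tetra A b c d t) := by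
  rw [← tetra_swap]
  exact h.swap.lateral_subset_flatPoints hP hs.swap

theorem upper_subset_flatPoints (h : IsTriangleCorner P U A B C z b c d σ) (hP : IsPolyhedron P)
    (hs : IsSmallHeight P U A z b c d σ t) :
    upperFace A b c d t ⊆ flatPoints (P ∪ tetra A b c d t) := fun _ hx =>
  mem_flatPoints_iff.2 ⟨_, h.top_ne_zero _, h.agree_top hP hs hx.1 hx.2.1 hx.2.2.1 hx.2.2.2⟩

theorem tip_sub (A z : E3) (t : ℝ) : A + t • z - A = t • z := by abel

theorem mem_segment_tip (h : IsTriangleCorner P U A B C z b c d σ) (ht : 0 < t) {x : E3}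
    (hx : x ∈ tetra A b c d t) (hb : b (x - A) = 0) (hc : c (x - A) = 0) :
    x ∈ segment ℝ A (A + t • z) := by
  obtain ⟨-, -, hd, hg⟩ := hx
  rw [segment_eq_image']
  refine ⟨t⁻¹ * d (x - A), ⟨mul_nonneg (inv_nonneg.2 ht.le) hd, by linarith⟩, ?_⟩
  simp only
  conv_rhs => rw [h.eq_add x]
  rw [hb, hc, tip_sub, smul_smul, mul_right_comm, inv_mul_cancel₀ ht.ne', one_mul, zero_smul,
    zero_smul, add_zero, add_zero]

theorem mem_segment_side (h : IsTriangleCorner P U A B C z b c d σ) (ht : 0 < t) {x : E3}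
    (hx : x ∈ tetra A b c d t) (hc : c (x - A) = 0)
    (hg : b (x - A) + c (x - A) + t⁻¹ * d (x - A) = 1) :
    x ∈ segment ℝ B (A + t • z) := by
  obtain ⟨hb, -, hd, -⟩ := hx
  rw [segment_eq_image']
  rw [hc, add_zero] at hg
  refine ⟨t⁻¹ * d (x - A), ⟨mul_nonneg (inv_nonneg.2 ht.le) hd, by linarith⟩, ?_⟩
  simp only
  conv_rhs => rw [h.eq_add x]
  have e : d (x - A) • z = (t⁻¹ * d (x - A)) • (t • z) := by
    rw [smul_smul, mul_right_comm, inv_mul_cancel₀ ht.ne', one_mul]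
  have e2 : b (x - A) = 1 - t⁻¹ * d (x - A) := by linarith
  rw [hc, e, e2]
  module

theorem mem_frontier_of_d_zero (h : IsTriangleCorner P U A B C z b c d σ) (hP : IsPolyhedron P)
    {x : E3} (hx : x ∈ U ∩ P) (hd : d (x - A) = 0) : x ∈ frontier P := by
  refine ⟨subset_closure hx.2, fun hint => ?_⟩
  have hev : ∀ᶠ y in 𝓝 x, y ∈ interior P := isOpen_interior.mem_nhds hint
  have hU : ∀ᶠ y in 𝓝 x, y ∈ U := h.isOpen.mem_nhds hx.1
  obtain ⟨r, hr, h1, h2⟩ := exists_pos_ray (hev.and hU) z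
  have h3 := h.d_nonpos hP ⟨h2, interior_subset h1⟩
  rw [add_sub_right_comm, map_add, hd, map_smul, h.d_z, smul_eq_mul] at h3
  linarith

theorem mem_segment_AB (h : IsTriangleCorner P U A B C z b c d σ) {x : E3}
    (hx : x ∈ segment ℝ A B) :
    0 ≤ b (x - A) ∧ b (x - A) ≤ 1 ∧ c (x - A) = 0 ∧ d (x - A) = 0 := by
  rw [segment_eq_image'] at hx
  obtain ⟨s, hs, rfl⟩ := hx
  simp only [add_sub_cancel_left, map_smul, h.b_B, h.c_B, h.d_B, smul_eq_mul, mul_one, mul_zero]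
  exact ⟨hs.1, hs.2, trivial, trivial⟩

theorem segment_AB_subset (h : IsTriangleCorner P U A B C z b c d σ) (hP : IsPolyhedron P) :
    segment ℝ A B ⊆ edgeSkeleton P := by
  intro x hx
  obtain ⟨h1, h2, h3, h4⟩ := h.mem_segment_AB hx
  refine ⟨h.mem_frontier_of_d_zero hP (h.subset x h4 h1 h3.ge (by linarith)) h4, fun hf => ?_⟩
  have := (h.notMem x h4 h1 h3.ge (by linarith) hf).2.1
  linarith

/-- The edges of the enlarged polyhedron: the sides `A B` and `A C` disappear, and three edges
with the end point `A + t • z` are new. -/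
theorem edgeSkeleton_union_subset (h : IsTriangleCorner P U A B C z b c d σ) (hP : IsPolyhedron P)
    (hs : IsSmallHeight P U A z b c d σ t) :
    edgeSkeleton (P ∪ tetra A b c d t) ⊆
      (edgeSkeleton P \ (segment ℝ A B ∪ segment ℝ A C)) ∪
        (segment ℝ A (A + t • z) ∪ (segment ℝ B (A + t • z) ∪ segment ℝ C (A + t • z))) := by
  intro x hx
  by_cases hxT : x ∈ tetra A b c d t
  · have hxT' : x ∈ tetra A c b d t := by rwa [tetra_swap]
    rcases h.tetra_cases hP hxT with h1 | h1 | h1 | h1 | h1 | h1 | h1 | h1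
    · exact absurd h1 hx.1.2
    · exact absurd (h.lateral_subset_flatPoints hP hs h1) hx.2
    · exact absurd (h.lateral_subset_flatPoints' hP hs h1) hx.2
    · exact absurd (h.upper_subset_flatPoints hP hs h1) hx.2
    · exact .inr <| .inl <| h.mem_segment_tip hs.pos hxT h1.1 h1.2
    · exact .inr <| .inr <| .inl <| h.mem_segment_side hs.pos hxT h1.1 h1.2
    · exact .inr <| .inr <| .inr <| h.swap.mem_segment_side hs.pos hxT' h1.1 (by linarith [h1.2])
    · by_cases hb : b (x - A) = 0
      · exact .inr <| .inr <| .inr <| h.swap.mem_segment_side hs.pos hxT' hb (by linarith [h1.2])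
      by_cases hc : c (x - A) = 0
      · exact .inr <| .inr <| .inl <| h.mem_segment_side hs.pos hxT hc h1.2
      have hg : b (x - A) + c (x - A) = 1 := by
        have := h1.2
        rw [h1.1] at this
        linarith
      refine .inl ⟨⟨h.mem_frontier_of_d_zero hP (h.mem_of_d_zero hxT h1.1) h1.1, fun hf => ?_⟩, ?_⟩
      · have := (h.notMem x h1.1 hxT.1 hxT.2.1 hg.le hf).2.2
        linarith
      · rintro (h2 | h2)
        · exact hc (h.mem_segment_AB h2).2.2.1
        · exact hb (h.swap.mem_segment_AB h2).2.2.1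
  · have hev := eventually_union_iff_left (P := P) hxT
    refine .inl ⟨⟨(mem_frontier_iff_of_eventually hev).1 hx.1,
      fun hf => hx.2 ((mem_flatPoints_congr hev).2 hf)⟩, ?_⟩
    rintro (h2 | h2)
    · obtain ⟨h3, h4, h5, h6⟩ := h.mem_segment_AB h2
      exact hxT ⟨h3, h5.ge, h6.ge, by rw [h5, h6]; linarith⟩
    · obtain ⟨h3, h4, h5, h6⟩ := h.swap.mem_segment_AB h2
      exact hxT ⟨h5.ge, h3, h6.ge, by rw [h5, h6]; linarith⟩

/-- The edges of the enlarged polyhedron have at most the total length that results from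
replacing the sides `A B` and `A C` by the three edges at `A + t • z`. -/
theorem edgeLength_union_le (h : IsTriangleCorner P U A B C z b c d σ) (hP : IsPolyhedron P)
    (hs : IsSmallHeight P U A z b c d σ t) :
    edgeLength (P ∪ tetra A b c d t) + (dist A B + dist A C) ≤
      edgeLength P + (dist A (A + t • z) + (dist B (A + t • z) + dist C (A + t • z))) := by
  have hinter : segment ℝ A B ∩ segment ℝ A C ⊆ {A} := by
    rintro x ⟨h1, h2⟩
    obtain ⟨-, -, h3, h4⟩ := h.mem_segment_AB h1
    obtain ⟨-, -, h5, -⟩ := h.swap.mem_segment_AB h2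
    rw [mem_singleton_iff, h.eq_add x, h3, h4, h5]
    simp
  have hsub : segment ℝ A B ∪ segment ℝ A C ⊆ edgeSkeleton P :=
    union_subset (h.segment_AB_subset hP) (h.swap.segment_AB_subset hP)
  have hm : MeasurableSet (segment ℝ A B ∪ segment ℝ A C) := by
    have : ∀ X Y : E3, MeasurableSet (segment ℝ X Y) := fun X Y => by
      rw [segment_eq_image_lineMap]
      exact (isCompact_Icc.image (by fun_prop)).isClosed.measurableSet
    exact (this _ _).union (this _ _)
  have hfin := hP.hausdorffMeasure_edgeSkeleton_ne_top
  have h1 : Measure.hausdorffMeasure 1 (edgeSkeleton (P ∪ tetra A b c d t)) +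
      (edist A B + edist A C) ≤ Measure.hausdorffMeasure 1 (edgeSkeleton P) +
        (edist A (A + t • z) + (edist B (A + t • z) + edist C (A + t • z))) := by
    calc _ ≤ (Measure.hausdorffMeasure 1 (edgeSkeleton P \ (segment ℝ A B ∪ segment ℝ A C)) +
          (edist A (A + t • z) + (edist B (A + t • z) + edist C (A + t • z)))) +
            Measure.hausdorffMeasure 1 (segment ℝ A B ∪ segment ℝ A C) := by
          rw [hausdorffMeasure_segment_union hinter]
          refine add_le_add ((measure_mono (h.edgeSkeleton_union_subset hP hs)).trans
            ((measure_union_le _ _).trans (add_le_add le_rfl ((measure_union_le _ _).trans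
              (add_le_add ?_ ((measure_union_le _ _).trans (add_le_add ?_ ?_))))))) le_rfl <;>
            rw [hausdorffMeasure_segment]
      _ = _ := by
          rw [add_right_comm, ← measure_sdiff_add_inter (edgeSkeleton P) hm,
            inter_eq_self_of_subset_right hsub]
  have hfin' : Measure.hausdorffMeasure 1 (edgeSkeleton P) +
        (edist A (A + t • z) + (edist B (A + t • z) + edist C (A + t • z))) ≠ ⊤ := by
    simp [hfin, edist_ne_top]
  have hfinQ : Measure.hausdorffMeasure 1 (edgeSkeleton (P ∪ tetra A b c d t)) ≠ ⊤ :=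
    ne_top_of_le_ne_top hfin' (le_self_add.trans h1)
  have h2 := ENNReal.toReal_mono hfin' h1
  rw [ENNReal.toReal_add hfinQ (by simp [edist_ne_top]), ENNReal.toReal_add hfin
    (by simp [edist_ne_top]), ENNReal.toReal_add (by simp [edist_ne_top])
    (by simp [edist_ne_top]), ENNReal.toReal_add (by simp [edist_ne_top])
    (by simp [edist_ne_top]), ENNReal.toReal_add (by simp [edist_ne_top])
    (by simp [edist_ne_top])] at h2
  simpa only [dist_edist, edgeLength] using h2

theorem convex_tetra (A : E3) (b c d : StrongDual ℝ E3) (t : ℝ) : Convex ℝ (tetra A b c d t) := by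
  intro x hx y hy r s hr hs hrs
  obtain ⟨h1, h2, h3, h4⟩ := hx
  obtain ⟨h1', h2', h3', h4'⟩ := hy
  refine ⟨?_, ?_, ?_, ?_⟩ <;> simp only [apply_smul_add_smul_sub _ _ _ _ hrs]
  · positivity
  · positivity
  · positivity
  · nlinarith

theorem isCompact_tetra (h : IsTriangleCorner P U A B C z b c d σ) (ht : 0 < t) :
    IsCompact (tetra A b c d t) := by
  have hsub := h.tetra_subset_of_mem ht (convex_convexHull ℝ ({A, B, C, A + t • z} : Set E3))
    (subset_convexHull ℝ _ (by simp)) (subset_convexHull ℝ _ (by simp))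
    (subset_convexHull ℝ _ (by simp)) (subset_convexHull ℝ _ (by simp))
  exact ((Set.toFinite _).isCompact_convexHull ℝ).of_isClosed_subset (isClosed_tetra A b c d t) hsub

theorem tetra_subset_closure_interior (h : IsTriangleCorner P U A B C z b c d σ) (ht : 0 < t) :
    (interior (tetra A b c d t)).Nonempty ∧
      tetra A b c d t ⊆ closure (interior (tetra A b c d t)) := by
  have hne : (interior (tetra A b c d t)).Nonempty := by
    have ho : IsOpen {x : E3 | 0 < b (x - A) ∧ 0 < c (x - A) ∧ 0 < d (x - A) ∧
        b (x - A) + c (x - A) + t⁻¹ * d (x - A) < 1} := by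
      have h1 : IsOpen {x : E3 | 0 < b (x - A)} := isOpen_lt continuous_const (by fun_prop)
      have h2 : IsOpen {x : E3 | 0 < c (x - A)} := isOpen_lt continuous_const (by fun_prop)
      have h3 : IsOpen {x : E3 | 0 < d (x - A)} := isOpen_lt continuous_const (by fun_prop)
      have h4 : IsOpen {x : E3 | b (x - A) + c (x - A) + t⁻¹ * d (x - A) < 1} :=
        isOpen_lt (by fun_prop) continuous_const
      exact h1.inter (h2.inter (h3.inter h4))
    have hsub : {x : E3 | 0 < b (x - A) ∧ 0 < c (x - A) ∧ 0 < d (x - A) ∧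
        b (x - A) + c (x - A) + t⁻¹ * d (x - A) < 1} ⊆ tetra A b c d t :=
      fun x hx => ⟨hx.1.le, hx.2.1.le, hx.2.2.1.le, hx.2.2.2.le⟩
    refine ⟨A + ((4 : ℝ)⁻¹ • (B - A) + (4 : ℝ)⁻¹ • (C - A) + (t / 4) • z),
      interior_maximal hsub ho ?_⟩
    simp only [mem_ofPred_eq, add_sub_cancel_left, map_add, map_smul, h.b_B, h.b_C, h.b_z, h.c_B,
      h.c_C, h.c_z, h.d_B, h.d_C, h.d_z, smul_eq_mul]
    refine ⟨by norm_num, by norm_num, by linarith, ?_⟩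
    field_simp
    linarith
  refine ⟨hne, ?_⟩
  rw [(convex_tetra A b c d t).closure_interior_eq_closure_of_nonempty_interior hne]
  exact subset_closure

theorem isPolyhedron_union (h : IsTriangleCorner P U A B C z b c d σ) (hP : IsPolyhedron P)
    (hs : IsSmallHeight P U A z b c d σ t) : IsPolyhedron (P ∪ tetra A b c d t) := by
  obtain ⟨hTne, hTcl⟩ := h.tetra_subset_closure_interior hs.pos
  have hcompact : IsCompact (P ∪ tetra A b c d t) := hP.isCompact.union (h.isCompact_tetra hs.pos)
  have hiP : interior P ⊆ interior (P ∪ tetra A b c d t) := interior_mono subset_union_left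
  have hiT : interior (tetra A b c d t) ⊆ interior (P ∪ tetra A b c d t) :=
    interior_mono subset_union_right
  refine ⟨hcompact, ?_, ?_, ?_⟩
  · refine Subset.antisymm (closure_minimal interior_subset hcompact.isClosed)
      (union_subset ?_ (hTcl.trans (closure_mono hiT)))
    rw [← hP.closure_interior]
    exact closure_mono (by rw [hP.closure_interior]; exact hiP)
  · -- the two interiors are joined by a ball around a point of the triangle
    set x₀ : E3 := A + ((4 : ℝ)⁻¹ • (B - A) + (4 : ℝ)⁻¹ • (C - A)) with hx₀
    have hb : b (x₀ - A) = 4⁻¹ := by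
      rw [hx₀, add_sub_cancel_left]; simp [h.b_B, h.b_C]
    have hc : c (x₀ - A) = 4⁻¹ := by
      rw [hx₀, add_sub_cancel_left]; simp [h.c_B, h.c_C]
    have hd : d (x₀ - A) = 0 := by
      rw [hx₀, add_sub_cancel_left]; simp [h.d_B, h.d_C]
    have hx₀T : x₀ ∈ tetra A b c d t :=
      ⟨by rw [hb]; norm_num, by rw [hc]; norm_num, hd.ge, by rw [hb, hc, hd]; norm_num⟩
    have hx₀i : x₀ ∈ interior (P ∪ tetra A b c d t) :=
      h.mem_interior_union hP (by rw [hb]; norm_num) (by rw [hc]; norm_num) hd.ge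
        (by rw [hb, hc, hd]; norm_num)
    obtain ⟨ε, hε, hball⟩ := Metric.isOpen_iff.1 isOpen_interior x₀ hx₀i
    have hx₀P : x₀ ∈ closure (interior P) := by
      rw [hP.closure_interior]; exact (h.mem_of_d_zero hx₀T hd).2
    obtain ⟨p, hp1, hp2⟩ := mem_closure_iff.1 hx₀P _ Metric.isOpen_ball (Metric.mem_ball_self hε)
    obtain ⟨q, hq1, hq2⟩ := mem_closure_iff.1 (hTcl hx₀T) _ Metric.isOpen_ball
      (Metric.mem_ball_self hε)
    have hconn : IsConnected (interior P ∪ Metric.ball x₀ ε ∪ interior (tetra A b c d t)) := by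
      refine IsConnected.union ⟨q, Or.inr hq1, hq2⟩ (IsConnected.union ⟨p, hp2, hp1⟩
        hP.isConnected_interior ⟨⟨x₀, Metric.mem_ball_self hε⟩, (convex_ball _ _).isPreconnected⟩)
        ⟨hTne, (convex_tetra A b c d t).interior.isPreconnected⟩
    refine hconn.subset_closure (union_subset (union_subset hiP hball) hiT) ?_
    refine interior_subset.trans (union_subset ?_ (hTcl.trans (closure_mono subset_union_right)))
    calc P = closure (interior P) := hP.closure_interior.symm
      _ ⊆ _ := closure_mono (subset_union_left.trans subset_union_left)
  · obtain ⟨S, hS, hST, hPS⟩ := hP.polyhedral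
    conv => enter [1, S, 2, 2]; rw [hPS]
    refine exists_polyhedral_insert hS hST
      (W := {hsp (-b) A, hsp (-c) A, hsp (-d) A, hsp (b + c + t⁻¹ • d) B}) (Set.toFinite _) ?_ ?_
    · rintro H (rfl | rfl | rfl | rfl)
      · exact isHalfspace_hsp h.b_ne_zero A
      · exact isHalfspace_hsp h.c_ne_zero A
      · exact isHalfspace_hsp (neg_ne_zero.2 h.d_ne_zero) A
      · exact isHalfspace_hsp (h.top_ne_zero _) B
    · ext x
      simp only [sInter_insert, sInter_singleton, mem_inter_iff, h.mem_hsp_top]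
      simp only [hsp, tetra, mem_ofPred_eq, neg_apply, neg_nonpos]

/-- Attaching the tetrahedron does not decrease the volume, so the Melzak ratio decreases as soon
as the three new edges are shorter than the two that disappear. -/
theorem melzakRatio_union_lt (h : IsTriangleCorner P U A B C z b c d σ) (hP : IsPolyhedron P)
    (hs : IsSmallHeight P U A z b c d σ t)
    (hlt : dist A (A + t • z) + (dist B (A + t • z) + dist C (A + t • z)) < dist A B + dist A C) :
    melzakRatio (P ∪ tetra A b c d t) < melzakRatio P := by
  have h1 := h.edgeLength_union_le hP hs
  have h2 : 0 ≤ edgeLength (P ∪ tetra A b c d t) := ENNReal.toReal_nonneg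
  have hfinP : volume P ≠ ⊤ := hP.isCompact.measure_lt_top.ne
  have hfinQ : volume (P ∪ tetra A b c d t) ≠ ⊤ :=
    (h.isPolyhedron_union hP hs).isCompact.measure_lt_top.ne
  have hpos : 0 < (volume P).toReal := by
    refine ENNReal.toReal_pos (fun h0 => ?_) hfinP
    exact (isOpen_interior.measure_pos volume hP.isConnected_interior.nonempty).ne'
      (measure_mono_null interior_subset h0)
  have hle : (volume P).toReal ≤ (volume (P ∪ tetra A b c d t)).toReal :=
    ENNReal.toReal_mono hfinQ (measure_mono subset_union_left)
  have h3 : edgeLength (P ∪ tetra A b c d t) < edgeLength P := by linarith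
  have h4 : edgeLength (P ∪ tetra A b c d t) ^ 3 < edgeLength P ^ 3 :=
    pow_lt_pow_left₀ h3 h2 (by norm_num)
  rw [melzakRatio, melzakRatio]
  calc edgeLength (P ∪ tetra A b c d t) ^ 3 / (volume (P ∪ tetra A b c d t)).toReal
      ≤ edgeLength (P ∪ tetra A b c d t) ^ 3 / (volume P).toReal := by gcongr
    _ < edgeLength P ^ 3 / (volume P).toReal := by gcongr

end IsTriangleCorner

/-! ### Faces of the enlarged polyhedron -/

/-- The relative interiors of the faces: the connected components of the set of flat points. -/
def openFaces (P : Set E3) : Set (Set E3) :=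
  {C | ∃ x ∈ flatPoints P, C = connectedComponentIn (flatPoints P) x}

/-- A face is determined by its relative interior and conversely. -/
theorem encard_openFaces (P : Set E3) : (openFaces P).encard = (faces P).encard := by
  have himg : faces P = closure '' openFaces P := by
    ext F
    constructor
    · rintro ⟨x, hx, rfl⟩
      exact ⟨_, ⟨x, hx, rfl⟩, rfl⟩
    · rintro ⟨_, ⟨x, hx, rfl⟩, rfl⟩
      exact ⟨x, hx, rfl⟩
  have hrec : ∀ C ∈ openFaces P, closure C ∩ flatPoints P = C := by
    rintro _ ⟨x, -, rfl⟩
    exact Subset.antisymm (fun y hy => mem_connectedComponentIn_of_mem_closure hy.1 hy.2)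
      fun y hy => ⟨subset_closure hy, connectedComponentIn_subset _ _ hy⟩
  have hinj : InjOn closure (openFaces P) := fun C hC C' hC' he => by
    rw [← hrec C hC, he, hrec C' hC']
  rw [himg, hinj.encard_image]

theorem openFaces_eq_connectedComponentIn {P C : Set E3} (hC : C ∈ openFaces P) {x : E3}
    (hx : x ∈ C) : C = connectedComponentIn (flatPoints P) x := by
  obtain ⟨y, -, rfl⟩ := hC
  exact connectedComponentIn_eq hx

/-- A partition of the set of flat points into nonempty connected relatively open sets is the
partition into components, so it has as many members as there are faces. -/
theorem encard_openFaces_of_partition {Q : Set E3} {K : Set (Set E3)} {D : Set E3 → Set E3}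
    (hsub : ∀ C ∈ K, D C ⊆ flatPoints Q) (hcover : ∀ x ∈ flatPoints Q, ∃ C ∈ K, x ∈ D C)
    (hdisj : ∀ C ∈ K, ∀ C' ∈ K, ∀ x ∈ D C, x ∈ D C' → C = C')
    (hne : ∀ C ∈ K, (D C).Nonempty) (hconn : ∀ C ∈ K, IsPreconnected (D C))
    (hopen : ∀ C ∈ K, ∀ x ∈ D C, ∀ᶠ y in 𝓝 x, y ∈ flatPoints Q → y ∈ D C) :
    (openFaces Q).encard = K.encard := by
  have hcomp : ∀ C ∈ K, ∀ x ∈ D C, connectedComponentIn (flatPoints Q) x = D C := by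
    intro C hC x hx
    refine Subset.antisymm ?_ ((hconn C hC).subset_connectedComponentIn hx (hsub C hC))
    refine isPreconnected_connectedComponentIn.forall_of_eventually_iff (p := fun y => y ∈ D C) ?_
      (mem_connectedComponentIn (hsub C hC hx)) hx
    intro y hy
    obtain ⟨C', hC', hyC'⟩ := hcover y (connectedComponentIn_subset _ _ hy)
    filter_upwards [hopen C' hC' y hyC'] with u hu hu'
    have huC' := hu (connectedComponentIn_subset _ _ hu')
    constructor
    · intro h1
      rwa [hdisj C hC C' hC' y h1 hyC']
    · intro h1
      rwa [hdisj C hC C' hC' u h1 huC']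
  have himg : openFaces Q = D '' K := by
    ext E
    constructor
    · rintro ⟨x, hx, rfl⟩
      obtain ⟨C, hC, hxC⟩ := hcover x hx
      exact ⟨C, hC, (hcomp C hC x hxC).symm⟩
    · rintro ⟨C, hC, rfl⟩
      obtain ⟨x, hx⟩ := hne C hC
      exact ⟨x, hsub C hC hx, (hcomp C hC x hx).symm⟩
  have hinj : InjOn D K := fun C hC C' hC' he => by
    obtain ⟨x, hx⟩ := hne C hC
    exact hdisj C hC C' hC' x hx (he ▸ hx)
  rw [himg, hinj.encard_image]

namespace IsTriangleCorner

variable {P U : Set E3} {A B C z : E3} {b c d : StrongDual ℝ E3} {σ t : ℝ}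

theorem hsp_neg_c_ne_neg_b (h : IsTriangleCorner P U A B C z b c d σ) (x : E3) :
    hsp (-b) x ≠ hsp (-c) x := by
  intro he
  have h1 : x - (B - A) ∈ hsp (-c) x := by
    rw [mem_hsp, sub_sub_cancel_left, map_neg, neg_apply, h.c_B, neg_zero, neg_zero]
  rw [← he, mem_hsp, sub_sub_cancel_left, map_neg, neg_apply, h.b_B] at h1
  norm_num at h1

theorem notMem_flatPoints_of_b_c (h : IsTriangleCorner P U A B C z b c d σ) (hP : IsPolyhedron P)
    {x : E3} (hx : x ∈ U) (hb : b (x - A) = 0) (hc : c (x - A) = 0) :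
    x ∉ flatPoints (P ∪ tetra A b c d t) := by
  refine notMem_flatPoints_of_two_hsp h.isOpen hx h.b_ne_zero h.c_ne_zero (fun y hy => ?_)
    (fun y hy => ?_) (h.hsp_neg_c_ne_neg_b x)
  · have := h.b_nonneg_union hP hy
    rw [← sub_sub_sub_cancel_right y x A, map_sub, neg_apply, neg_apply]
    linarith
  · rw [← tetra_swap] at hy
    have := h.swap.b_nonneg_union hP hy
    rw [← sub_sub_sub_cancel_right y x A, map_sub, neg_apply, neg_apply]
    linarith

theorem top_sub (h : IsTriangleCorner P U A B C z b c d σ) (s : ℝ) (x y : E3) :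
    (b + c + s • d) (y - x) = b (y - A) + c (y - A) + s * d (y - A) -
      (b (x - A) + c (x - A) + s * d (x - A)) := by
  rw [← sub_sub_sub_cancel_right y x B, map_sub, h.far_apply, h.far_apply]
  ring

theorem notMem_flatPoints_of_c_top (h : IsTriangleCorner P U A B C z b c d σ)
    (hP : IsPolyhedron P) (hs : IsSmallHeight P U A z b c d σ t)
    {x : E3} (hx : x ∈ U) (hc : c (x - A) = 0)
    (hg : b (x - A) + c (x - A) + t⁻¹ * d (x - A) = 1) :
    x ∉ flatPoints (P ∪ tetra A b c d t) := by
  refine notMem_flatPoints_of_two_hsp h.isOpen hx h.c_ne_zero (h.top_ne_zero t⁻¹) (fun y hy => ?_)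
    (fun y hy => ?_) fun he => ?_
  · rw [← tetra_swap] at hy
    have := h.swap.b_nonneg_union hP hy
    rw [← sub_sub_sub_cancel_right y x A, map_sub, neg_apply, neg_apply]
    linarith
  · have := h.top_le hP hs hy
    rw [h.top_sub]
    linarith
  · have h1 : x + (B - A) ∈ hsp (-c) x := by
      rw [mem_hsp, add_sub_cancel_left]
      simp [h.c_B]
    rw [he, mem_hsp, add_sub_cancel_left] at h1
    simp [h.b_B, h.c_B, h.d_B] at h1
    linarith

theorem notMem_flatPoints_of_d_top (h : IsTriangleCorner P U A B C z b c d σ)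
    (hP : IsPolyhedron P) (hs : IsSmallHeight P U A z b c d σ t)
    {x : E3} (hx : x ∈ U) (hd : d (x - A) = 0)
    (hg : b (x - A) + c (x - A) + t⁻¹ * d (x - A) = 1) :
    x ∉ flatPoints (P ∪ tetra A b c d t) := by
  refine notMem_flatPoints_of_two_hsp h.isOpen hx (h.top_ne_zero σ) (h.top_ne_zero t⁻¹)
    (fun y hy => ?_) (fun y hy => ?_) fun he => ?_
  · have := h.mem_of_mem_faceHalfspaces hP hs h.mem_far (h.hsp_far_ne hs.pos hs.lt_inv) hy
    rw [mem_hsp, h.far_apply] at this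
    rw [h.top_sub]
    rw [hd] at hg ⊢
    linarith
  · have := h.top_le hP hs hy
    rw [h.top_sub]
    linarith
  · have key : ∀ s : ℝ, (b + c + s • d) (x + (z - σ • (B - A)) - x) = s - σ := fun s => by
      rw [add_sub_cancel_left]
      simp [h.b_B, h.c_B, h.d_B, h.b_z, h.c_z, h.d_z]
      ring
    have h1 : x + (z - σ • (B - A)) ∈ hsp (b + c + σ • d) x := by rw [mem_hsp, key, sub_self]
    rw [he, mem_hsp, key] at h1
    linarith [hs.lt_inv]

/-- The flat points of the enlarged polyhedron that belong to the tetrahedron. -/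
theorem flat_cases (h : IsTriangleCorner P U A B C z b c d σ)
    (hP : IsPolyhedron P) (hs : IsSmallHeight P U A z b c d σ t) {x : E3}
    (hx : x ∈ tetra A b c d t) (hxf : x ∈ flatPoints (P ∪ tetra A b c d t)) :
    x ∈ lateral A b c d t ∨ x ∈ lateral A c b d t ∨ x ∈ upperFace A b c d t := by
  have hxU := hs.tetra_subset hx
  rcases h.tetra_cases hP hx with h1 | h1 | h1 | h1 | h1 | h1 | h1 | h1
  · exact absurd h1 hxf.1.2
  · exact .inl h1
  · exact .inr (.inl h1)
  · exact .inr (.inr h1)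
  · exact absurd hxf (h.notMem_flatPoints_of_b_c hP hxU h1.1 h1.2)
  · exact absurd hxf (h.notMem_flatPoints_of_c_top hP hs hxU h1.1 h1.2)
  · rw [← tetra_swap] at hxf
    exact absurd hxf (h.swap.notMem_flatPoints_of_c_top hP hs.swap hxU h1.1 (by linarith [h1.2]))
  · exact absurd hxf (h.notMem_flatPoints_of_d_top hP hs hxU h1.1 h1.2)

/-- Near a point of `lateral A b c d t`, the flat points of the enlarged polyhedron belong to this
set or to the face of `P` adjacent to the side `A B`. -/
theorem eventually_lateral (h : IsTriangleCorner P U A B C z b c d σ)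
    (hP : IsPolyhedron P) (hs : IsSmallHeight P U A z b c d σ t) {y₁ : E3} (hyU : y₁ ∈ U)
    (hyc : c (y₁ - A) = 0) (hagr : AgreeNear P (hsp (-c) y₁) y₁) {x : E3}
    (hx : x ∈ lateral A b c d t) :
    ∀ᶠ y in 𝓝 x, y ∈ flatPoints (P ∪ tetra A b c d t) →
      y ∈ lateral A b c d t ∨ y ∈ connectedComponentIn (flatPoints P) y₁ := by
  obtain ⟨hc, hb, hd, hg⟩ := hx
  have hg' : ∀ᶠ y in 𝓝 x, b (y - A) + c (y - A) + t⁻¹ * d (y - A) < 1 := by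
    have hcont : Continuous fun y : E3 => b (y - A) + c (y - A) + t⁻¹ * d (y - A) := by fun_prop
    exact (hcont.tendsto x).eventually (eventually_lt_nhds hg)
  filter_upwards [hg', eventually_lt_apply hb,
    h.isOpen.mem_nhds (hs.tetra_subset ⟨hb.le, hc.ge, hd, hg.le⟩),
    (h.agree_side hP hs hb hc hd hg).eventually_of_mem_frontier] with y hy1 hy2 hy3 hy4 hyf
  have hy5 := hy4 hyf.1
  have hyc' : c (y - A) = 0 := by
    rw [← sub_sub_sub_cancel_right y x A, map_sub, neg_apply, neg_apply, hc] at hy5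
    linarith
  rcases le_or_gt 0 (d (y - A)) with h0 | h0
  · exact .inl ⟨hyc', hy2, h0, hy1⟩
  · right
    have hyT : y ∉ tetra A b c d t := fun hyT => absurd hyT.2.2.1 (not_le.2 h0)
    have hyf' := (mem_flatPoints_congr (eventually_union_iff_left hyT)).1 hyf
    obtain ⟨φ, -, hφ⟩ := mem_flatPoints_iff.1 hyf'
    rw [hagr.connectedComponentIn_eq h.isOpen h.convex_inter h.c_ne_zero hyU hy3 hyf' hφ.mem (by
      rw [← sub_sub_sub_cancel_right y y₁ A, map_sub, neg_apply, neg_apply, hyc, hyc']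
      simp)]
    exact mem_connectedComponentIn hyf'

theorem convex_lateral (A : E3) (b c d : StrongDual ℝ E3) (t : ℝ) :
    Convex ℝ (lateral A b c d t) := by
  rw [convex_iff_forall_pos]
  rintro x ⟨h1, h2, h3, h4⟩ y ⟨h1', h2', h3', h4'⟩ r s hr hs hrs
  refine ⟨?_, ?_, ?_, ?_⟩ <;> simp only [apply_smul_add_smul_sub _ _ _ _ hrs]
  · rw [h1, h1']; ring
  · positivity
  · positivity
  · nlinarith

theorem convex_upper (A : E3) (b c d : StrongDual ℝ E3) (t : ℝ) :
    Convex ℝ (upperFace A b c d t) := by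
  rw [convex_iff_forall_pos]
  rintro x ⟨h1, h2, h3, h4⟩ y ⟨h1', h2', h3', h4'⟩ r s hr hs hrs
  refine ⟨?_, ?_, ?_, ?_⟩ <;> simp only [apply_smul_add_smul_sub _ _ _ _ hrs]
  · positivity
  · positivity
  · positivity
  · linear_combination r * h4 + s * h4' + hrs

/-- The face adjacent to the side `A B` and the lateral face of the tetrahedron together are
connected: both contain the midpoint of the side in their closures. -/
theorem isPreconnected_union_lateral (h : IsTriangleCorner P U A B C z b c d σ)
    {y₁ : E3} (hyU : y₁ ∈ U)
    (hyc : c (y₁ - A) = 0) (hagr : AgreeNear P (hsp (-c) y₁) y₁) :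
    IsPreconnected (connectedComponentIn (flatPoints P) y₁ ∪ lateral A b c d t) := by
  set x : E3 := A + (2 : ℝ)⁻¹ • (B - A) with hx
  have hb : b (x - A) = 2⁻¹ := by rw [hx, add_sub_cancel_left]; simp [h.b_B]
  have hc : c (x - A) = 0 := by rw [hx, add_sub_cancel_left]; simp [h.c_B]
  have hd : d (x - A) = 0 := by rw [hx, add_sub_cancel_left]; simp [h.d_B]
  have hxL : x ∈ lateral A b c d t :=
    ⟨hc, by rw [hb]; norm_num, hd.ge, by rw [hb, hc, hd]; norm_num⟩
  have hxP : x ∈ U ∩ P :=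
    h.mem_of_d_zero (t := t) ⟨by rw [hb]; norm_num, hc.ge, hd.ge, hxL.2.2.2.le⟩ hd
  have hxC := hagr.mem_closure_connectedComponentIn h.isOpen h.convex_inter h.c_ne_zero hyU hxP (by
    rw [← sub_sub_sub_cancel_right x y₁ A, map_sub, neg_apply, neg_apply, hyc, hc]
    simp)
  have h1 : IsPreconnected (insert x (connectedComponentIn (flatPoints P) y₁)) :=
    isPreconnected_connectedComponentIn.subset_closure (subset_insert _ _)
      (insert_subset hxC subset_closure)
  have h2 := IsPreconnected.union x (mem_insert _ _) hxL h1
    (convex_lateral A b c d t).isPreconnected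
  have hmem : x ∈ connectedComponentIn (flatPoints P) y₁ ∪ lateral A b c d t := Or.inr hxL
  rwa [insert_union, insert_eq_of_mem hmem] at h2

/-- The enlarged polyhedron has as many faces as `P`: the upper face of the tetrahedron replaces
the triangle, the two faces adjacent to the sides `A B` and `A C` are prolonged by the lateral faces
of the tetrahedron, and all other faces are unchanged. -/
theorem encard_faces_union (h : IsTriangleCorner P U A B C z b c d σ)
    (hP : IsPolyhedron P) (hs : IsSmallHeight P U A z b c d σ t) :
    (faces (P ∪ tetra A b c d t)).encard = (faces P).encard := by
  obtain ⟨x₀, hx₀, hface⟩ := h.face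
  obtain ⟨y₁, hy₁U, hy₁c, hy₁d, hy₁⟩ := h.exists_agree_c hP
  obtain ⟨y₂, hy₂U, hy₂b, hy₂d, hy₂⟩ := h.swap.exists_agree_c hP
  have hy₁f : y₁ ∈ flatPoints P := mem_flatPoints_iff.2 ⟨_, h.c_ne_zero, hy₁⟩
  have hy₂f : y₂ ∈ flatPoints P := mem_flatPoints_iff.2 ⟨_, h.b_ne_zero, hy₂⟩
  set F := connectedComponentIn (flatPoints P) x₀ with hF
  set F₁ := connectedComponentIn (flatPoints P) y₁ with hF₁
  set F₂ := connectedComponentIn (flatPoints P) y₂ with hF₂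
  have hmF : ∀ {x}, x ∈ F ↔ d (x - A) = 0 ∧ 0 < b (x - A) ∧ 0 < c (x - A) ∧
      b (x - A) + c (x - A) < 1 := fun {x} => by rw [hface]; rfl
  have hFT : F ⊆ tetra A b c d t := fun x hx => by
    obtain ⟨h1, h2, h3, h4⟩ := hmF.1 hx
    exact ⟨h2.le, h3.le, h1.ge, by rw [h1]; linarith⟩
  have hTF : ∀ x ∈ flatPoints P, x ∈ tetra A b c d t → x ∈ F := fun x hx hxT => by
    obtain ⟨φ, -, hφ⟩ := mem_flatPoints_iff.1 hx
    have hd := h.d_eq_zero_of_mem hP hs hxT hφ.mem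
    have hbc : b (x - A) + c (x - A) ≤ 1 := by
      have := hxT.2.2.2
      rw [hd] at this
      linarith
    exact hmF.2 ⟨hd, h.notMem x hd hxT.1 hxT.2.1 hbc hx⟩
  have hy₁F₁ : y₁ ∈ F₁ := mem_connectedComponentIn hy₁f
  have hy₂F₂ : y₂ ∈ F₂ := mem_connectedComponentIn hy₂f
  have hF₁F : F₁ ≠ F := fun he => by
    have := (hmF.1 (he ▸ hy₁F₁)).1
    linarith
  have hF₂F : F₂ ≠ F := fun he => by
    have := (hmF.1 (he ▸ hy₂F₂)).1
    linarith
  have hF₁F₂ : F₁ ≠ F₂ := fun he => by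
    have hmem : y₂ ∈ F₁ := he ▸ hy₂F₂
    have h1 := (hy₁.of_mem_connectedComponentIn h.c_ne_zero hmem).2
    exact h.hsp_neg_c_ne_neg_b y₂ (h1.hsp_eq h.b_ne_zero (hy₂.mono fun y hy => hy.1))
  -- The face of `P` with relative interior `K` becomes the face with relative interior `D K`.
  let D : Set E3 → Set E3 := fun K => {x | (x ∈ K ∧ K ≠ F) ∨ (x ∈ upperFace A b c d t ∧ K = F) ∨
    (x ∈ lateral A b c d t ∧ K = F₁) ∨ (x ∈ lateral A c b d t ∧ K = F₂)}
  have hout : ∀ K ∈ openFaces P, K ≠ F → ∀ x ∈ K, x ∈ flatPoints P ∧ x ∉ tetra A b c d t := by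
    intro K hK hKF x hx
    have hxf : x ∈ flatPoints P := by
      rw [openFaces_eq_connectedComponentIn hK hx] at hx
      exact connectedComponentIn_subset _ _ hx
    refine ⟨hxf, fun hxT => hKF ?_⟩
    rw [openFaces_eq_connectedComponentIn hK hx, hF, ← connectedComponentIn_eq (hTF x hxf hxT)]
  have hL2 : lateral A c b d t ⊆ tetra A b c d t := by
    rw [← tetra_swap]; exact lateral_subset_tetra
  rw [← encard_openFaces, ← encard_openFaces]
  refine encard_openFaces_of_partition (D := D) ?_ ?_ ?_ ?_ ?_ ?_
  · rintro K hK x (⟨hx, hKF⟩ | ⟨hx, -⟩ | ⟨hx, -⟩ | ⟨hx, -⟩)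
    · obtain ⟨h1, h2⟩ := hout K hK hKF x hx
      exact (mem_flatPoints_congr (eventually_union_iff_left h2)).2 h1
    · exact h.upper_subset_flatPoints hP hs hx
    · exact h.lateral_subset_flatPoints hP hs hx
    · exact h.lateral_subset_flatPoints' hP hs hx
  · intro x hx
    by_cases hxT : x ∈ tetra A b c d t
    · rcases h.flat_cases hP hs hxT hx with h1 | h1 | h1
      · exact ⟨F₁, ⟨y₁, hy₁f, rfl⟩, .inr <| .inr <| .inl ⟨h1, rfl⟩⟩
      · exact ⟨F₂, ⟨y₂, hy₂f, rfl⟩, .inr <| .inr <| .inr ⟨h1, rfl⟩⟩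
      · exact ⟨F, ⟨x₀, hx₀, rfl⟩, .inr <| .inl ⟨h1, rfl⟩⟩
    · have hxf := (mem_flatPoints_congr (eventually_union_iff_left hxT)).1 hx
      have hxm := mem_connectedComponentIn hxf
      exact ⟨_, ⟨x, hxf, rfl⟩, .inl ⟨hxm, fun he => hxT (hFT (he ▸ hxm))⟩⟩
  · rintro K hK K' hK' x (⟨hx, hKF⟩ | ⟨hx, rfl⟩ | ⟨hx, rfl⟩ | ⟨hx, rfl⟩)
      (⟨hx', hKF'⟩ | ⟨hx', rfl⟩ | ⟨hx', rfl⟩ | ⟨hx', rfl⟩)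
    · rw [openFaces_eq_connectedComponentIn hK hx, openFaces_eq_connectedComponentIn hK' hx']
    · exact absurd (upper_subset_tetra hx') (hout K hK hKF x hx).2
    · exact absurd (lateral_subset_tetra hx') (hout K hK hKF x hx).2
    · exact absurd (hL2 hx') (hout K hK hKF x hx).2
    · exact absurd (upper_subset_tetra hx) (hout _ hK' hKF' x hx').2
    · rfl
    · linarith [hx.2.1, hx'.1]
    · linarith [hx.1, hx'.1]
    · exact absurd (lateral_subset_tetra hx) (hout _ hK' hKF' x hx').2
    · linarith [hx'.2.1, hx.1]
    · rfl
    · linarith [hx.2.1, hx'.1]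
    · exact absurd (hL2 hx) (hout _ hK' hKF' x hx').2
    · linarith [hx'.1, hx.1]
    · linarith [hx'.2.1, hx.1]
    · rfl
  · intro K hK
    by_cases hKF : K = F
    · refine ⟨A + ((4 : ℝ)⁻¹ • (B - A) + (4 : ℝ)⁻¹ • (C - A) + (t / 2) • z),
        .inr <| .inl ⟨?_, hKF⟩⟩
      have ht := hs.pos
      simp only [upperFace, mem_ofPred_eq, add_sub_cancel_left, map_add, map_smul, h.b_B, h.b_C,
        h.b_z, h.c_B, h.c_C, h.c_z, h.d_B, h.d_C, h.d_z, smul_eq_mul]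
      refine ⟨by norm_num, by norm_num, by linarith, ?_⟩
      field_simp
      ring
    · obtain ⟨x, hx, rfl⟩ := hK
      exact ⟨x, .inl ⟨mem_connectedComponentIn hx, hKF⟩⟩
  · intro K hK
    have hKc : IsPreconnected K := by
      obtain ⟨x, hx, rfl⟩ := hK
      exact isPreconnected_connectedComponentIn
    by_cases hKF : K = F
    · have : D K = upperFace A b c d t := by
        ext x
        simp [D, hKF, hF₁F.symm, hF₂F.symm]
      rw [this]
      exact (convex_upper A b c d t).isPreconnected
    by_cases hK1 : K = F₁
    · have : D K = F₁ ∪ lateral A b c d t := by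
        ext x
        simp [D, hK1, hF₁F, hF₁F₂]
      rw [this]
      exact h.isPreconnected_union_lateral hy₁U hy₁c hy₁
    by_cases hK2 : K = F₂
    · have : D K = F₂ ∪ lateral A c b d t := by
        ext x
        simp [D, hK2, hF₂F, hF₁F₂.symm]
      rw [this]
      exact h.swap.isPreconnected_union_lateral hy₂U hy₂b hy₂
    · have : D K = K := by
        ext x
        simp [D, hKF, hK1, hK2]
      rwa [this]
  · rintro K hK x (⟨hx, hKF⟩ | ⟨hx, rfl⟩ | ⟨hx, rfl⟩ | ⟨hx, rfl⟩)
    · obtain ⟨h1, h2⟩ := hout K hK hKF x hx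
      filter_upwards [(isClosed_tetra A b c d t).isOpen_compl.mem_nhds h2,
        eventually_mem_connectedComponentIn h1] with y hy1 hy2 hyf
      refine .inl ⟨?_, hKF⟩
      rw [openFaces_eq_connectedComponentIn hK hx]
      exact hy2 ((mem_flatPoints_congr (eventually_union_iff_left hy1)).1 hyf)
    · obtain ⟨h1, h2, h3, h4⟩ := hx
      filter_upwards [eventually_lt_apply h1, eventually_lt_apply h2, eventually_lt_apply h3,
        (h.agree_top hP hs h1 h2 h3 h4).eventually_of_mem_frontier] with y hy1 hy2 hy3 hy4 hyf
      have := hy4 hyf.1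
      rw [h.top_sub] at this
      exact .inr <| .inl ⟨⟨hy1, hy2, hy3, by linarith⟩, rfl⟩
    · filter_upwards [h.eventually_lateral hP hs hy₁U hy₁c hy₁ hx] with y hy hyf
      rcases hy hyf with h1 | h1
      · exact .inr <| .inr <| .inl ⟨h1, rfl⟩
      · exact .inl ⟨h1, hF₁F⟩
    · have := h.swap.eventually_lateral hP hs.swap hy₂U hy₂b hy₂ hx
      rw [tetra_swap] at this
      filter_upwards [this] with y hy hyf
      rcases hy hyf with h1 | h1
      · exact .inr <| .inr <| .inr ⟨h1, rfl⟩
      · exact .inl ⟨h1, hF₂F⟩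

end IsTriangleCorner

/-! ### Decrease of the edge length -/

/-- The supplementary angles are positive with sum at most `π / 2`, so their cosines add up to more
than `1`. -/
theorem one_add_cos_add_cos_neg {β γ : ℝ} (hβ : β < Real.pi) (hγ : γ < Real.pi)
    (h : 3 * Real.pi / 2 ≤ β + γ) : 1 + Real.cos β + Real.cos γ < 0 := by
  have h1 : Real.sin (Real.pi - β) ≤ Real.cos (Real.pi - γ) := by
    rw [← Real.cos_pi_div_two_sub]
    exact Real.cos_le_cos_of_nonneg_of_le_pi (by linarith) (by linarith [Real.pi_pos])
      (by linarith)
  rw [Real.cos_pi_sub] at h1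
  have h2 : 0 < Real.sin (Real.pi - β) :=
    Real.sin_pos_of_pos_of_lt_pi (by linarith) (by linarith)
  have h3 : 0 < Real.cos (Real.pi - β) :=
    Real.cos_pos_of_mem_Ioo ⟨by linarith [Real.pi_pos], by linarith⟩
  have h4 := Real.sin_sq_add_cos_sq (Real.pi - β)
  have h5 : Real.cos β = -Real.cos (Real.pi - β) := by rw [Real.cos_pi_sub, neg_neg]
  nlinarith

/-- The derivative of `‖v - t • z‖` at `t = 0` is the cosine of the angle between `v` and `-z`, and
the error is quadratic. -/
theorem norm_sub_smul_le {v z : E3} (hv : v ≠ 0) (hz : ‖z‖ = 1) {t : ℝ} (ht : 0 ≤ t) :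
    ‖v - t • z‖ ≤ ‖v‖ + t * Real.cos (InnerProductGeometry.angle v (-z)) + t ^ 2 / (2 * ‖v‖) := by
  have hr : 0 < ‖v‖ := norm_pos_iff.2 hv
  set k := Real.cos (InnerProductGeometry.angle v (-z)) with hk
  have hk1 : -1 ≤ k := Real.neg_one_le_cos _
  have hinner : inner ℝ v z = -(‖v‖ * k) := by
    have := InnerProductGeometry.cos_angle_mul_norm_mul_norm v (-z)
    rw [norm_neg, hz, inner_neg_right] at this
    linarith
  have hsq : ‖v - t • z‖ ^ 2 = ‖v‖ ^ 2 + 2 * t * (‖v‖ * k) + t ^ 2 := by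
    rw [norm_sub_sq_real, norm_smul, hz, inner_smul_right, hinner, mul_one,
      Real.norm_eq_abs, sq_abs]
    ring
  set q := t ^ 2 / (2 * ‖v‖) with hq
  have hq' : 2 * ‖v‖ * q = t ^ 2 := by rw [hq]; field_simp
  have hq0 : 0 ≤ q := by positivity
  have hs : 0 ≤ ‖v‖ + t * k + q := by
    have : t ≤ ‖v‖ + q := by
      nlinarith [sq_nonneg (‖v‖ - q), sq_nonneg (‖v‖ + q - t)]
    nlinarith
  refine le_of_sq_le_sq ?_ hs
  rw [hsq]
  nlinarith [sq_nonneg (t * k + q)]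

namespace IsTriangleCorner

variable {P U : Set E3} {A B C z : E3} {b c d : StrongDual ℝ E3} {σ : ℝ}

theorem sub_ne_zero (h : IsTriangleCorner P U A B C z b c d σ) : B - A ≠ 0 := fun h0 => by
  have := h.b_B
  rw [h0, map_zero] at this
  norm_num at this

theorem angle_lt_pi (h : IsTriangleCorner P U A B C z b c d σ) :
    InnerProductGeometry.angle (B - A) (-z) < Real.pi := by
  refine lt_of_le_of_ne (InnerProductGeometry.angle_le_pi _ _) fun he => ?_
  obtain ⟨-, r, hr, hz⟩ := InnerProductGeometry.angle_eq_pi_iff.1 he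
  have h1 : d (-z) = 0 := by rw [hz, map_smul, h.d_B, smul_zero]
  rw [map_neg, h.d_z] at h1
  norm_num at h1

/-- If the line in which the planes of the two adjacent faces meet makes sufficiently large angles
with the sides `A B` and `A C`, then moving the vertex `A` outwards along this line shortens the
edges: the derivative of the total length of the three edges at `A + t • z` is negative. -/
theorem exists_edges_lt (h : IsTriangleCorner P U A B C z b c d σ)
    (hangle : 3 * Real.pi / 2 ≤ InnerProductGeometry.angle (B - A) (-z) +
      InnerProductGeometry.angle (C - A) (-z)) :
    ∃ δ : ℝ, 0 < δ ∧ ∀ t ∈ Ioc 0 δ, dist A (A + t • z) +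
      (dist B (A + t • z) + dist C (A + t • z)) < dist A B + dist A C := by
  have hB := norm_pos_iff.2 h.sub_ne_zero
  have hC := norm_pos_iff.2 h.swap.sub_ne_zero
  have hneg := one_add_cos_add_cos_neg h.angle_lt_pi h.swap.angle_lt_pi hangle
  set k := 1 + Real.cos (InnerProductGeometry.angle (B - A) (-z)) +
    Real.cos (InnerProductGeometry.angle (C - A) (-z)) with hk
  set M := 1 / (2 * ‖B - A‖) + 1 / (2 * ‖C - A‖) with hM
  have hMpos : 0 < M := by positivity
  refine ⟨-k / (2 * M), div_pos (neg_pos.2 hneg) (by positivity), fun t ht => ?_⟩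
  have h1 := norm_sub_smul_le h.sub_ne_zero h.norm_z ht.1.le
  have h2 := norm_sub_smul_le h.swap.sub_ne_zero h.norm_z ht.1.le
  have h3 : dist A (A + t • z) = t := by
    rw [dist_self_add_right, norm_smul, h.norm_z, mul_one, Real.norm_of_nonneg ht.1.le]
  have e : ∀ X : E3, dist X (A + t • z) = ‖X - A - t • z‖ := fun X => by
    rw [dist_eq_norm, sub_sub]
  rw [h3, e, e, dist_comm A B, dist_comm A C, dist_eq_norm, dist_eq_norm]
  have h4 : t * (2 * M) ≤ -k := (le_div_iff₀ (by positivity)).1 ht.2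
  have h5 : t ^ 2 / (2 * ‖B - A‖) + t ^ 2 / (2 * ‖C - A‖) = t * (t * M) := by
    rw [hM]; ring
  nlinarith [mul_pos ht.1 (mul_pos ht.1 hMpos), ht.1]

/-! ### Rotating the plane of the face -/

/-- The rotations of the plane of the triangle about the line `B C` are the planes through
`B C` and `A + t • z`; the height `t` tends to zero with the angle. -/
theorem exists_rotation (h : IsTriangleCorner P U A B C z b c d σ) :
    ∃ n m : E3, ‖n‖ = 1 ∧ ‖m‖ = 1 ∧ inner ℝ n m = 0 ∧ inner ℝ m (C - B) = 0 ∧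
      (∃ κ : ℝ, 0 < κ ∧ ∀ v, inner ℝ n v = κ * d v) ∧
      ∀ ε : ℝ, 0 < ε → ∃ δ : ℝ, 0 < δ ∧ ∀ θ ∈ Ioc 0 δ, ∃ t ∈ Ioc 0 ε,
        rotatedHalfspace B n m θ = hsp (b + c + t⁻¹ • d) B := by
  set n₀ : E3 := (InnerProductSpace.toDual ℝ E3).symm d with hn₀
  have hn₀d : ∀ v, inner ℝ n₀ v = d v := fun v => by
    rw [hn₀, InnerProductSpace.toDual_symm_apply]
  have hn₀0 : 0 < ‖n₀‖ := norm_pos_iff.2 fun h0 => by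
    have := hn₀d z
    rw [h0, inner_zero_left, h.d_z] at this
    norm_num at this
  have hCB : C - B ≠ 0 := fun h0 => by
    have : b (C - A - (B - A)) = 0 := by rw [sub_sub_sub_cancel_right, h0, map_zero]
    rw [map_sub, h.b_B, h.b_C] at this
    norm_num at this
  have hCB' : 0 < ‖C - B‖ := norm_pos_iff.2 hCB
  -- the altitude of the triangle from the side `B C` to the vertex `A`
  set w : E3 := (A - B) - (inner ℝ (A - B) (C - B) / ‖C - B‖ ^ 2) • (C - B) with hw
  have hwCB : inner ℝ w (C - B) = 0 := by
    rw [hw, inner_sub_left, inner_smul_left, real_inner_self_eq_norm_sq]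
    simp only [conj_trivial]
    field_simp
    ring
  have hdw : d w = 0 := by
    have h1 : d (A - B) = 0 := by rw [← neg_sub, map_neg, h.d_B, neg_zero]
    have h2 : d (C - B) = 0 := by
      rw [← sub_sub_sub_cancel_right C B A, map_sub, h.d_B, h.d_C, sub_zero]
    rw [hw, map_sub, map_smul, h1, h2, smul_zero, sub_zero]
  have hw0 : 0 < ‖w‖ := norm_pos_iff.2 fun h0 => by
    have h1 : (b + c) (A - B) = -1 := by
      rw [← neg_sub, map_neg, add_apply, h.b_B, h.c_B, add_zero]
    have h2 : (b + c) (C - B) = 0 := by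
      rw [← sub_sub_sub_cancel_right C B A, map_sub, add_apply, add_apply, h.b_B, h.c_B, h.b_C,
        h.c_C]
      norm_num
    have h3 : (b + c) w = -1 := by rw [hw, map_sub, map_smul, h1, h2, smul_zero, sub_zero]
    rw [h0, map_zero] at h3
    norm_num at h3
  have hwA : inner ℝ w (A - B) = ‖w‖ ^ 2 := by
    have : A - B = w + (inner ℝ (A - B) (C - B) / ‖C - B‖ ^ 2) • (C - B) := by rw [hw]; abel
    rw [this, inner_add_right, inner_smul_right, hwCB, real_inner_self_eq_norm_sq, mul_zero,
      add_zero]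
  set n : E3 := ‖n₀‖⁻¹ • n₀ with hn
  set m : E3 := -(‖w‖⁻¹ • w) with hm
  set κ := ‖n₀‖⁻¹ with hκ
  have hκ0 : 0 < κ := inv_pos.2 hn₀0
  have hnd : ∀ v, inner ℝ n v = κ * d v := fun v => by
    rw [hn, inner_smul_left, hn₀d]; simp
  set η := ‖w‖ with hη
  set μ := inner ℝ m z with hμ
  have hmA : inner ℝ m (A - B) = -η := by
    rw [hm, inner_neg_left, inner_smul_left, hwA]
    simp only [conj_trivial]
    field_simp
  have hmC : inner ℝ m (C - B) = 0 := by
    rw [hm, inner_neg_left, inner_smul_left, hwCB, mul_zero, neg_zero]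
  have hmx : ∀ x, inner ℝ m (x - B) =
      -((1 - b (x - A) - c (x - A)) * η) + d (x - A) * μ := fun x => by
    have e : x - B = (1 - b (x - A) - c (x - A)) • (A - B) + c (x - A) • (C - B) +
        d (x - A) • z := by
      rw [← sub_add_sub_cancel x A B]
      nth_rewrite 1 [h.decomp (x - A)]
      module
    rw [e, inner_add_right, inner_add_right, inner_smul_right, inner_smul_right, inner_smul_right,
      hmA, hmC, hμ]
    ring
  have hnx : ∀ x, inner ℝ n (x - B) = κ * d (x - A) := fun x => by
    rw [hnd, ← sub_sub_sub_cancel_right x B A, map_sub, h.d_B, sub_zero]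
  refine ⟨n, m, ?_, ?_, ?_, hmC, ⟨κ, hκ0, hnd⟩, fun ε hε => ?_⟩
  · rw [hn, norm_smul, norm_inv, norm_norm, inv_mul_cancel₀ hn₀0.ne']
  · rw [hm, norm_neg, norm_smul, norm_inv, norm_norm, inv_mul_cancel₀ hw0.ne']
  · rw [hnd, hm, map_neg, map_smul, hdw, smul_zero, neg_zero, mul_zero]
  · have hden : ∀ᶠ θ : ℝ in 𝓝 0, 0 < κ * Real.cos θ + μ * Real.sin θ := by
      have hcont : Continuous fun θ : ℝ => κ * Real.cos θ + μ * Real.sin θ := by fun_prop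
      exact (hcont.tendsto 0).eventually (eventually_gt_nhds (by simpa using hκ0))
    have hnum : ∀ᶠ θ : ℝ in 𝓝 0,
        η * Real.sin θ < ε * (κ * Real.cos θ + μ * Real.sin θ) := by
      have h1 : Continuous fun θ : ℝ => η * Real.sin θ := by fun_prop
      have h2 : Continuous fun θ : ℝ => ε * (κ * Real.cos θ + μ * Real.sin θ) := by fun_prop
      exact (h1.tendsto 0).eventually_lt (h2.tendsto 0) (by simpa using mul_pos hε hκ0)
    obtain ⟨δ, hδ, hball⟩ := Metric.eventually_nhds_iff.1
      ((hden.and hnum).and (eventually_lt_nhds Real.pi_pos))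
    refine ⟨δ / 2, by positivity, fun θ hθ => ?_⟩
    obtain ⟨⟨h1, h2⟩, h3⟩ := hball (y := θ) (by
      rw [Real.dist_eq, sub_zero, abs_of_pos hθ.1]
      linarith [hθ.2])
    have hsin := Real.sin_pos_of_pos_of_lt_pi hθ.1 h3
    -- the plane rotated by `θ` meets the line through `A` in the direction `z` at this height
    refine ⟨η * Real.sin θ / (κ * Real.cos θ + μ * Real.sin θ),
      ⟨by positivity, ((div_lt_iff₀ h1).2 h2).le⟩, ?_⟩
    ext x
    have hpos : 0 < η * Real.sin θ := by positivity
    have key : inner ℝ (Real.cos θ • n + Real.sin θ • m) (x - B) = (η * Real.sin θ) *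
        (b (x - A) + c (x - A) + (κ * Real.cos θ + μ * Real.sin θ) / (η * Real.sin θ) *
          d (x - A) - 1) := by
      rw [inner_add_left, real_inner_smul_left n, real_inner_smul_left m, hnx, hmx]
      field_simp
      ring
    rw [h.mem_hsp_top, inv_div, rotatedHalfspace, mem_ofPred_eq, key]
    refine ⟨fun h' => ?_, fun h' => mul_nonpos_of_nonneg_of_nonpos hpos.le (by linarith)⟩
    linarith [nonpos_of_mul_nonpos_right h' hpos]

end IsTriangleCorner

theorem convexHull_range_fin_three (A : Fin 3 → E3) (i : Fin 3) :
    convexHull ℝ {A i, A (i + 1), A (i + 2)} = convexHull ℝ (range A) := by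
  congr 1
  ext x
  fin_cases i <;> simp [Fin.exists_fin_succ, eq_comm] <;> tauto

theorem AffineIndependent.smul_sub_add_smul_sub {A : Fin 3 → E3} (hA : AffineIndependent ℝ A)
    (i : Fin 3) (s t : ℝ) (h : s • (A (i + 1) - A i) + t • (A (i + 2) - A i) = 0) :
    s = 0 ∧ t = 0 := by
  have hA' := hA.comp_embedding (Equiv.addLeft i).toEmbedding
  have key := affineIndependent_iff.1 hA' Finset.univ ![-s - t, s, t]
    (by simp [Fin.sum_univ_three]; ring) (by
      simp only [Fin.sum_univ_three, Function.comp_apply, Equiv.coe_toEmbedding,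
        Equiv.coe_addLeft, Matrix.cons_val_zero, Matrix.cons_val_one, Matrix.cons_val, add_zero]
      rw [← h]
      module)
  exact ⟨key 1 (Finset.mem_univ _), key 2 (Finset.mem_univ _)⟩

theorem sum_angle_eq_pi {A : Fin 3 → E3} (hA : AffineIndependent ℝ A) :
    ∑ i, InnerProductGeometry.angle (A (i + 1) - A i) (A (i + 2) - A i) = Real.pi := by
  have h := EuclideanGeometry.angle_add_angle_add_angle_eq_pi (p₁ := A 1) (p₂ := A 0) (A 2)
    (fun he => by simpa using hA.injective he)
  simp only [EuclideanGeometry.angle, vsub_eq_sub] at h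
  rw [Fin.sum_univ_three]
  simp only [zero_add, Fin.reduceAdd]
  linarith

/-- A convex open neighbourhood of an exposed convex face inside the one that exposes it. -/
theorem IsExposedFace.exists_convex {P F : Set E3} (h : IsExposedFace P F) (hF : IsCompact F)
    (hFc : Convex ℝ F) :
    ∃ U, IsOpen U ∧ Convex ℝ U ∧ F ⊆ U ∧ Convex ℝ (U ∩ P) := by
  obtain ⟨-, V, hV, hFV, hVP⟩ := h
  obtain ⟨δ, hδ, hsub⟩ := hF.exists_thickening_subset_open hV hFV
  refine ⟨Metric.thickening δ F, Metric.isOpen_thickening, hFc.thickening δ,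
    Metric.self_subset_thickening hδ F, ?_⟩
  rw [← inter_eq_self_of_subset_left hsub, inter_assoc]
  exact (hFc.thickening δ).inter hVP

theorem sdiff_union_inter_of_inter_eq {P Q U H : Set E3} (h : U ∩ Q = U ∩ H)
    (hPQ : P \ U = Q \ U) :
    (P \ U) ∪ (U ∩ H) = Q := by
  rw [← h, hPQ, inter_comm, sdiff_union_inter]

theorem mainTheorem4 (P : Set E3) (hP : IsPolyhedron P)
    (A : Fin 3 → E3) (hA : AffineIndependent ℝ A)
    (hF : IsExposedFace P (convexHull ℝ (Set.range A)))
    (hdeficit : ∑ i, angleDeficit P (A i) ≤ Real.pi / 2) :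
    ∃ U : Set E3, IsOpen U ∧ Convex ℝ U ∧ convexHull ℝ (Set.range A) ⊆ U ∧ Convex ℝ (U ∩ P) ∧
      ∃ (i : Fin 3) (n m : E3), IsRotationFrame P U A i n m ∧
        rotateFace P U (A (i + 1)) n m 0 = P ∧
        ∃ ε : ℝ, 0 < ε ∧ ∀ θ ∈ Set.Ioc 0 ε,
          IsPolyhedron (rotateFace P U (A (i + 1)) n m θ) ∧
          (faces (rotateFace P U (A (i + 1)) n m θ)).encard = (faces P).encard ∧
          melzakRatio (rotateFace P U (A (i + 1)) n m θ) < melzakRatio P := by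
  obtain ⟨U, hU, hUc, hFU, hUP⟩ := hF.exists_convex ((finite_range A).isCompact_convexHull ℝ)
    (convex_convexHull ℝ _)
  refine ⟨U, hU, hUc, hFU, hUP, ?_⟩
  have hcorner : ∀ i, ∃ z b c d σ, IsTriangleCorner P U (A i) (A (i + 1)) (A (i + 2)) z b c d σ :=
    fun i => exists_isTriangleCorner hP hU hUc hUP (hA.smul_sub_add_smul_sub i)
      (by rwa [convexHull_range_fin_three]) (by rw [convexHull_range_fin_three]; exact hF.1)
  choose z b c d σ h using hcorner
  -- By the deficit condition the face angles at the three vertices, and so the angles of the three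
  -- trihedral angles, add up to at least `11 * π / 2`. The angles of the triangle contribute `π`;
  -- so at one vertex the other two angles add up to at least a third of `9 * π / 2`.
  obtain ⟨i, hi⟩ : ∃ i, 3 * Real.pi / 2 ≤
      InnerProductGeometry.angle (A (i + 1) - A i) (-z i) +
        InnerProductGeometry.angle (A (i + 2) - A i) (-z i) := by
    by_contra! hlt
    have h1 := Finset.sum_le_sum fun i (_ : i ∈ Finset.univ) => (h i).finsum_faceAngle_le hP
    have h2 := Finset.sum_lt_sum_of_nonempty Finset.univ_nonempty
      fun i (_ : i ∈ Finset.univ) => hlt i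
    have h3 := sum_angle_eq_pi hA
    simp only [angleDeficit, Finset.sum_add_distrib, Finset.sum_sub_distrib, Finset.sum_const,
      Finset.card_univ, Fintype.card_fin, nsmul_eq_mul, Nat.cast_ofNat] at h1 h2 hdeficit
    linarith
  have hc := h i
  obtain ⟨δ₁, hδ₁, hsmall⟩ := hc.exists_isSmallHeight hP
  obtain ⟨δ₂, hδ₂, hedges⟩ := hc.exists_edges_lt hi
  obtain ⟨n, m, hn, hm, hnm, hmC, ⟨κ, hκ, hnd⟩, hrot⟩ := hc.exists_rotation
  obtain ⟨ε, hε, hε'⟩ := hrot (min δ₁ δ₂) (lt_min hδ₁ hδ₂)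
  have hnx : ∀ x, inner ℝ n (x - A (i + 1)) = κ * d i (x - A i) := fun x => by
    rw [hnd, ← sub_sub_sub_cancel_right x (A (i + 1)) (A i), map_sub, hc.d_B, sub_zero]
  have hrot0 : rotatedHalfspace (A (i + 1)) n m 0 = hsp (d i) (A i) := by
    ext x
    rw [rotatedHalfspace, mem_ofPred_eq, Real.cos_zero, Real.sin_zero, one_smul, zero_smul,
      add_zero, hnx, mem_hsp]
    exact ⟨fun h' => nonpos_of_mul_nonpos_right h' hκ,
      fun h' => mul_nonpos_of_nonneg_of_nonpos hκ.le h'⟩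
  refine ⟨i, n, m, ⟨hn, hm, hnm, fun j => ?_, fun x hx => ?_, hmC⟩, ?_, ε, hε, fun θ hθ => ?_⟩
  · have hj : d i (A j - A i) = 0 := by
      have : ∀ i j : Fin 3, j = i ∨ j = i + 1 ∨ j = i + 2 := by decide
      rcases this i j with rfl | rfl | rfl
      · simp
      · exact hc.d_B
      · exact hc.d_C
    rw [hnx, hj, mul_zero]
  · rw [hnx]
    exact mul_nonpos_of_nonneg_of_nonpos hκ.le (hc.d_nonpos hP hx)
  · refine sdiff_union_inter_of_inter_eq ?_ rfl
    rw [hrot0, ← sInter_insert, insert_sdiff_singleton, insert_eq_of_mem hc.mem_d, ← hc.inter_eq hP]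
  · obtain ⟨t, ht, hrt⟩ := hε' θ hθ
    have hs := hsmall t ⟨ht.1, ht.2.trans (min_le_left _ _)⟩
    have he : rotateFace P U (A (i + 1)) n m θ = P ∪ tetra (A i) (b i) (c i) (d i) t := by
      refine sdiff_union_inter_of_inter_eq ?_ ?_
      · rw [hrot0, hrt, ← hc.inter_union_eq hP hs]
      · rw [union_sdiff_distrib, sdiff_eq_empty.2 hs.tetra_subset, union_empty]
    rw [he]
    exact ⟨hc.isPolyhedron_union hP hs, hc.encard_faces_union hP hs,
      hc.melzakRatio_union_lt hP hs (hedges t ⟨ht.1, ht.2.trans (min_le_right _ _)⟩)⟩
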